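/- Let $\mathbb{T}$ be the circle group. For an abelian compact Lie group $A$, write $A^*=\mathrm{Hom}(A,\mathbb{T})$ for its (multiplicative) group of characters, with trivial character $\epsilon$. An $A$-equivariant formal group law (Cole--Greenlees--Kriz) is a quintuple $(k,R,\Delta,\theta,y(\epsilon))$ of a commutative ring $k$, a commutative complete topological $k$-algebra $R$, a continuous map of $k$-algebras $\Delta\colon R\to R\hat\otimes_k R$, a map of $k$-algebras $\theta=(\theta(V))_{V\in A^*}\colon R\to k^{A^*}$ and an element $y(\epsilon)\in R$ such that: $\Delta$ is cocommutative, coassociative and counital for $\theta(\epsilon)$; $\theta$ is compatible with the coproducts, i.e. $(\theta(V)\hat\otimes\theta(W))\circ\Delta=\theta(VW)$; the finite products of the ideals $\ker\theta(V)$, $V\in A^*$, form a basis of neighbourhoods of $0$ in $R$; and $y(\epsilon)$ is regular and generates $\ker\theta(\epsilon)$. A morphism is a pair of ring maps $k\to k'$ and $R\to R'$ (the latter continuous) preserving all the structure. The Euler class of $V\in A^*$ is $e_V=\theta(V)(y(\epsilon))\in k$. The category of $A$-equivariant formal group laws has an initial object; its ground ring is the $A$-equivariant Lazard ring $L_A$,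 and $e_V\in L_A$ denotes the Euler class of the initial object. If $B\subseteq A$ is a closed subgroup, a $B$-equivariant formal group law becomes an $A$-equivariant one over the same rings by composing $\theta$ with the map $k^{B^*}\to k^{A^*}$ induced by the surjective restriction of characters $A^*\to B^*$; the resulting map $L_A\to L_B$ is denoted by $\mathrm{res}^A_B$. The rings $L_A$ together form the global Lazard ring. **Proposition.** The global Lazard ring exists and is $2$-regular. That is, for every abelian compact Lie group $A$ the category of $A$-equivariant formal group laws has an initial object, so that $L_A$ is defined, and the following two (equivalent) conditions hold. 1. For every torus $T\cong\mathbb{T}^r$ ($r\ge 0$), the Euler class $e_V\in L_T$ of every non-trivial character $V\in T^*$ is a regular element; and for every $l\le 2$ and all linearly independent characters $V_1,\dots,V_l\in T^*$, the sequence $(e_{V_1},\dots,e_{V_l})$ is regular in $L_T$ (each $e_{V_i}$ is a non-zero-divisor modulo the preceding ones, and $L_T/(e_{V_1},\dots,e_{V_l})\neq 0$). 2. For every group $A\cong\mathbb{T}^r\times C_n$ with $r\ge 0$ and $n\ge 1$ (where $C_n$ is the cyclic group of order $n$) and every surjective character $V\colon A\to\mathbb{T}$, every character of $\ker V$ extends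 to $A$, the Euler class $e_V\in L_A$ is a regular element, and the sequence $$0\to L_A\xrightarrow{\;e_V\cdot\;}L_A\xrightarrow{\;\mathrm{res}^A_{\ker V}\;}L_{\ker V}\to 0$$ is exact. -/

import Mathlib

open scoped TensorProduct Topology

universe u v w

noncomputable section

/-! ### Completed tensor products and continuous comultiplications -/

/-- The open ideals of a topological ring. -/
def OpenIdeal (R : Type u) [CommRing R] [TopologicalSpace R] : Type u :=
  {J : Ideal R // IsOpen (J : Set R)}

/-- The preimage of an open ideal under a continuous ring map. -/
def OpenIdeal.comap {R R' : Type u} [CommRing R] [CommRing R'] [TopologicalSpace R]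
    [TopologicalSpace R'] (f : R →+* R') (hf : Continuous f) (J : OpenIdeal R') : OpenIdeal R :=
  ⟨J.1.comap f, J.2.preimage hf⟩

/-- A topological ring `R` is (linearly) complete: the canonical map from `R` to the inverse limit
of the discrete quotients `R ⧸ J`, over all open ideals `J`, is bijective. -/
structure IsLinearlyComplete (R : Type u) [CommRing R] [TopologicalSpace R] : Prop where
  separated : ∀ x : R, (∀ J : OpenIdeal R, x ∈ J.1) → x = 0
  complete : ∀ x : OpenIdeal R → R,
    (∀ J J' : OpenIdeal R, J.1 ≤ J'.1 → x J - x J' ∈ J'.1) →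
      ∃ y : R, ∀ J : OpenIdeal R, y - x J ∈ J.1

section Comultiplication

variable (k : Type u) (R : Type u) [CommRing k] [CommRing R] [Algebra k R] [TopologicalSpace R]

/-- The completed tensor product `R ⊗̂ R` over the discrete ring `k`: the inverse limit of the
rings `(R ⧸ J) ⊗ (R ⧸ K)` over all pairs of open ideals `J`, `K` of `R`, realized as the ring of
compatible families. -/
def CompletedTensor :
    Subalgebra k (∀ p : OpenIdeal R × OpenIdeal R, (R ⧸ p.1.1) ⊗[k] (R ⧸ p.2.1)) where
  carrier := {x | ∀ (p q : OpenIdeal R × OpenIdeal R) (h₁ : p.1.1 ≤ q.1.1) (h₂ : p.2.1 ≤ q.2.1),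
    Algebra.TensorProduct.map (Ideal.Quotient.factorₐ k h₁) (Ideal.Quotient.factorₐ k h₂) (x p)
      = x q}
  mul_mem' := by
    intro a b ha hb p q h₁ h₂
    simp only [Pi.mul_apply, map_mul, ha p q h₁ h₂, hb p q h₁ h₂]
  add_mem' := by
    intro a b ha hb p q h₁ h₂
    simp only [Pi.add_apply, map_add, ha p q h₁ h₂, hb p q h₁ h₂]
  algebraMap_mem' := by
    intro c p q h₁ h₂
    simp only [Pi.algebraMap_apply, AlgHom.commutes]

variable {k R}
variable (Δ : R →ₐ[k] CompletedTensor k R)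

/-- The component `Δ_{J,K} : R → (R ⧸ J) ⊗ (R ⧸ K)` of a map `Δ : R → R ⊗̂ R`. -/
def comulComponent (J K : OpenIdeal R) : R →ₐ[k] (R ⧸ J.1) ⊗[k] (R ⧸ K.1) :=
  ((Pi.evalAlgHom k (fun p : OpenIdeal R × OpenIdeal R => (R ⧸ p.1.1) ⊗[k] (R ⧸ p.2.1))
    (J, K)).comp (CompletedTensor k R).val).comp Δ

/-- `Δ : R → R ⊗̂ R` is continuous for the inverse limit topology on `R ⊗̂ R`, where each
`(R ⧸ J) ⊗ (R ⧸ K)` is discrete: every component has open kernel. -/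
def ComulContinuous : Prop :=
  ∀ J K : OpenIdeal R, IsOpen (RingHom.ker (comulComponent Δ J K) : Set R)

/-- Cocommutativity of `Δ`, checked on all components of `R ⊗̂ R`. -/
def ComulCocommutative : Prop :=
  ∀ (J K : OpenIdeal R) (x : R),
    Algebra.TensorProduct.comm k (R ⧸ J.1) (R ⧸ K.1) (comulComponent Δ J K x)
      = comulComponent Δ K J x

variable {Δ}

/-- The kernel of a component of a continuous comultiplication, as an open ideal. -/
def comulKer (hΔ : ComulContinuous Δ) (J K : OpenIdeal R) : OpenIdeal R :=
  ⟨RingHom.ker (comulComponent Δ J K), hΔ J K⟩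

/-- The map `R ⧸ ker Δ_{J,K} → (R ⧸ J) ⊗ (R ⧸ K)` induced by `Δ_{J,K}`. -/
def comulBar (hΔ : ComulContinuous Δ) (J K : OpenIdeal R) :
    (R ⧸ (comulKer hΔ J K).1) →ₐ[k] (R ⧸ J.1) ⊗[k] (R ⧸ K.1) :=
  Ideal.kerLiftAlg (comulComponent Δ J K)

/-- Coassociativity `(Δ ⊗̂ id) ∘ Δ = (id ⊗̂ Δ) ∘ Δ`, checked on all components
`(R ⧸ J) ⊗ (R ⧸ K) ⊗ (R ⧸ L)` of `R ⊗̂ R ⊗̂ R`. The `(J, K, L)`-component of `Δ ⊗̂ id` is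
the projection to `(R ⧸ ker Δ_{J,K}) ⊗ (R ⧸ L)` followed by the map induced by
`Δ_{J,K} ⊗ id`. -/
def ComulCoassociative (hΔ : ComulContinuous Δ) : Prop :=
  ∀ (J K L : OpenIdeal R) (x : R),
    Algebra.TensorProduct.assoc k k k (R ⧸ J.1) (R ⧸ K.1) (R ⧸ L.1)
        (Algebra.TensorProduct.map (comulBar hΔ J K) (AlgHom.id k (R ⧸ L.1))
          (comulComponent Δ (comulKer hΔ J K) L x))
      = Algebra.TensorProduct.map (AlgHom.id k (R ⧸ J.1)) (comulBar hΔ K L)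
          (comulComponent Δ J (comulKer hΔ K L) x)

variable (Δ)

/-- The composite `(f ⊗̂ g) ∘ Δ : R → R ⊗̂ R → k` for two algebra maps `f`, `g : R → k` with
open kernel. -/
def convolve (f g : R →ₐ[k] k) (hf : IsOpen (RingHom.ker f : Set R))
    (hg : IsOpen (RingHom.ker g : Set R)) : R →ₐ[k] k :=
  (Algebra.TensorProduct.productMap (Ideal.kerLiftAlg f) (Ideal.kerLiftAlg g)).comp
    (comulComponent Δ ⟨RingHom.ker f, hf⟩ ⟨RingHom.ker g, hg⟩)

/-- The `K`-component `R → R ⧸ K` of the composite `(f ⊗̂ id) ∘ Δ : R → R ⊗̂ R → R`, for an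
algebra map `f : R → k` with open kernel. -/
def leftTranslate (f : R →ₐ[k] k) (hf : IsOpen (RingHom.ker f : Set R)) (K : OpenIdeal R) :
    R →ₐ[k] R ⧸ K.1 :=
  (Algebra.TensorProduct.productMap ((Algebra.ofId k (R ⧸ K.1)).comp (Ideal.kerLiftAlg f))
    (AlgHom.id k (R ⧸ K.1))).comp (comulComponent Δ ⟨RingHom.ker f, hf⟩ K)

end Comultiplication

/-- If the finite products of the kernels of a family of maps form a basis of neighbourhoods of
zero, then each of these kernels is open. -/
theorem isOpen_ker_of_hasBasis {k R : Type u} {D : Type v} [CommRing k] [CommRing R] [Algebra k R]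
    [TopologicalSpace R] [IsTopologicalRing R] {θ : D → R →ₐ[k] k}
    (h : (𝓝 (0 : R)).HasBasis (fun _ : Multiset D => True)
      (fun s => ((s.map fun V => RingHom.ker (θ V)).prod : Set R))) (V : D) :
    IsOpen (RingHom.ker (θ V) : Set R) := by
  refine (RingHom.ker (θ V)).toAddSubgroup.isOpen_of_mem_nhds (g := 0) ?_
  have := h.mem_of_mem (i := {V}) trivial
  simpa using this

/-! ### Equivariant formal group laws -/

/-- An equivariant formal group law `(k, R, Δ, θ, y(ε))`. The only input from the abelian compact
Lie group `A` is its character group `D = A^* = Hom(A, 𝕋)`, written multiplicatively, with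
trivial character `ε = 1`. The map `θ : R → k^{A^*}` is given by its components `θ(V)`. -/
structure EquivariantFGL (D : Type v) [CommGroup D] where
  /-- the ground ring -/
  k : Type u
  /-- the complete topological algebra -/
  R : Type u
  [commRing_k : CommRing k]
  [commRing_R : CommRing R]
  [algebra : Algebra k R]
  [topology : TopologicalSpace R]
  [topRing : IsTopologicalRing R]
  complete : IsLinearlyComplete R
  /-- the comultiplication -/
  Δ : R →ₐ[k] CompletedTensor k R
  /-- the augmentations -/
  θ : D → R →ₐ[k] k
  /-- the orientation `y(ε)` -/
  y : R
  comul_continuous : ComulContinuous Δ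
  comul_cocomm : ComulCocommutative Δ
  comul_coassoc : ComulCoassociative comul_continuous
  /-- the topology on `R` is generated by the finite products of the ideals `ker θ(V)` -/
  basis : (𝓝 (0 : R)).HasBasis (fun _ : Multiset D => True)
    (fun s => ((s.map fun V => RingHom.ker (θ V)).prod : Set R))
  /-- `θ(ε)` is a counit: `(θ(ε) ⊗̂ id) ∘ Δ = id` -/
  counit : ∀ (K : OpenIdeal R) (x : R),
    leftTranslate Δ (θ 1) (isOpen_ker_of_hasBasis basis 1) K x = Ideal.Quotient.mk K.1 x
  /-- `θ` is compatible with the coproducts, where the coproduct on `k^{A^*}` is dual to the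
  multiplication of `A^*`: `(θ(V) ⊗̂ θ(W)) ∘ Δ = θ(VW)` -/
  theta_mul : ∀ V W : D,
    convolve Δ (θ V) (θ W) (isOpen_ker_of_hasBasis basis V) (isOpen_ker_of_hasBasis basis W)
      = θ (V * W)
  y_regular : IsRegular y
  y_span : RingHom.ker (θ 1) = Ideal.span {y}

namespace EquivariantFGL

attribute [instance] commRing_k commRing_R algebra topology topRing

variable {D : Type v} [CommGroup D] {E : Type w} [CommGroup E]

/-- The Euler class `e_V = θ(V)(y(ε))` in the ground ring. -/
def euler (F : EquivariantFGL.{u} D) (V : D) : F.k := F.θ V F.y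

/-- For `f₁ : k → k'` and `f₂ : R → R'` compatible with the algebra structures and ideals `J ≤
f₂⁻¹(J')`, the `f₁`-semilinear map `R ⧸ J → R' ⧸ J'` induced by `f₂`. -/
def quotMap {k k' R R' : Type*} [CommRing k] [CommRing k'] [CommRing R] [CommRing R'] [Algebra k R]
    [Algebra k' R'] (f₁ : k →+* k') (f₂ : R →+* R')
    (h : ∀ c, f₂ (algebraMap k R c) = algebraMap k' R' (f₁ c)) (J : Ideal R) (J' : Ideal R')
    (hJ : J ≤ J'.comap f₂) : (R ⧸ J) →ₛₗ[f₁] (R' ⧸ J') where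
  toFun := Ideal.quotientMap J' f₂ hJ
  map_add' := map_add _
  map_smul' := by
    intro c x
    obtain ⟨x, rfl⟩ := Ideal.Quotient.mk_surjective x
    rw [Algebra.smul_def, Algebra.smul_def, map_mul, ← Ideal.Quotient.mk_algebraMap,
      ← Ideal.Quotient.mk_algebraMap, Ideal.quotientMap_mk, h]

/-- A morphism of equivariant formal group laws: a pair of ring maps `f₁ : k → k'` and
`f₂ : R → R'` (the latter continuous) preserving all the structure. -/
structure Hom (F G : EquivariantFGL.{u} D) where
  /-- the map `f₁` of ground rings -/
  base : F.k →+* G.k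
  /-- the map `f₂` of complete algebras -/
  total : F.R →+* G.R
  continuous_total : Continuous total
  map_algebraMap : ∀ c, total (algebraMap F.k F.R c) = algebraMap G.k G.R (base c)
  map_theta : ∀ (V : D) (x : F.R), G.θ V (total x) = base (F.θ V x)
  map_y : total F.y = G.y
  /-- `Δ' ∘ f₂ = (f₂ ⊗̂ f₂) ∘ Δ`, on every component of `R' ⊗̂ R'` -/
  map_comul : ∀ (J K : OpenIdeal G.R) (x : F.R),
    comulComponent G.Δ J K (total x) =
      TensorProduct.map
        (quotMap base total map_algebraMap (J.1.comap total) J.1 le_rfl)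
        (quotMap base total map_algebraMap (K.1.comap total) K.1 le_rfl)
        (comulComponent F.Δ (OpenIdeal.comap total continuous_total J)
          (OpenIdeal.comap total continuous_total K) x)

/-- `F` is universal, i.e. an initial object in the category of equivariant formal group laws.
Then the ground ring of `F` is the equivariant Lazard ring. -/
def IsUniversal (F : EquivariantFGL.{u} D) : Prop :=
  ∀ G : EquivariantFGL.{u} D, Nonempty (Unique (Hom F G))

/-- The pushforward of a `B`-equivariant formal group law along the inclusion `i : B → A` of a
subgroup, where `q = i^* : A^* → B^*` is the (surjective) restriction of characters: the only
change is that `θ` is replaced by its composite with `q`. -/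
def pushforward (q : D →* E) (hq : Function.Surjective q) (F : EquivariantFGL.{u} E) :
    EquivariantFGL.{u} D where
  k := F.k
  R := F.R
  complete := F.complete
  Δ := F.Δ
  θ := fun V => F.θ (q V)
  y := F.y
  comul_continuous := F.comul_continuous
  comul_cocomm := F.comul_cocomm
  comul_coassoc := F.comul_coassoc
  basis := by
    refine F.basis.to_hasBasis (fun s _ => ?_) (fun s _ => ⟨s.map q, trivial, ?_⟩)
    · obtain ⟨t, rfl⟩ := Multiset.map_surjective_of_surjective hq s
      exact ⟨t, trivial, by simp⟩
    · simp
  counit := by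
    intro K x
    have h : ∀ (W : E) (hW : W = 1) (ho : IsOpen (RingHom.ker (F.θ W) : Set F.R)),
        leftTranslate F.Δ (F.θ W) ho K x = Ideal.Quotient.mk K.1 x := by
      rintro W rfl ho
      exact F.counit K x
    exact h _ (map_one q) _
  theta_mul := by
    intro V W
    rw [map_mul]
    exact F.theta_mul (q V) (q W)
  y_regular := F.y_regular
  y_span := by
    rw [map_one]
    exact F.y_span

/-- The restriction map of equivariant Lazard rings `i^* : L_A → L_B` along a subgroup inclusion
`i : B → A` (with `q = i^* : A^* → B^*`): the map of ground rings underlying the unique morphism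
from the universal `A`-equivariant formal group law `F` to the pushforward of the universal
`B`-equivariant formal group law `G`. -/
def IsUniversal.restriction {F : EquivariantFGL.{u} D} (hF : F.IsUniversal) (q : D →* E)
    (hq : Function.Surjective q) (G : EquivariantFGL.{u} E) : F.k →+* G.k :=
  (hF (pushforward q hq G)).some.default.base

end EquivariantFGL

/-! ### Abelian compact Lie groups -/

/-- The torus `𝕋^r`. -/
abbrev StdTorus (r : ℕ) : Type := Fin r → Circle

/-- The group `C_n` of `n`-th roots of unity in the circle, for `n ≥ 1`. -/
abbrev RootsOfUnityGroup (n : ℕ) : Subgroup Circle := (powMonoidHom n : Circle →* Circle).ker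

/-- Abelian compact Lie groups: topological groups isomorphic to the product of a torus and a
finite discrete abelian group. -/
def IsAbelianCompactLie (A : Type v) [CommGroup A] [TopologicalSpace A] : Prop :=
  ∃ (r : ℕ) (C : Type) (_ : CommGroup C) (_ : TopologicalSpace C) (_ : DiscreteTopology C)
    (_ : Finite C), Nonempty (A ≃ₜ* StdTorus r × C)

/-- The restriction of characters `A^* → B^*` to a subgroup `B` of `A`. -/
def restrictCharacters {A : Type v} [CommGroup A] [TopologicalSpace A] (B : Subgroup A) :
    PontryaginDual A →* PontryaginDual B :=
  (PontryaginDual.map (⟨B.subtype, continuous_subtype_val⟩ : B →ₜ* A)).toMonoidHom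

/-- The kernel of a character of `A`, as a subgroup of `A`. -/
def characterKernel {A : Type v} [CommGroup A] [TopologicalSpace A] (V : PontryaginDual A) :
    Subgroup A :=
  MonoidHom.ker (V : A →* Circle)

end

/-! The proof dualizes. The continuous functionals on the complete ring of an equivariant formal
group law form a cocommutative bialgebra `C` over `k`. The augmentations are grouplike elements `g
V` of `C`. The cap product with evaluation at y(ε) is onto with kernel spanned by 1, and its
conjugates by the `g V` are commuting operators, finite products of which kill any given element.
Conversely, the dual of such a bialgebra (`CovFGL`) is an equivariant formal group law
(`CovFGL.realization`).

Once the normalized section `Z` of the cap product is named, the structure on `C` consists of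
operations subject to identities. The comultiplication is recovered from the operators
(`CofreeOps.comul`), and nilpotence is bounded term by term (`CovTerm.Yl_bound`). A universal object
is therefore the algebra of terms modulo the identities valid in all models. The Lazard ring
`UnivC.L` is the image of its counit, and `UnivC.isUniversal_fgl` gives existence.

Exactness comes from g_V = 1 + e_V Z(g_V). Modulo e_V the element g_V becomes 1, so the universal
model descends to the quotient of the character group by V (`UnivC.res_ker`). That V generates the
kernel of restriction to ker V, and that all characters of ker V extend, follows from
Stone–Weierstrass and Haar measure (`eq_top_of_separatesPoints`).

Regularity of e_W, for W of infinite order in a finitely generated group, is the core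
(`UnivC.eq_zero_of_mul_euler`). Choose a surjective degree φ to ℤ with φ(W) = m > 0, use induction
on m, and let x e_W = 0. Invert the Euler classes of characters of degree not divisible by m, and
adjoin ω with ω² = e_W ω. The unit z = 1 + ω Z(g_W) is grouplike and interpolates between 1 (at ω =
0) and g_W (at ω = e_W). Divide the characters of degree divisible by m by the corresponding powers
of z, and induce back to all characters by adjoining an m-th root. This gives a model with Euler
class e_W − ω at W that specializes to the original one at ω = 0 (`CovFGL.exists_split`). Since (a +
bω)(e_W − ω) has ω-coefficient −a, x dies in the localization, so a product of inverted Euler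
classes kills x. As x e_W = 0, each of them may be shifted by a power of W to a degree strictly
between 0 and m, where the induction hypothesis cancels it.

A pair (e_V, e_W) of independent characters reduces to one character of infinite order in the
quotient by V. The quotient rings are nonzero because the additive group over ℚ, with trivial
augmentations, kills every Euler class. -/

noncomputable section

/-! ### Coalgebras from commuting locally nilpotent operators -/

/-- Commuting operators `Y V` on a module with sections `Z V`, such that the kernel of `Y V` is spanned by
`g V` and every element is killed by a finite product of the operators `Y V`. -/
structure CofreeOps (k : Type u) (C : Type v) (D : Type w) [CommRing k] [AddCommGroup C]
    [Module k C] where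
  ε : C →ₗ[k] k
  Y : D → Module.End k C
  Z : D → Module.End k C
  g : D → C
  Y_comm : ∀ V W c, Y V (Y W c) = Y W (Y V c)
  Y_Z : ∀ V c, Y V (Z V c) = c
  Z_Y : ∀ V c, Z V (Y V c) = c - ε c • g V
  ε_g : ∀ V, ε (g V) = 1
  nil : ∀ c, ∃ s : List D, (s.map Y).prod c = 0

namespace CofreeOps

variable {k : Type u} {C : Type v} {D : Type w} [CommRing k] [AddCommGroup C] [Module k C]
variable (O : CofreeOps k C D)

/-- The product of the operators `Y V` over a list. -/
def Ys (s : List D) : Module.End k C := (s.map O.Y).prod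

@[simp] lemma Ys_nil (c : C) : O.Ys [] c = c := rfl

@[simp] lemma Ys_cons (V : D) (s : List D) (c : C) : O.Ys (V :: s) c = O.Y V (O.Ys s c) := by
  simp [Ys]

lemma Ys_append (s t : List D) (c : C) : O.Ys (s ++ t) c = O.Ys s (O.Ys t c) := by
  simp [Ys]

lemma Y_Ys (V : D) (s : List D) (c : C) : O.Y V (O.Ys s c) = O.Ys s (O.Y V c) := by
  induction s with
  | nil => rfl
  | cons W s ih => rw [Ys_cons, Ys_cons, O.Y_comm, ih]

lemma Ys_comm (s t : List D) (c : C) : O.Ys s (O.Ys t c) = O.Ys t (O.Ys s c) := by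
  induction s with
  | nil => rfl
  | cons W s ih => rw [Ys_cons, Ys_cons, ih, Y_Ys]

lemma exists_Ys (c : C) : ∃ s : List D, O.Ys s c = 0 := O.nil c

/-- Comparing `Z_Y` at `Z V c` with `Y_Z` leaves `ε (Z V c) • g V = 0`, and `ε` sends `g V` to 1.
The section is thus the one normalized by the augmentation. -/
lemma ε_Z (V : D) (c : C) : O.ε (O.Z V c) = 0 := by
  have h := O.Z_Y V (O.Z V c)
  rw [O.Y_Z] at h
  have h2 := congrArg O.ε (sub_eq_self.mp h.symm)
  simpa [O.ε_g] using h2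

lemma Y_g (V : D) : O.Y V (O.g V) = 0 := by
  have h := congrArg (O.Y V) (O.Z_Y V (O.g V))
  rw [O.Y_Z, map_sub, O.ε_g, one_smul, sub_self] at h
  exact h

lemma eq_add (V : D) (c : C) : c = O.Z V (O.Y V c) + O.ε c • O.g V := by
  rw [O.Z_Y, sub_add_cancel]

/-- The functionals `ε ∘ Y_s`. -/
def τ (s : List D) : C →ₗ[k] k := O.ε ∘ₗ O.Ys s

lemma τ_apply (s : List D) (c : C) : O.τ s c = O.ε (O.Ys s c) := rfl

lemma exists_rTensor_Ys {N : Type*} [AddCommGroup N] [Module k N] (w : C ⊗[k] N) :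
    ∃ s : List D, (O.Ys s).rTensor N w = 0 := by
  induction w using TensorProduct.induction_on with
  | zero => exact ⟨[], map_zero _⟩
  | tmul c n =>
    obtain ⟨s, hs⟩ := O.exists_Ys c
    exact ⟨s, by simp [hs]⟩
  | add a b ha hb =>
    obtain ⟨s, hs⟩ := ha
    obtain ⟨t, ht⟩ := hb
    refine ⟨s ++ t, ?_⟩
    have h1 : O.Ys (s ++ t) = O.Ys s ∘ₗ O.Ys t := LinearMap.ext (O.Ys_append s t)
    have h2 : O.Ys (s ++ t) = O.Ys t ∘ₗ O.Ys s :=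
      LinearMap.ext fun c => (O.Ys_append s t c).trans (O.Ys_comm s t c)
    have h3 : (O.Ys (s ++ t)).rTensor N a = 0 := by
      rw [h2, LinearMap.rTensor_comp_apply, hs, map_zero]
    have h4 : (O.Ys (s ++ t)).rTensor N b = 0 := by
      rw [h1, LinearMap.rTensor_comp_apply, ht, map_zero]
    rw [map_add, h3, h4, add_zero]

/-- The functionals `ε ∘ Y_s` separate the elements of `C ⊗ N`. -/
lemma tensor_eq_zero {N : Type*} [AddCommGroup N] [Module k N] {w : C ⊗[k] N}
    (h : ∀ t, (O.τ t).rTensor N w = 0) : w = 0 := by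
  obtain ⟨s, hs⟩ := O.exists_rTensor_Ys w
  induction s generalizing w with
  | nil =>
    have : O.Ys ([] : List D) = LinearMap.id := rfl
    simpa [this] using hs
  | cons V s ih =>
    have h0 : (O.Y V).rTensor N w = 0 := by
      refine ih (fun t => ?_) ?_
      · rw [← LinearMap.rTensor_comp_apply]
        have : O.τ t ∘ₗ O.Y V = O.τ (t ++ [V]) := by
          ext c; simp [τ_apply, Ys_append]
        rw [this]; exact h _
      · rw [← LinearMap.rTensor_comp_apply]
        have : O.Ys s ∘ₗ O.Y V = O.Ys (V :: s) := by
          ext c; simp [Y_Ys]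
        rw [this]; exact hs
    -- The splitting id = Z Y + ε·g is an identity of linear maps, so it survives tensoring with any
    -- `N`; no flatness is needed.
    have h1 : (LinearMap.id : C →ₗ[k] C)
        = O.Z V ∘ₗ O.Y V + (LinearMap.toSpanSingleton k C (O.g V)) ∘ₗ O.τ [] := by
      ext c
      exact O.eq_add V c
    have h2 := congrArg (fun f => f.rTensor N w) h1
    simp only [LinearMap.rTensor_id, LinearMap.id_apply, LinearMap.rTensor_add,
      LinearMap.add_apply, LinearMap.rTensor_comp_apply, h0, h [], map_zero, add_zero] at h2
    exact h2

lemma eq_zero {c : C} (h : ∀ t, O.ε (O.Ys t c) = 0) : c = 0 := by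
  have : c ⊗ₜ[k] (1 : k) = 0 := O.tensor_eq_zero (fun t => by simp [τ_apply, h])
  simpa using congrArg (TensorProduct.rid k C) this

/-- Contract one factor, swap, and apply the one-sided criterion to the other factor. -/
lemma tensor_eq_zero' {w : C ⊗[k] C}
    (h : ∀ s t, TensorProduct.map (O.τ s) (O.τ t) w = 0) : w = 0 := by
  refine O.tensor_eq_zero fun s => ?_
  have : TensorProduct.comm k k C ((O.τ s).rTensor C w) = 0 := by
    refine O.tensor_eq_zero fun t => ?_
    have h1 : (O.τ t).rTensor k (TensorProduct.comm k k C ((O.τ s).rTensor C w))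
        = TensorProduct.comm k k k (TensorProduct.map (O.τ s) (O.τ t) w) := by
      have : (O.τ t).rTensor k ∘ₗ (TensorProduct.comm k k C).toLinearMap ∘ₗ (O.τ s).rTensor C
          = (TensorProduct.comm k k k).toLinearMap ∘ₗ TensorProduct.map (O.τ s) (O.τ t) :=
        TensorProduct.ext' fun a b => rfl
      exact LinearMap.congr_fun this w
    rw [h1, h, map_zero]
  simpa using this

/-- The product functional `(ε ∘ Y_s) ⊗ (ε ∘ Y_t)` on `C ⊗ C`. -/
def τ₂ (s t : List D) : C ⊗[k] C →ₗ[k] k :=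
  LinearMap.mul' k k ∘ₗ TensorProduct.map (O.τ s) (O.τ t)

@[simp] lemma τ₂_tmul (s t : List D) (a b : C) : O.τ₂ s t (a ⊗ₜ b) = O.τ s a * O.τ t b := rfl

lemma ext₂ {w w' : C ⊗[k] C} (h : ∀ s t, O.τ₂ s t w = O.τ₂ s t w') : w = w' := by
  rw [← sub_eq_zero]
  refine O.tensor_eq_zero' fun s t => ?_
  apply (TensorProduct.lid k k).injective
  have h1 : ∀ x : k ⊗[k] k, TensorProduct.lid k k x = LinearMap.mul' k k x := fun x => by
    induction x using TensorProduct.induction_on <;> simp_all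
  rw [map_zero, h1]
  exact (map_sub (O.τ₂ s t) w w').trans (sub_eq_zero.mpr (h s t))

/-- The contraction `(h ⊗ id) : C ⊗ C → C`. -/
def contract (h : C →ₗ[k] k) : C ⊗[k] C →ₗ[k] C :=
  (TensorProduct.lid k C).toLinearMap ∘ₗ h.rTensor C

@[simp] lemma contract_tmul (h : C →ₗ[k] k) (a b : C) : contract h (a ⊗ₜ b) = h a • b := rfl

lemma τ_contract (s t : List D) (w : C ⊗[k] C) : O.τ t (contract (O.τ s) w) = O.τ₂ s t w := by
  have : O.τ t ∘ₗ contract (O.τ s) = O.τ₂ s t := TensorProduct.ext' fun a b => by simp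
  exact LinearMap.congr_fun this w

/-- The comultiplication on the kernel of `Y_s`. -/
def comulList : List D → C →ₗ[k] C ⊗[k] C
  | [] => 0
  -- Splitting the first factor of Δc as Z_V Y_V + ε·g_V, and using that Y_V on that factor of Δc is
  -- Δ(Y_V c), forces this recursion. On an element killed by the list, the recursion reaches the
  -- empty list at zero.
  | V :: s => TensorProduct.mk k C C (O.g V) + (O.Z V).rTensor C ∘ₗ comulList s ∘ₗ O.Y V

lemma contract_comulList_cons (h : C →ₗ[k] k) (V : D) (s : List D) (c : C) :
    contract h (O.comulList (V :: s) c)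
      = h (O.g V) • c + contract (h ∘ₗ O.Z V) (O.comulList s (O.Y V c)) := by
  simp only [comulList, LinearMap.add_apply, map_add, LinearMap.comp_apply, TensorProduct.mk_apply,
    contract_tmul]
  congr 1
  simp only [contract, LinearMap.comp_apply, LinearMap.rTensor_comp_apply]

/-- Along the recursion the second factor only undergoes operators `Y`, and these commute with one
another. -/
lemma Y_contract_comulList (h : C →ₗ[k] k) (V : D) (s : List D) (c : C) :
    O.Y V (contract h (O.comulList s c)) = contract h (O.comulList s (O.Y V c)) := by
  induction s generalizing h c with
  | nil => simp [comulList]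
  | cons W s ih =>
    rw [contract_comulList_cons, contract_comulList_cons, map_add, map_smul, ih, O.Y_comm]

lemma Ys_contract_comulList (h : C →ₗ[k] k) (t s : List D) (c : C) :
    O.Ys t (contract h (O.comulList s c)) = contract h (O.comulList s (O.Ys t c)) := by
  induction t with
  | nil => rfl
  | cons W t ih => rw [Ys_cons, Ys_cons, ih, Y_contract_comulList]

/-- One counit law, by induction through c = Z Y c + ε(c) g. The list must kill `c`, since otherwise
the recursion drops a nonzero remainder. -/
lemma ε_contract_comulList (h : C →ₗ[k] k) (s : List D) {c : C} (hc : O.Ys s c = 0) :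
    O.ε (contract h (O.comulList s c)) = h c := by
  induction s generalizing h c with
  | nil => simp_all [comulList]
  | cons W s ih =>
    rw [contract_comulList_cons, map_add, map_smul, ih _ (by simpa [Y_Ys] using hc)]
    conv_rhs => rw [O.eq_add W c]
    simp [add_comm, mul_comm]

lemma τ_contract_comulList (h : C →ₗ[k] k) (t s : List D) {c : C} (hc : O.Ys s c = 0) :
    O.τ t (contract h (O.comulList s c)) = h (O.Ys t c) := by
  rw [τ_apply, Ys_contract_comulList, ε_contract_comulList]
  rw [Ys_comm, hc, map_zero]

/-- The prescribed values do not mention the list that kills `c`. Together with `ext₂` they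
characterize the tensor, so different lists yield the same comultiplication. -/
lemma exists_comul (c : C) : ∃ w : C ⊗[k] C, ∀ s t, O.τ₂ s t w = O.ε (O.Ys s (O.Ys t c)) := by
  obtain ⟨r, hr⟩ := O.exists_Ys c
  exact ⟨O.comulList r c, fun s t => by rw [← τ_contract, τ_contract_comulList _ _ _ _ hr]; rfl⟩

/-- The comultiplication determined by the operators. -/
def comul : C →ₗ[k] C ⊗[k] C where
  toFun c := (O.exists_comul c).choose
  -- The list depends on the element, so additivity is read off from the characterizing values
  -- instead of from the recursion.
  map_add' a b := O.ext₂ fun s t => by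
    rw [map_add, (O.exists_comul _).choose_spec, (O.exists_comul _).choose_spec,
      (O.exists_comul _).choose_spec]
    simp only [map_add]
  map_smul' x a := O.ext₂ fun s t => by
    rw [map_smul, (O.exists_comul _).choose_spec, (O.exists_comul _).choose_spec]
    simp only [map_smul, RingHom.id_apply]

@[simp] lemma τ₂_comul (s t : List D) (c : C) : O.τ₂ s t (O.comul c) = O.ε (O.Ys s (O.Ys t c)) :=
  (O.exists_comul c).choose_spec s t

lemma comul_eq_comulList {s : List D} {c : C} (hc : O.Ys s c = 0) :
    O.comul c = O.comulList s c :=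
  O.ext₂ fun r t => by rw [τ₂_comul, ← τ_contract, τ_contract_comulList _ _ _ _ hc]; rfl

lemma Ys_contract_comul (h : C →ₗ[k] k) (t : List D) (c : C) :
    O.Ys t (contract h (O.comul c)) = contract h (O.comul (O.Ys t c)) := by
  obtain ⟨s, hs⟩ := O.exists_Ys c
  rw [O.comul_eq_comulList hs, Ys_contract_comulList, O.comul_eq_comulList]
  rw [Ys_comm, hs, map_zero]

lemma ε_contract_comul (h : C →ₗ[k] k) (c : C) : O.ε (contract h (O.comul c)) = h c := by
  obtain ⟨s, hs⟩ := O.exists_Ys c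
  rw [O.comul_eq_comulList hs, ε_contract_comulList _ _ _ hs]

/-- An operator commuting with the operators `Y V` is the contraction of the comultiplication with
its composite with the counit. -/
lemma contract_comul_eq (T : C →ₗ[k] C) (hT : ∀ V c, T (O.Y V c) = O.Y V (T c)) (c : C) :
    contract (O.ε ∘ₗ T) (O.comul c) = T c := by
  have hTs : ∀ t c, T (O.Ys t c) = O.Ys t (T c) := by
    intro t c
    induction t with
    | nil => rfl
    | cons V t ih => rw [Ys_cons, hT, ih, Ys_cons]
  rw [← sub_eq_zero]
  refine O.eq_zero fun t => ?_
  rw [map_sub, Ys_contract_comul, map_sub, ε_contract_comul, LinearMap.comp_apply, hTs, sub_self]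

lemma contract_τ_comul (s : List D) (c : C) : contract (O.τ s) (O.comul c) = O.Ys s c :=
  O.contract_comul_eq (O.Ys s) (fun V c => (O.Y_Ys V s c).symm) c

lemma comm_comul (c : C) : TensorProduct.comm k C C (O.comul c) = O.comul c := by
  refine O.ext₂ fun s t => ?_
  have : O.τ₂ s t ∘ₗ (TensorProduct.comm k C C).toLinearMap = O.τ₂ t s :=
    TensorProduct.ext' fun a b => by simp [mul_comm]
  rw [τ₂_comul, Ys_comm, ← τ₂_comul, ← this]
  rfl

/-- The coalgebra structure determined by the operators. -/
@[reducible]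
def coalgebra : Coalgebra k C where
  comul := O.comul
  counit := O.ε
  coassoc := by
    ext c
    simp only [LinearMap.comp_apply, LinearEquiv.coe_coe]
    rw [← sub_eq_zero]
    refine O.tensor_eq_zero fun r => ?_
    apply (TensorProduct.lid k (C ⊗[k] C)).injective
    rw [map_zero]
    refine O.ext₂ fun s t => ?_
    rw [map_zero, map_sub, map_sub, map_sub, sub_eq_zero]
    -- Paired with τ_r ⊗ τ_s ⊗ τ_t, both iterated comultiplications give ε(Y_r Y_s Y_t c).
    have h1 : (O.τ₂ s t ∘ₗ (TensorProduct.lid k (C ⊗[k] C)).toLinearMap ∘ₗ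
        (O.τ r).rTensor (C ⊗[k] C)) ∘ₗ (TensorProduct.assoc k C C C).toLinearMap ∘ₗ
          O.comul.rTensor C = O.τ₂ (r ++ s) t := by
      refine TensorProduct.ext' fun a b => ?_
      have h2 : ∀ w : C ⊗[k] C, O.τ₂ s t (TensorProduct.lid k (C ⊗[k] C)
          ((O.τ r).rTensor (C ⊗[k] C) (TensorProduct.assoc k C C C (w ⊗ₜ b))))
            = O.τ₂ r s w * O.τ t b := fun w => by
        induction w using TensorProduct.induction_on with
        | zero => simp
        | tmul x y => simp [mul_assoc]
        | add x y hx hy => simp only [TensorProduct.add_tmul, map_add, hx, hy, add_mul]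
      simp only [LinearMap.comp_apply, LinearMap.rTensor_tmul, LinearEquiv.coe_coe]
      rw [h2, τ₂_comul, τ₂_tmul, O.τ_apply (r ++ s), Ys_append]
    have h3 : (O.τ₂ s t ∘ₗ (TensorProduct.lid k (C ⊗[k] C)).toLinearMap ∘ₗ
        (O.τ r).rTensor (C ⊗[k] C)) ∘ₗ O.comul.lTensor C = O.τ₂ r (s ++ t) := by
      refine TensorProduct.ext' fun a b => ?_
      simp [τ_apply, Ys_append]
    have h4 := LinearMap.congr_fun h1 (O.comul c)
    have h5 := LinearMap.congr_fun h3 (O.comul c)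
    simp only [LinearMap.comp_apply, LinearEquiv.coe_coe] at h4 h5
    rw [h4, h5, τ₂_comul, τ₂_comul, Ys_append, Ys_append]
  rTensor_counit_comp_comul := by
    ext c
    apply (TensorProduct.lid k C).injective
    refine (O.contract_τ_comul [] c).trans ?_
    simp
  lTensor_counit_comp_comul := by
    ext c
    have h := O.contract_τ_comul [] c
    rw [← comm_comul] at h
    apply (TensorProduct.rid k C).injective
    have h1 : (TensorProduct.rid k C).toLinearMap ∘ₗ O.ε.lTensor C
        = contract O.ε ∘ₗ (TensorProduct.comm k C C).toLinearMap :=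
      TensorProduct.ext' fun a b => by simp
    have h2 := LinearMap.congr_fun h1 (O.comul c)
    simp only [LinearMap.comp_apply, LinearEquiv.coe_coe] at h2 ⊢
    rw [h2]
    refine Eq.trans ?_ (h.trans ?_)
    · rfl
    · simp

lemma isCocomm : letI := O.coalgebra; Coalgebra.IsCocomm k C :=
  letI := O.coalgebra
  ⟨LinearMap.ext O.comm_comul⟩

end CofreeOps

/-! ### Cap products -/

section Cap

open Coalgebra
open CofreeOps (contract contract_tmul)

variable {k : Type u} {C : Type v} [CommRing k] [CommRing C] [Bialgebra k C]

/-- The cap product `c ↦ h(c₁) c₂` with a functional `h`. -/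
def cap (h : C →ₗ[k] k) : C →ₗ[k] C := contract h ∘ₗ comul

lemma cap_apply (h : C →ₗ[k] k) (c : C) : cap h c = contract h (comul c) := rfl

lemma counit_cap (h : C →ₗ[k] k) (c : C) : counit (R := k) (cap h c) = h c := by
  have h1 : counit ∘ₗ contract h
      = h ∘ₗ (TensorProduct.rid k C).toLinearMap ∘ₗ (counit (R := k) (A := C)).lTensor C :=
    TensorProduct.ext' fun a b => by simp [mul_comm]
  have h2 := LinearMap.congr_fun h1 (comul c)
  simpa [cap_apply] using h2

/-- This is coassociativity: both sides are h(c₁) c₂ ⊗ c₃. It makes cap products an action of the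
convolution algebra. -/
lemma comul_cap (h : C →ₗ[k] k) (c : C) :
    comul (R := k) (cap h c) = (cap h).rTensor C (comul c) := by
  have h0 : ∀ (w : C ⊗[k] C) (b : C), TensorProduct.lid k (C ⊗[k] C)
      (h.rTensor (C ⊗[k] C) (TensorProduct.assoc k C C C (w ⊗ₜ b))) = contract h w ⊗ₜ b := by
    intro w b
    induction w using TensorProduct.induction_on with
    | zero => simp
    | tmul x y => simp [TensorProduct.smul_tmul']
    | add x y hx hy => simp only [TensorProduct.add_tmul, map_add, hx, hy]
  have h1 : ((TensorProduct.lid k (C ⊗[k] C)).toLinearMap ∘ₗ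
      h.rTensor (C ⊗[k] C)) ∘ₗ (TensorProduct.assoc k C C C).toLinearMap ∘ₗ comul.rTensor C
        = (cap h).rTensor C :=
    TensorProduct.ext' fun a b => h0 _ _
  have h2 : ((TensorProduct.lid k (C ⊗[k] C)).toLinearMap ∘ₗ
      h.rTensor (C ⊗[k] C)) ∘ₗ comul.lTensor C = comul ∘ₗ contract h :=
    TensorProduct.ext' fun a b => by simp
  have h3 := LinearMap.congr_fun h1 (comul c)
  have h4 := LinearMap.congr_fun h2 (comul c)
  simp only [LinearMap.comp_apply, LinearEquiv.coe_coe, coassoc_apply] at h3 h4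
  rw [cap_apply, ← h3, h4]

lemma contract_comp (h : C →ₗ[k] k) (T : C →ₗ[k] C) (w : C ⊗[k] C) :
    contract (h ∘ₗ T) w = contract h (T.rTensor C w) := by
  simp only [contract, LinearMap.comp_apply, LinearMap.rTensor_comp_apply]

lemma cap_comp (h h' : C →ₗ[k] k) (c : C) : cap (h ∘ₗ cap h') c = cap h (cap h' c) := by
  rw [cap_apply, contract_comp, ← comul_cap, ← cap_apply]

lemma comp_cap_eq_conv (h h' : C →ₗ[k] k) :
    h ∘ₗ cap h' = (WithConv.toConv h' * WithConv.toConv h).ofConv := by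
  have h1 : h ∘ₗ contract h' = LinearMap.mul' k k ∘ₗ TensorProduct.map h' h :=
    TensorProduct.ext' fun a b => by simp
  exact LinearMap.ext fun c => LinearMap.congr_fun h1 (comul c)

/-- The convolution algebra of a cocommutative coalgebra is commutative. -/
lemma cap_comm [IsCocomm k C] (h h' : C →ₗ[k] k) (c : C) :
    cap h (cap h' c) = cap h' (cap h c) := by
  rw [← cap_comp, ← cap_comp, comp_cap_eq_conv, comp_cap_eq_conv, mul_comm]

lemma cap_grouplike (h : C →ₗ[k] k) {a : C} (ha : IsGroupLikeElem k a) : cap h a = h a • a := by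
  rw [cap_apply, ha.comul_eq_tmul_self, contract_tmul]

lemma contract_tmul_mul (h : C →ₗ[k] k) (a b : C) (w : C ⊗[k] C) :
    contract h ((a ⊗ₜ b) * w) = b * contract (h ∘ₗ LinearMap.mulLeft k a) w := by
  induction w using TensorProduct.induction_on with
  | zero => simp
  | tmul x y => simp
  | add x y hx hy => simp only [mul_add, map_add, hx, hy]

lemma cap_grouplike_mul (h : C →ₗ[k] k) {a : C} (ha : IsGroupLikeElem k a) (c : C) :
    cap h (a * c) = a * cap (h ∘ₗ LinearMap.mulLeft k a) c := by
  rw [cap_apply, Bialgebra.comul_mul, ha.comul_eq_tmul_self, contract_tmul_mul, cap_apply]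

end Cap

/-! ### Orientations -/

section CapOrientation

open Coalgebra
open CofreeOps (contract contract_tmul)

/-- A functional `y` on a bialgebra whose cap product is split surjective with kernel spanned
by the unit. -/
structure CapOrientation (k : Type u) (C : Type v) [CommRing k] [CommRing C] [Bialgebra k C] where
  y : C →ₗ[k] k
  Z : C →ₗ[k] C
  cap_Z : ∀ c, cap y (Z c) = c
  Z_cap : ∀ c, Z (cap y c) = c - algebraMap k C (counit c)

namespace CapOrientation

variable {k : Type u} {C : Type v} {D : Type w} [CommRing k] [CommRing C] [Bialgebra k C]
  [CommGroup D] (O : CapOrientation k C) (g : D →* C)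

lemma y_one : O.y 1 = 0 := by
  have h : O.Z (cap O.y 1) = 0 := by simp [Z_cap]
  have h2 := congrArg (fun c => counit (R := k) (cap O.y c)) h
  simpa [cap_Z, counit_cap] using h2

lemma y_Z (c : C) : O.y (O.Z c) = counit c := by
  rw [← counit_cap, cap_Z]

/-- The cap product with the translate of `y` by the character `V`. -/
def Yop (V : D) : Module.End k C :=
  LinearMap.mulLeft k (g V) ∘ₗ cap O.y ∘ₗ LinearMap.mulLeft k (g V⁻¹)

/-- The section of `Yop`. -/
def Zop (V : D) : Module.End k C :=
  LinearMap.mulLeft k (g V) ∘ₗ O.Z ∘ₗ LinearMap.mulLeft k (g V⁻¹)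

lemma Yop_apply (V : D) (c : C) : O.Yop g V c = g V * cap O.y (g V⁻¹ * c) := rfl

lemma Zop_apply (V : D) (c : C) : O.Zop g V c = g V * O.Z (g V⁻¹ * c) := rfl

/-- The product of the operators `Yop V` over a list. -/
def Yl (s : List D) : Module.End k C := (s.map (O.Yop g)).prod

@[simp] lemma Yl_nil (c : C) : O.Yl g [] c = c := rfl

@[simp] lemma Yl_cons (V : D) (s : List D) (c : C) :
    O.Yl g (V :: s) c = O.Yop g V (O.Yl g s c) := by
  simp [Yl]

lemma g_mul_inv (V : D) (c : C) : g V * (g V⁻¹ * c) = c := by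
  rw [← mul_assoc, ← map_mul, mul_inv_cancel, map_one, one_mul]

lemma g_inv_mul (V : D) (c : C) : g V⁻¹ * (g V * c) = c := by
  rw [← mul_assoc, ← map_mul, inv_mul_cancel, map_one, one_mul]

variable {g} (hg : ∀ V, IsGroupLikeElem k (g V))

-- Conjugating a cap product by a grouplike element translates the functional. All these operators
-- are therefore cap products, and they commute.
include hg in
lemma Yop_eq_cap (V : D) : O.Yop g V = cap (O.y ∘ₗ LinearMap.mulLeft k (g V⁻¹)) := by
  ext c
  rw [Yop_apply, cap_grouplike_mul _ (hg _), g_mul_inv]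

lemma Yop_Zop (V : D) (c : C) : O.Yop g V (O.Zop g V c) = c := by
  rw [Yop_apply, Zop_apply, g_inv_mul, cap_Z, g_mul_inv]

include hg in
lemma Zop_Yop (V : D) (c : C) :
    O.Zop g V (O.Yop g V c) = c - counit (R := k) c • g V := by
  rw [Yop_apply, Zop_apply, g_inv_mul, Z_cap, mul_sub, g_mul_inv, Bialgebra.counit_mul,
    (hg _).counit_eq_one, one_mul, ← Algebra.commutes, ← Algebra.smul_def]

include hg in
lemma Yop_comm [IsCocomm k C] (V W : D) (c : C) :
    O.Yop g V (O.Yop g W c) = O.Yop g W (O.Yop g V c) := by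
  rw [O.Yop_eq_cap hg, O.Yop_eq_cap hg, cap_comm]

include hg in
lemma Yop_Yl [IsCocomm k C] (V : D) (s : List D) (c : C) :
    O.Yop g V (O.Yl g s c) = O.Yl g s (O.Yop g V c) := by
  induction s with
  | nil => rfl
  | cons W s ih => rw [Yl_cons, Yl_cons, O.Yop_comm hg, ih]

include hg in
lemma cap_Yl [IsCocomm k C] (h : C →ₗ[k] k) (s : List D) (c : C) :
    cap h (O.Yl g s c) = O.Yl g s (cap h c) := by
  induction s with
  | nil => rfl
  | cons W s ih => rw [Yl_cons, Yl_cons, O.Yop_eq_cap hg, cap_comm, ih]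

lemma Yl_append (s t : List D) (c : C) : O.Yl g (s ++ t) c = O.Yl g s (O.Yl g t c) := by
  simp [Yl]

include hg in
lemma Yl_comm [IsCocomm k C] (s t : List D) (c : C) :
    O.Yl g s (O.Yl g t c) = O.Yl g t (O.Yl g s c) := by
  induction s with
  | nil => rfl
  | cons W s ih => rw [Yl_cons, Yl_cons, ih, O.Yop_Yl hg]

lemma Yl_append_left {s : List D} {c : C} (h : O.Yl g s c = 0) (t : List D) :
    O.Yl g (t ++ s) c = 0 := by
  rw [Yl_append, h, map_zero]

include hg in
lemma Yl_append_right [IsCocomm k C] {s : List D} {c : C} (h : O.Yl g s c = 0) (t : List D) :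
    O.Yl g (s ++ t) c = 0 := by
  rw [Yl_append, O.Yl_comm hg, h, map_zero]

-- This identity, obtained by splitting the first tensor factor, is the recursion of
-- `CofreeOps.comulList` for a comultiplication given in advance.
include hg in
lemma comul_eq_add (V : D) (c : C) : comul (R := k) c
    = g V ⊗ₜ c + (O.Zop g V).rTensor C (comul (O.Yop g V c)) := by
  have h1 : (LinearMap.id : C →ₗ[k] C)
      = O.Zop g V ∘ₗ O.Yop g V + (LinearMap.toSpanSingleton k C (g V)) ∘ₗ counit := by
    ext c
    simp [O.Zop_Yop hg]
  have h2 := congrArg (fun f => f.rTensor C (comul c)) h1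
  simp only [LinearMap.rTensor_id, LinearMap.id_apply, LinearMap.rTensor_add,
    LinearMap.add_apply, LinearMap.rTensor_comp_apply, rTensor_counit_comul] at h2
  rw [O.Yop_eq_cap hg, comul_cap]
  rw [O.Yop_eq_cap hg] at h2
  exact h2.trans (by rw [add_comm]; simp)

-- By the recursion, the second tensor factors of Δc never leave the kernel. The conclusion speaks
-- of the image of C ⊗ ker, which avoids any flatness question.
include hg in
lemma comul_mem_range [IsCocomm k C] {s : List D} {c : C} (hc : O.Yl g s c = 0) :
    comul (R := k) c ∈ LinearMap.range ((LinearMap.ker (O.Yl g s)).subtype.lTensor C) := by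
  induction s generalizing c with
  | nil =>
    obtain rfl : c = 0 := hc
    simp
  | cons V s ih =>
    rw [O.comul_eq_add hg V c]
    refine add_mem ⟨g V ⊗ₜ ⟨c, hc⟩, by simp⟩ ?_
    rw [Yl_cons, O.Yop_Yl hg] at hc
    obtain ⟨w, hw⟩ := ih hc
    have hle : LinearMap.ker (O.Yl g s) ≤ LinearMap.ker (O.Yl g (V :: s)) := fun x hx => by
      rw [LinearMap.mem_ker] at hx ⊢
      rw [Yl_cons, hx, map_zero]
    refine ⟨TensorProduct.map (O.Zop g V) (Submodule.inclusion hle) w, ?_⟩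
    rw [← hw]
    have : (LinearMap.ker (O.Yl g (V :: s))).subtype.lTensor C ∘ₗ
        TensorProduct.map (O.Zop g V) (Submodule.inclusion hle)
          = (O.Zop g V).rTensor C ∘ₗ (LinearMap.ker (O.Yl g s)).subtype.lTensor C :=
      TensorProduct.ext' fun a b => rfl
    exact LinearMap.congr_fun this w

lemma contract_mul_mem {N N' K : Submodule k C} (hK : ∀ x ∈ N, ∀ y ∈ N', x * y ∈ K)
    (h : C →ₗ[k] k) {p q : C ⊗[k] C} (hp : p ∈ LinearMap.range (N.subtype.lTensor C))
    (hq : q ∈ LinearMap.range (N'.subtype.lTensor C)) : contract h (p * q) ∈ K := by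
  obtain ⟨p, rfl⟩ := hp
  obtain ⟨q, rfl⟩ := hq
  induction p using TensorProduct.induction_on with
  | zero => simp
  | add x y hx hy => simpa only [map_add, add_mul] using add_mem hx hy
  | tmul a n =>
    induction q using TensorProduct.induction_on with
    | zero => simp
    | add x y hx hy => simpa only [map_add, mul_add] using add_mem hx hy
    | tmul b n' =>
      simpa using K.smul_mem _ (hK _ n.2 _ n'.2)

end CapOrientation

/-- A list of characters whose product of operators kills the product of two elements killed by
the given lists. -/
def prodList {D : Type w} [Mul D] : List D → List D → List D
  | [], _ => []
  | _ :: _, [] => []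
  -- The operator of VW removes the leading term of a product. What remains pairs one list in full
  -- with the tail of the other, in the two possible ways.
  | V :: s, W :: t => (V * W) :: (prodList (V :: s) t ++ prodList s (W :: t))
termination_by s t => s.length + t.length

namespace CapOrientation

variable {k : Type u} {C : Type v} {D : Type w} [CommRing k] [CommRing C] [Bialgebra k C]
  [CommGroup D] (O : CapOrientation k C) {g : D →* C} (hg : ∀ V, IsGroupLikeElem k (g V))

include hg in
lemma rTensor_Zop_comul_mem [IsCocomm k C] {V : D} {s : List D} {c : C}
    (hc : O.Yl g (V :: s) c = 0) : (O.Zop g V).rTensor C (comul (O.Yop g V c))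
      ∈ LinearMap.range ((LinearMap.ker (O.Yl g s)).subtype.lTensor C) := by
  rw [Yl_cons, O.Yop_Yl hg] at hc
  obtain ⟨w, hw⟩ := O.comul_mem_range hg hc
  refine ⟨(O.Zop g V).rTensor _ w, ?_⟩
  rw [← hw]
  have : (LinearMap.ker (O.Yl g s)).subtype.lTensor C ∘ₗ (O.Zop g V).rTensor _
      = (O.Zop g V).rTensor C ∘ₗ (LinearMap.ker (O.Yl g s)).subtype.lTensor C :=
    TensorProduct.ext' fun a b => rfl
  exact LinearMap.congr_fun this w

-- Write Δa = g_V ⊗ a + … and Δb = g_W ⊗ b + …, and contract ΔaΔb with the translate of y by VW. It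
-- kills g_V g_W because y(1) = 0. The two remaining products have their second factors in kernels
-- to which the induction applies. Dually, this is the continuity of the comultiplication of the
-- coordinate ring.
include hg in
lemma Yl_prodList [IsCocomm k C] (s t : List D) {a b : C} (ha : O.Yl g s a = 0)
    (hb : O.Yl g t b = 0) : O.Yl g (prodList s t) (a * b) = 0 := by
  induction s, t using prodList.induct generalizing a b with
  | case1 t =>
    obtain rfl : a = 0 := ha
    rw [zero_mul, map_zero]
  | case2 =>
    obtain rfl : b = 0 := hb
    rw [mul_zero, map_zero]
  | case3 V s W t ih1 ih2 =>
    rw [prodList, Yl_cons, O.Yop_Yl hg]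
    rw [O.Yop_eq_cap hg]
    generalize hh : O.y ∘ₗ LinearMap.mulLeft k (g (V * W)⁻¹) = h
    have h0 : h (g V * g W) = 0 := by
      rw [← hh, LinearMap.comp_apply, LinearMap.mulLeft_apply, ← map_mul, ← map_mul,
        inv_mul_cancel, map_one, y_one]
    rw [cap_apply, Bialgebra.comul_mul]
    conv_lhs => enter [2, 2, 1]; rw [O.comul_eq_add hg V a]
    rw [add_mul]
    conv_lhs => enter [2, 2, 1, 2]; rw [O.comul_eq_add hg W b]
    rw [mul_add, Algebra.TensorProduct.tmul_mul_tmul, map_add, map_add, map_add, contract_tmul, h0,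
      zero_smul, zero_add]
    have h1 := contract_mul_mem (K := LinearMap.ker (O.Yl g (prodList (V :: s) t)))
      (fun x hx y hy => ih1 hx hy) h (p := g V ⊗ₜ[k] a)
      (N := LinearMap.ker (O.Yl g (V :: s))) ⟨g V ⊗ₜ ⟨a, ha⟩, by simp⟩
      (O.rTensor_Zop_comul_mem hg hb)
    have h2 := contract_mul_mem (K := LinearMap.ker (O.Yl g (prodList s (W :: t))))
      (fun x hx y hy => ih2 hx hy) h (O.rTensor_Zop_comul_mem hg ha) (O.comul_mem_range hg hb)
    rw [O.Yl_append_right hg h1, O.Yl_append_left h2, add_zero]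

end CapOrientation

/-- The covariant bialgebra of an equivariant formal group law. -/
structure CovFGL (D : Type w) (k : Type u) (C : Type v) [CommGroup D] [CommRing k] [CommRing C]
    [Bialgebra k C] extends CapOrientation k C where
  g : D →* C
  grouplike : ∀ V, IsGroupLikeElem k (g V)
  nil : ∀ c, ∃ s : List D, toCapOrientation.Yl g s c = 0

namespace CovFGL

variable {k : Type u} {C : Type v} {D : Type w} [CommRing k] [CommRing C] [Bialgebra k C]
  [CommGroup D] [IsCocomm k C] (M : CovFGL D k C)

/-- The operators on the covariant bialgebra of an equivariant formal group law. -/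
@[simps] def ops : CofreeOps k C D where
  ε := counit
  Y := M.Yop M.g
  Z := M.Zop M.g
  g := M.g
  Y_comm := M.Yop_comm M.grouplike
  Y_Z := M.Yop_Zop
  Z_Y := M.Zop_Yop M.grouplike
  ε_g V := (M.grouplike V).counit_eq_one
  nil := M.nil

lemma contract_τ_comul (s : List D) (c : C) :
    contract (M.ops.τ s) (comul c) = M.ops.Ys s c := by
  induction s generalizing c with
  | nil =>
    have h := congrArg (TensorProduct.lid k C) (rTensor_counit_comul (R := k) c)
    rw [TensorProduct.lid_tmul, one_smul] at h
    exact h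
  | cons V s ih =>
    have h1 : M.ops.τ (V :: s) = (M.y ∘ₗ LinearMap.mulLeft k (M.g V⁻¹)) ∘ₗ cap (M.ops.τ s) := by
      ext c
      rw [LinearMap.comp_apply, cap_apply, ih, CofreeOps.τ_apply, CofreeOps.Ys_cons, ops_Y,
        M.Yop_eq_cap M.grouplike, ops_ε, counit_cap]
    rw [h1, ← cap_apply, cap_comp, cap_apply _ c, ih, ← M.Yop_eq_cap M.grouplike]
    rfl

/-- The comultiplication carries no information beyond the operators, the counit and the grouplike
elements. Ring maps compatible with the operators and the counits thus preserve it automatically. -/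
lemma ops_comul : M.ops.comul = comul := by
  ext c
  refine M.ops.ext₂ fun s t => ?_
  rw [CofreeOps.τ₂_comul, ← CofreeOps.τ_contract, contract_τ_comul, CofreeOps.Ys_comm]
  rfl

end CovFGL

end CapOrientation

/-! ### Semilinear maps of tensor squares -/

section TensorSquare

variable {k C k' C' : Type*} [CommRing k] [CommRing C] [Algebra k C] [CommRing k'] [CommRing C']
  [Algebra k' C']

/-- The ring map `C ⊗ C → C' ⊗ C'` induced by a ring map over a map of base rings. -/
def tensorSquare (φ : k →+* k') (Φ : C →+* C')
    (h : ∀ x, Φ (algebraMap k C x) = algebraMap k' C' (φ x)) : C ⊗[k] C →+* C' ⊗[k'] C' :=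
  letI : Algebra k (C' ⊗[k'] C') := ((algebraMap k' (C' ⊗[k'] C')).comp φ).toAlgebra
  (Algebra.TensorProduct.productMap
    ({ toRingHom := (Algebra.TensorProduct.includeLeftRingHom).comp Φ
       commutes' := fun x => by
        change Φ (algebraMap k C x) ⊗ₜ[k'] (1 : C') = _
        rw [h]; rfl } : C →ₐ[k] C' ⊗[k'] C')
    ({ toRingHom := (Algebra.TensorProduct.includeRight : C' →ₐ[k'] _).toRingHom.comp Φ
       commutes' := fun x => by
        change (1 : C') ⊗ₜ[k'] Φ (algebraMap k C x) = _
        rw [h]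
        exact (Algebra.TensorProduct.includeRight : C' →ₐ[k'] C' ⊗[k'] C').commutes _ } :
        C →ₐ[k] C' ⊗[k'] C')).toRingHom

@[simp] lemma tensorSquare_tmul (φ : k →+* k') (Φ : C →+* C')
    (h : ∀ x, Φ (algebraMap k C x) = algebraMap k' C' (φ x)) (a b : C) :
    tensorSquare φ Φ h (a ⊗ₜ b) = Φ a ⊗ₜ Φ b := by
  change (Φ a ⊗ₜ[k'] (1 : C')) * ((1 : C') ⊗ₜ[k'] Φ b) = _
  simp

end TensorSquare

namespace CofreeOps

variable {k C k' C' : Type*} {D : Type*} [CommRing k] [CommRing C] [Algebra k C] [CommRing k']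
  [CommRing C'] [Algebra k' C']

/-- Ring maps commuting with the operators and augmentations of two families of operators. -/
structure IsHom (O : CofreeOps k C D) (O' : CofreeOps k' C' D) (φ : k →+* k') (Φ : C →+* C') :
    Prop where
  map_algebraMap : ∀ x, Φ (algebraMap k C x) = algebraMap k' C' (φ x)
  map_ε : ∀ c, O'.ε (Φ c) = φ (O.ε c)
  map_Y : ∀ V c, O'.Y V (Φ c) = Φ (O.Y V c)

namespace IsHom

variable {O : CofreeOps k C D} {O' : CofreeOps k' C' D} {φ : k →+* k'} {Φ : C →+* C'}
  (H : IsHom O O' φ Φ)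

include H

lemma map_Ys (s : List D) (c : C) : O'.Ys s (Φ c) = Φ (O.Ys s c) := by
  induction s with
  | nil => rfl
  | cons V s ih => rw [Ys_cons, Ys_cons, ih, H.map_Y]

lemma map_τ (s : List D) (c : C) : O'.τ s (Φ c) = φ (O.τ s c) := by
  rw [τ_apply, τ_apply, H.map_Ys, H.map_ε]

lemma map_τ₂ (s t : List D) (w : C ⊗[k] C) :
    O'.τ₂ s t (tensorSquare φ Φ H.map_algebraMap w) = φ (O.τ₂ s t w) := by
  induction w using TensorProduct.induction_on with
  | zero => simp
  | tmul a b => simp [H.map_τ]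
  | add a b ha hb => simp only [map_add, ha, hb]

lemma map_comul (c : C) :
    tensorSquare φ Φ H.map_algebraMap (O.comul c) = O'.comul (Φ c) := by
  refine O'.ext₂ fun s t => ?_
  rw [H.map_τ₂, τ₂_comul, τ₂_comul, H.map_Ys, H.map_Ys, H.map_ε]

end IsHom

end CofreeOps

/-! ### Morphisms of covariant bialgebras -/

namespace CovFGL

open Coalgebra

variable {k C k' C' : Type*} {D : Type*} [CommRing k] [CommRing C] [Bialgebra k C]
  [IsCocomm k C] [CommRing k'] [CommRing C'] [Bialgebra k' C'] [IsCocomm k' C'] [CommGroup D]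

/-- Semilinear maps of covariant bialgebras of equivariant formal group laws. -/
structure IsHom (M : CovFGL D k C) (M' : CovFGL D k' C') (φ : k →+* k') (Φ : C →+* C') :
    Prop where
  map_algebraMap : ∀ x, Φ (algebraMap k C x) = algebraMap k' C' (φ x)
  map_counit : ∀ c, counit (R := k') (Φ c) = φ (counit c)
  map_g : ∀ V, Φ (M.g V) = M'.g V
  map_cap : ∀ c, cap M'.y (Φ c) = Φ (cap M.y c)

namespace IsHom

variable {M : CovFGL D k C} {M' : CovFGL D k' C'} {φ : k →+* k'} {Φ : C →+* C'}
  (H : IsHom M M' φ Φ)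

include H

-- The section is determined by being a right inverse with values in the kernel of the counit, so
-- morphisms need no axiom about it.
omit [IsCocomm k C] [IsCocomm k' C'] in
lemma map_Z (c : C) : M'.Z (Φ c) = Φ (M.Z c) := by
  have h := M'.Z_cap (Φ (M.Z c))
  rw [H.map_cap, M.cap_Z, H.map_counit, ← M.cap_Z c] at h
  have h2 : counit (R := k) (M.Z (cap M.y (M.Z c))) = 0 := by
    rw [M.Z_cap, map_sub, Bialgebra.counit_algebraMap, sub_self]
  rw [h2, map_zero, map_zero, sub_zero] at h
  rw [M.cap_Z] at h
  exact h

lemma ops : CofreeOps.IsHom M.ops M'.ops φ Φ where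
  map_algebraMap := H.map_algebraMap
  map_ε := H.map_counit
  map_Y V c := by
    simp only [ops_Y, CapOrientation.Yop_apply]
    rw [map_mul Φ, ← H.map_cap, map_mul Φ, H.map_g, H.map_g]

omit [IsCocomm k C] [IsCocomm k' C'] in
lemma map_y (c : C) : M'.y (Φ c) = φ (M.y c) := by
  rw [← counit_cap, H.map_cap, H.map_counit, counit_cap]

lemma map_comul (c : C) :
    tensorSquare φ Φ H.map_algebraMap (comul c) = comul (Φ c) := by
  rw [← M.ops_comul, H.ops.map_comul, M'.ops_comul]

end IsHom

end CovFGL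

/-! ### Terms -/

/-- Terms in the operations of a covariant bialgebra of an equivariant formal group law; `E` is
the composite of the counit and the unit. -/
inductive CovTerm (D : Type) : Type u
  | zero : CovTerm D
  | one : CovTerm D
  | add : CovTerm D → CovTerm D → CovTerm D
  | neg : CovTerm D → CovTerm D
  | mul : CovTerm D → CovTerm D → CovTerm D
  | g : D → CovTerm D
  | Y : CovTerm D → CovTerm D
  | Z : CovTerm D → CovTerm D
  | E : CovTerm D → CovTerm D

/-- A covariant bialgebra of an equivariant formal group law over some ring. -/
structure BundledCovFGL (D : Type) [CommGroup D] : Type (u + 1) where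
  k : Type u
  C : Type u
  [commRing_k : CommRing k]
  [commRing_C : CommRing C]
  [bialgebra : Bialgebra k C]
  [isCocomm : Coalgebra.IsCocomm k C]
  model : CovFGL D k C

attribute [instance] BundledCovFGL.commRing_k BundledCovFGL.commRing_C BundledCovFGL.bialgebra
  BundledCovFGL.isCocomm

namespace CovTerm

open Coalgebra

variable {D : Type} [CommGroup D]

/-- The value of a term. -/
def eval {k : Type*} {C : Type*} [CommRing k] [CommRing C] [Bialgebra k C]
    (M : CovFGL D k C) : CovTerm.{u} D → C
  | zero => 0
  | one => 1
  | add a b => eval M a + eval M b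
  | neg a => -eval M a
  | mul a b => eval M a * eval M b
  | g V => M.g V
  | Y a => cap M.y (eval M a)
  | Z a => M.Z (eval M a)
  | E a => algebraMap k C (counit (eval M a))

/-- A list of characters whose product of operators kills the value of a term. -/
def bound : CovTerm.{u} D → List D
  | zero => []
  | one => [1]
  | add a b => bound a ++ bound b
  | neg a => bound a
  | mul a b => prodList (bound a) (bound b)
  | g V => [V]
  | Y a => bound a
  | Z a => 1 :: bound a
  | E _ => [1]

section

variable {k : Type*} {C : Type*} [CommRing k] [CommRing C] [Bialgebra k C] [IsCocomm k C]

omit [IsCocomm k C] in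
lemma _root_.CapOrientation.Yop_one (O : CapOrientation k C) (g : D →* C) (c : C) :
    O.Yop g 1 c = cap O.y c := by
  simp [CapOrientation.Yop_apply]

/-- The list depends on the term alone and not on the model. Nilpotence, the only axiom that is not
an identity, therefore passes to the algebra of terms modulo the identities of all models. Products
use `Yl_prodList`. -/
lemma Yl_bound (M : CovFGL D k C) (t : CovTerm.{u} D) :
    M.Yl M.g (bound t) (eval M t) = 0 := by
  have hone : cap M.y 1 = 0 := by
    rw [cap_grouplike _ (a := (1 : C)) .one, M.y_one, zero_smul]
  induction t with
  | zero => rfl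
  | one => simpa [bound, eval, CapOrientation.Yop_one] using hone
  | add a b ha hb =>
    rw [bound, eval, map_add, M.Yl_append_right M.grouplike ha, M.Yl_append_left hb, add_zero]
  | neg a ha => rw [bound, eval, map_neg, ha, neg_zero]
  | mul a b ha hb => exact M.Yl_prodList M.grouplike _ _ ha hb
  | g V => simpa [bound, eval] using M.ops.Y_g V
  | Y a ha =>
    rw [bound, eval, ← M.cap_Yl M.grouplike, ha, map_zero]
  | Z a ha =>
    rw [bound, eval, CapOrientation.Yl_cons, M.Yop_Yl M.grouplike, CapOrientation.Yop_one, M.cap_Z,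
      ha]
  | E a ha =>
    simp [bound, eval, CapOrientation.Yop_one, Algebra.algebraMap_eq_smul_one, hone]

omit [IsCocomm k C] in
lemma map_eval {k' C' : Type*} [CommRing k'] [CommRing C'] [Bialgebra k' C'] [IsCocomm k' C']
    {M : CovFGL D k C} {M' : CovFGL D k' C'} {φ : k →+* k'} {Φ : C →+* C'}
    (H : M.IsHom M' φ Φ) (t : CovTerm.{u} D) : Φ (eval M t) = eval M' t := by
  induction t with
  | zero => simp [eval]
  | one => simp [eval]
  | add a b ha hb => simp [eval, ha, hb]
  | neg a ha => simp [eval, ha]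
  | mul a b ha hb => simp [eval, ha, hb]
  | g V => simp [eval, H.map_g]
  | Y a ha => simp [eval, ← ha, H.map_cap]
  | Z a ha => simp [eval, ← ha, H.map_Z]
  | E a ha => simp [eval, ← ha, H.map_counit, H.map_algebraMap]

end

variable (D) in
/-- Two terms are identified if they have the same value in every covariant bialgebra. -/
@[reducible]
def setoid : Setoid (CovTerm.{u} D) where
  -- Quantifying over all models in this way replaces a product over a large collection; the
  -- quotient stays in the universe of the terms.
  r a b := ∀ B : BundledCovFGL.{u} D, eval B.model a = eval B.model b
  iseqv := ⟨fun _ _ => rfl, fun h B => (h B).symm, fun h h' B => (h B).trans (h' B)⟩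

end CovTerm

/-- The universal covariant bialgebra. -/
def UnivC (D : Type) [CommGroup D] : Type u := Quotient (CovTerm.setoid.{u} D)

namespace UnivC

open CovTerm Coalgebra

variable {D : Type} [CommGroup D]

/-- The class of a term. -/
def mk (t : CovTerm.{u} D) : UnivC.{u} D := Quotient.mk (CovTerm.setoid D) t

lemma mk_surjective : Function.Surjective (mk : CovTerm.{u} D → UnivC.{u} D) :=
  Quotient.mk_surjective

lemma mk_eq {a b : CovTerm.{u} D} (h : ∀ B : BundledCovFGL.{u} D, eval B.model a = eval B.model b) :
    mk a = mk b := Quotient.sound h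

instance : Zero (UnivC.{u} D) := ⟨mk zero⟩
instance : One (UnivC.{u} D) := ⟨mk one⟩
instance : Add (UnivC.{u} D) := ⟨Quotient.map₂ add fun _ _ h _ _ h' B => by
  simp only [eval]; rw [h B, h' B]⟩
instance : Mul (UnivC.{u} D) := ⟨Quotient.map₂ mul fun _ _ h _ _ h' B => by
  simp only [eval]; rw [h B, h' B]⟩
instance : Neg (UnivC.{u} D) := ⟨Quotient.map neg fun _ _ h B => by simp only [eval]; rw [h B]⟩

instance : CommRing (UnivC.{u} D) where
  add_assoc := by
    rintro ⟨a⟩ ⟨b⟩ ⟨c⟩; exact mk_eq fun B => add_assoc _ _ _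
  zero_add := by rintro ⟨a⟩; exact mk_eq fun B => zero_add _
  add_zero := by rintro ⟨a⟩; exact mk_eq fun B => add_zero _
  add_comm := by rintro ⟨a⟩ ⟨b⟩; exact mk_eq fun B => add_comm _ _
  neg_add_cancel := by rintro ⟨a⟩; exact mk_eq fun B => neg_add_cancel _
  mul_assoc := by
    rintro ⟨a⟩ ⟨b⟩ ⟨c⟩; exact mk_eq fun B => mul_assoc _ _ _
  one_mul := by rintro ⟨a⟩; exact mk_eq fun B => one_mul _
  mul_one := by rintro ⟨a⟩; exact mk_eq fun B => mul_one _
  mul_comm := by rintro ⟨a⟩ ⟨b⟩; exact mk_eq fun B => mul_comm _ _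
  left_distrib := by
    rintro ⟨a⟩ ⟨b⟩ ⟨c⟩; exact mk_eq fun B => mul_add _ _ _
  right_distrib := by
    rintro ⟨a⟩ ⟨b⟩ ⟨c⟩; exact mk_eq fun B => add_mul _ _ _
  zero_mul := by rintro ⟨a⟩; exact mk_eq fun B => zero_mul _
  mul_zero := by rintro ⟨a⟩; exact mk_eq fun B => mul_zero _
  nsmul := nsmulRec
  zsmul := zsmulRec

/-- Evaluation of the universal bialgebra in a covariant bialgebra. -/
def ev {k C : Type u} [CommRing k] [CommRing C] [Bialgebra k C] [IsCocomm k C]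
    (M : CovFGL D k C) : UnivC.{u} D →+* C where
  toFun := Quotient.lift (eval M) fun _ _ h => h ⟨k, C, M⟩
  map_zero' := rfl
  map_one' := rfl
  map_add' := by rintro ⟨a⟩ ⟨b⟩; rfl
  map_mul' := by rintro ⟨a⟩ ⟨b⟩; rfl

section

variable {k C : Type u} [CommRing k] [CommRing C] [Bialgebra k C] [IsCocomm k C]
  (M : CovFGL D k C)

@[simp] lemma ev_mk (t : CovTerm.{u} D) : ev M (mk t) = eval M t := rfl

end

lemma ext_ev {a b : UnivC.{u} D} (h : ∀ B : BundledCovFGL.{u} D, ev B.model a = ev B.model b) :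
    a = b := by
  obtain ⟨a, rfl⟩ := mk_surjective a
  obtain ⟨b, rfl⟩ := mk_surjective b
  exact mk_eq h

variable (D) in
/-- The composite of the counit and the unit of the universal bialgebra. -/
def E : UnivC.{u} D →+* UnivC.{u} D where
  toFun := Quotient.map CovTerm.E fun _ _ h B => by simp only [eval]; rw [h B]
  map_zero' := mk_eq fun B => by simp [eval]
  map_one' := mk_eq fun B => by simp [eval]
  map_add' := by rintro ⟨a⟩ ⟨b⟩; exact mk_eq fun B => by simp [eval]
  map_mul' := by rintro ⟨a⟩ ⟨b⟩; exact mk_eq fun B => by simp [eval]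

variable (D) in
/-- The universal ring: the image of the counit. -/
def L : Subring (UnivC.{u} D) := (E D).range

/-- Evaluation on the universal ring. -/
def evL {k C : Type u} [CommRing k] [CommRing C] [Bialgebra k C] [IsCocomm k C]
    (M : CovFGL D k C) : L.{u} D →+* k :=
  (Bialgebra.counitAlgHom k C).toRingHom.comp ((ev M).comp (L D).subtype)

section

variable {k C : Type u} [CommRing k] [CommRing C] [Bialgebra k C] [IsCocomm k C]
  (M : CovFGL D k C)

lemma ev_E (a : UnivC.{u} D) : ev M (E D a) = algebraMap k C (counit (ev M a)) := by
  obtain ⟨a, rfl⟩ := mk_surjective a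
  rfl

lemma evL_apply (l : L.{u} D) : evL M l = counit (ev M (l : UnivC.{u} D)) := rfl

lemma ev_coe (l : L.{u} D) : ev M (l : UnivC.{u} D) = algebraMap k C (evL M l) := by
  obtain ⟨_, a, rfl⟩ := l
  rw [evL_apply, ev_E, Bialgebra.counit_algebraMap]

end

lemma ext_evL {a b : L.{u} D} (h : ∀ B : BundledCovFGL.{u} D, evL B.model a = evL B.model b) :
    a = b :=
  Subtype.ext (ext_ev fun B => by rw [ev_coe, ev_coe, h B])

/-- The augmentation of the universal bialgebra. -/
def ε : UnivC.{u} D →ₗ[L.{u} D] L.{u} D where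
  toFun a := ⟨E D a, a, rfl⟩
  map_add' a b := Subtype.ext (map_add _ _ _)
  map_smul' l a := ext_evL fun B => by
    change counit (ev B.model (E D ((l : UnivC.{u} D) * a)))
      = counit (ev B.model ((l : UnivC.{u} D) * E D a))
    simp [ev_E, ev_coe]

lemma evL_ε {k C : Type u} [CommRing k] [CommRing C] [Bialgebra k C] [IsCocomm k C]
    (M : CovFGL D k C) (a : UnivC.{u} D) : evL M (ε a) = counit (ev M a) := by
  change counit (ev M (E D a)) = _
  simp [ev_E]

/-- The cap product with the coordinate on the universal bialgebra. -/
def Y : UnivC.{u} D →ₗ[L.{u} D] UnivC.{u} D where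
  toFun := Quotient.map CovTerm.Y fun _ _ h B => by simp only [eval]; rw [h B]
  map_add' := by rintro ⟨a⟩ ⟨b⟩; exact mk_eq fun B => by simp [eval]
  map_smul' := by
    rintro ⟨_, ⟨l⟩, rfl⟩ ⟨a⟩
    -- A scalar is the class of a term `E l`, so linearity is an identity between terms, valid in
    -- each model.
    refine mk_eq (a := CovTerm.Y (CovTerm.mul (CovTerm.E l) a))
      (b := CovTerm.mul (CovTerm.E l) (CovTerm.Y a)) fun B => ?_
    simp [eval, ← Algebra.smul_def]

/-- The section of the cap product with the coordinate on the universal bialgebra. -/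
def Z : UnivC.{u} D →ₗ[L.{u} D] UnivC.{u} D where
  toFun := Quotient.map CovTerm.Z fun _ _ h B => by simp only [eval]; rw [h B]
  map_add' := by rintro ⟨a⟩ ⟨b⟩; exact mk_eq fun B => by simp [eval]
  map_smul' := by
    rintro ⟨_, ⟨l⟩, rfl⟩ ⟨a⟩
    refine mk_eq (a := CovTerm.Z (CovTerm.mul (CovTerm.E l) a))
      (b := CovTerm.mul (CovTerm.E l) (CovTerm.Z a)) fun B => ?_
    simp [eval, ← Algebra.smul_def]

/-- The grouplike elements of the universal bialgebra. -/
def g : D →* UnivC.{u} D where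
  toFun V := mk (CovTerm.g V)
  map_one' := mk_eq fun B => by simp [eval]
  map_mul' V W := mk_eq fun B => by simp [eval]

section

variable {k C : Type u} [CommRing k] [CommRing C] [Bialgebra k C] [IsCocomm k C]
  (M : CovFGL D k C)

lemma ev_Y (a : UnivC.{u} D) : ev M (Y a) = cap M.y (ev M a) := by
  obtain ⟨a, rfl⟩ := mk_surjective a
  rfl

lemma ev_Z (a : UnivC.{u} D) : ev M (Z a) = M.Z (ev M a) := by
  obtain ⟨a, rfl⟩ := mk_surjective a
  rfl

lemma ev_g (V : D) : ev M (g V) = M.g V := rfl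

end

/-- The operator associated to a character on the universal bialgebra. -/
def YV (V : D) : UnivC.{u} D →ₗ[L.{u} D] UnivC.{u} D :=
  LinearMap.mulLeft _ (g V) ∘ₗ Y ∘ₗ LinearMap.mulLeft _ (g V⁻¹)

/-- The section of the operator associated to a character on the universal bialgebra. -/
def ZV (V : D) : UnivC.{u} D →ₗ[L.{u} D] UnivC.{u} D :=
  LinearMap.mulLeft _ (g V) ∘ₗ Z ∘ₗ LinearMap.mulLeft _ (g V⁻¹)

section

variable {k C : Type u} [CommRing k] [CommRing C] [Bialgebra k C] [IsCocomm k C]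
  (M : CovFGL D k C)

lemma ev_YV (V : D) (a : UnivC.{u} D) : ev M (YV V a) = M.Yop M.g V (ev M a) := by
  change ev M (g V * Y (g V⁻¹ * a)) = _
  rw [map_mul, ev_Y, map_mul]
  rfl

lemma ev_ZV (V : D) (a : UnivC.{u} D) : ev M (ZV V a) = M.Zop M.g V (ev M a) := by
  change ev M (g V * Z (g V⁻¹ * a)) = _
  rw [map_mul, ev_Z, map_mul]
  rfl

lemma ev_YV_list (s : List D) (a : UnivC.{u} D) :
    ev M ((s.map (YV : D → Module.End (L.{u} D) (UnivC.{u} D))).prod a)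
      = M.Yl M.g s (ev M a) := by
  induction s with
  | nil => rfl
  | cons V s ih =>
    rw [List.map_cons, List.prod_cons, Module.End.mul_apply, ev_YV, ih, CapOrientation.Yl_cons]

end

variable (D) in
/-- The operators on the universal bialgebra. -/
def ops : CofreeOps (L.{u} D) (UnivC.{u} D) D where
  ε := ε
  Y := YV
  Z := ZV
  g := g
  Y_comm V W c := ext_ev fun B => by
    simp only [ev_YV]; exact B.model.Yop_comm B.model.grouplike V W _
  Y_Z V c := ext_ev fun B => by
    simp only [ev_YV, ev_ZV]; exact B.model.Yop_Zop V _
  Z_Y V c := ext_ev fun B => by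
    have : ε c • g V = E D c * g V := rfl
    rw [this]
    simp only [ev_YV, ev_ZV, map_sub, map_mul, ev_E]
    rw [B.model.Zop_Yop B.model.grouplike, Algebra.smul_def]
    rfl
  ε_g V := ext_evL fun B => by
    rw [evL_ε, map_one, ev_g, (B.model.grouplike V).counit_eq_one]
  nil c := by
    obtain ⟨t, rfl⟩ := mk_surjective c
    exact ⟨bound t, ext_ev fun B => by
      rw [ev_YV_list, ev_mk, Yl_bound, map_zero]⟩

lemma isHom_ev {k C : Type u} [CommRing k] [CommRing C] [Bialgebra k C] [IsCocomm k C]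
    (M : CovFGL D k C) : CofreeOps.IsHom (ops D) M.ops (evL M) (ev M) where
  map_algebraMap l := ev_coe M l
  map_ε c := (evL_ε M c).symm
  map_Y V c := (ev_YV M V c).symm

instance : Bialgebra (L.{u} D) (UnivC.{u} D) :=
  letI := (ops.{u} D).coalgebra
  Bialgebra.mk' _ _
    (ext_evL fun B => by
      change evL B.model (ε 1) = _
      rw [evL_ε, map_one (ev _), map_one (evL _), Bialgebra.counit_one])
    (fun {a b} => ext_evL fun B => by
      change evL B.model (ε (a * b)) = evL B.model (ε a * ε b)
      rw [map_mul (evL _), evL_ε, evL_ε, evL_ε, map_mul (ev _), Bialgebra.counit_mul])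
    -- The functionals τ_s ⊗ τ_t reduce an identity of tensors to one in the ground ring, which is
    -- checked in every model. There it is the bialgebra axiom, since evaluation preserves
    -- comultiplications.
    ((ops D).ext₂ fun s t => ext_evL fun B => by
      change evL B.model ((ops D).τ₂ s t ((ops D).comul 1)) = _
      rw [← (isHom_ev B.model).map_τ₂, (isHom_ev B.model).map_comul, CovFGL.ops_comul,
        ← (isHom_ev B.model).map_τ₂, map_one (ev _), map_one (tensorSquare _ _ _),
        Bialgebra.comul_one])
    (fun {a b} => (ops D).ext₂ fun s t => ext_evL fun B => by
      change evL B.model ((ops D).τ₂ s t ((ops D).comul (a * b)))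
        = evL B.model ((ops D).τ₂ s t ((ops D).comul a * (ops D).comul b))
      rw [← (isHom_ev B.model).map_τ₂, ← (isHom_ev B.model).map_τ₂, map_mul (tensorSquare _ _ _),
        (isHom_ev B.model).map_comul, (isHom_ev B.model).map_comul,
        (isHom_ev B.model).map_comul, CovFGL.ops_comul, map_mul (ev _),
        Bialgebra.comul_mul])

instance : IsCocomm (L.{u} D) (UnivC.{u} D) := (ops D).isCocomm

/-- The term operation `Y` commutes with all the operators, so `CofreeOps.contract_comul_eq`
exhibits it as a genuine cap product. -/
lemma cap_ε_Y (c : UnivC.{u} D) : cap (ε ∘ₗ Y) c = Y c := by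
  have h : (YV (1 : D) : UnivC.{u} D →ₗ[L.{u} D] UnivC.{u} D) = Y := by
    ext c
    change g 1 * Y (g (1 : D)⁻¹ * c) = _
    simp
  rw [← h]
  exact (ops D).contract_comul_eq (YV 1) (fun V c => (ops D).Y_comm 1 V c) c

variable (D) in
/-- The universal covariant bialgebra of an equivariant formal group law. -/
def univ : CovFGL D (L.{u} D) (UnivC.{u} D) where
  y := ε ∘ₗ Y
  Z := Z
  cap_Z c := ext_ev fun B => by rw [cap_ε_Y, ev_Y, ev_Z, B.model.cap_Z]
  Z_cap c := ext_ev fun B => by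
    rw [cap_ε_Y, ev_Z, ev_Y, B.model.Z_cap, map_sub, ← ev_E]
    rfl
  g := g
  grouplike V := ⟨(ops D).ε_g V, by
    change (ops D).comul ((ops D).g V) = _
    -- A single operator kills g_V, so the recursion stops after its first term g_V ⊗ g_V.
    rw [(ops D).comul_eq_comulList (s := [V]) (by simp [CofreeOps.Y_g])]
    simp only [CofreeOps.comulList, LinearMap.add_apply, LinearMap.comp_apply, CofreeOps.Y_g]
    simp [ops]⟩
  nil c := by
    obtain ⟨s, hs⟩ := (ops D).nil c
    refine ⟨s, ?_⟩
    rw [← hs]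
    refine congrArg (fun f : List (Module.End (L.{u} D) (UnivC.{u} D)) => f.prod c)
      (List.map_congr_left fun V _ => ?_)
    ext c
    change g V * cap (ε ∘ₗ Y) (g V⁻¹ * c) = g V * Y (g V⁻¹ * c)
    rw [cap_ε_Y]

lemma isHom_univ {k C : Type u} [CommRing k] [CommRing C] [Bialgebra k C] [IsCocomm k C]
    (M : CovFGL D k C) : (univ.{u} D).IsHom M (evL M) (ev M) where
  map_algebraMap l := ev_coe M l
  map_counit c := (evL_ε M c).symm
  map_g V := rfl
  map_cap c := by
    change _ = ev M (cap (ε ∘ₗ Y) c)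
    rw [cap_ε_Y, ev_Y]

end UnivC

/-! ### Base change -/

section

open Coalgebra
open CofreeOps (contract contract_tmul)

variable {k C k' C' : Type*} [CommRing k] [CommRing C] [Bialgebra k C] [CommRing k'] [CommRing C']
  [Bialgebra k' C']

lemma contract_tensorSquare {φ : k →+* k'} {Φ : C →+* C'}
    {hΦ : ∀ x, Φ (algebraMap k C x) = algebraMap k' C' (φ x)} {h : C →ₗ[k] k} {h' : C' →ₗ[k'] k'}
    (H : ∀ c, h' (Φ c) = φ (h c)) (w : C ⊗[k] C) :
    contract h' (tensorSquare φ Φ hΦ w) = Φ (contract h w) := by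
  induction w using TensorProduct.induction_on with
  | zero => simp
  | tmul a b => simp [H, Algebra.smul_def, hΦ]
  | add a b ha hb => simp only [map_add, ha, hb]

end

namespace CovFGL

open Coalgebra

variable {k C : Type*} {D : Type*} [CommRing k] [CommRing C] [Bialgebra k C] [IsCocomm k C]
  [CommGroup D] (M : CovFGL D k C) (k' : Type*) [CommRing k'] [Algebra k k']

omit [IsCocomm k C] in
lemma comul_one_tmul (c : C) : comul (R := k') ((1 : k') ⊗ₜ[k] c)
    = tensorSquare (algebraMap k k')
      (Algebra.TensorProduct.includeRight : C →ₐ[k] k' ⊗[k] C).toRingHom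
      (fun x => by
        simp [Algebra.TensorProduct.algebraMap_apply]) (comul c) := by
  rw [TensorProduct.comul_tmul]
  simp only [CommSemiring.comul_apply]
  generalize comul (R := k) c = w
  induction w using TensorProduct.induction_on with
  | zero => simp
  | tmul a b =>
    rw [tensorSquare_tmul]
    rfl
  | add a b ha hb => simp only [map_add, TensorProduct.tmul_add, ha, hb]

/-- The base change of a functional. -/
def baseChangeFunctional (h : C →ₗ[k] k) : k' ⊗[k] C →ₗ[k'] k' :=
  (TensorProduct.AlgebraTensorModule.rid k k' k').toLinearMap ∘ₗ h.baseChange k'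

omit [IsCocomm k C] in
@[simp] lemma baseChangeFunctional_tmul (h : C →ₗ[k] k) (a : k') (c : C) :
    baseChangeFunctional k' h (a ⊗ₜ c) = h c • a := rfl

omit [IsCocomm k C] in
lemma cap_baseChangeFunctional (h : C →ₗ[k] k) :
    cap (baseChangeFunctional k' h) = (cap h).baseChange k' := by
  refine TensorProduct.AlgebraTensorModule.ext fun a c => ?_
  have : a ⊗ₜ[k] c = a • ((1 : k') ⊗ₜ[k] c) := by simp [TensorProduct.smul_tmul']
  rw [this, map_smul, map_smul, cap_apply, comul_one_tmul,
    contract_tensorSquare (h := h) (fun c => by simp [Algebra.algebraMap_eq_smul_one])]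
  rfl

/-- The base change of an orientation. -/
def _root_.CapOrientation.baseChange (O : CapOrientation k C) :
    CapOrientation k' (k' ⊗[k] C) where
  y := baseChangeFunctional k' O.y
  Z := O.Z.baseChange k'
  cap_Z c := by
    rw [cap_baseChangeFunctional, ← LinearMap.comp_apply, ← LinearMap.baseChange_comp]
    have : cap O.y ∘ₗ O.Z = LinearMap.id := LinearMap.ext O.cap_Z
    rw [this]; simp
  Z_cap c := by
    rw [cap_baseChangeFunctional]
    induction c using TensorProduct.induction_on with
    | zero => simp
    | tmul a c =>
      simp only [LinearMap.baseChange_tmul, O.Z_cap, TensorProduct.tmul_sub,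
        TensorProduct.counit_tmul, CommSemiring.counit_apply,
        Algebra.TensorProduct.algebraMap_apply, Algebra.algebraMap_self, RingHom.id_apply]
      congr 1
      rw [Algebra.algebraMap_eq_smul_one, TensorProduct.tmul_smul, TensorProduct.smul_tmul']
    | add a b ha hb => simp only [map_add, ha, hb]; ring

omit [IsCocomm k C] in
lemma _root_.CapOrientation.baseChange_Yop (O : CapOrientation k C) (g : D →* C) (V : D) (a : k')
    (c : C) : (O.baseChange k').Yop
      ((Algebra.TensorProduct.includeRight : C →ₐ[k] k' ⊗[k] C).toMonoidHom.comp g) V (a ⊗ₜ c)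
      = a ⊗ₜ O.Yop g V c := by
  rw [CapOrientation.Yop_apply, CapOrientation.baseChange, cap_baseChangeFunctional]
  change ((1 : k') ⊗ₜ[k] g V) * (cap O.y).baseChange k' ((1 : k') ⊗ₜ[k] g V⁻¹ * a ⊗ₜ[k] c) = _
  simp [CapOrientation.Yop_apply]

omit [IsCocomm k C] in
lemma _root_.CapOrientation.baseChange_Yl (O : CapOrientation k C) (g : D →* C) (s : List D)
    (a : k') (c : C) : (O.baseChange k').Yl
      ((Algebra.TensorProduct.includeRight : C →ₐ[k] k' ⊗[k] C).toMonoidHom.comp g) s (a ⊗ₜ c)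
      = a ⊗ₜ O.Yl g s c := by
  induction s with
  | nil => rfl
  | cons V s ih => rw [CapOrientation.Yl_cons, ih, CapOrientation.baseChange_Yop,
      CapOrientation.Yl_cons]

omit [IsCocomm k C] in
lemma isGroupLikeElem_one_tmul {c : C} (hc : IsGroupLikeElem k c) :
    IsGroupLikeElem k' ((1 : k') ⊗ₜ[k] c) := by
  constructor
  · simp [hc.counit_eq_one]
  · rw [comul_one_tmul, hc.comul_eq_tmul_self, tensorSquare_tmul]
    rfl

/-- The base change of a covariant bialgebra of an equivariant formal group law. -/
def baseChange : CovFGL D k' (k' ⊗[k] C) where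
  toCapOrientation := M.toCapOrientation.baseChange k'
  g := (Algebra.TensorProduct.includeRight : C →ₐ[k] k' ⊗[k] C).toMonoidHom.comp M.g
  grouplike V := isGroupLikeElem_one_tmul k' (M.grouplike V)
  nil c := by
    induction c using TensorProduct.induction_on with
    | zero => exact ⟨[], map_zero _⟩
    | tmul a c =>
      obtain ⟨s, hs⟩ := M.nil c
      exact ⟨s, by rw [CapOrientation.baseChange_Yl, hs, TensorProduct.tmul_zero]⟩
    | add a b ha hb =>
      obtain ⟨s, hs⟩ := ha
      obtain ⟨t, ht⟩ := hb
      refine ⟨s ++ t, ?_⟩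
      rw [map_add, CapOrientation.Yl_append_right _ _ hs, CapOrientation.Yl_append_left _ ht,
        add_zero]
      exact fun V => isGroupLikeElem_one_tmul k' (M.grouplike V)

lemma isHom_baseChange : M.IsHom (M.baseChange k') (algebraMap k k')
    (Algebra.TensorProduct.includeRight : C →ₐ[k] k' ⊗[k] C).toRingHom where
  map_algebraMap x := by
    simp [Algebra.TensorProduct.algebraMap_apply]
  map_counit c := by
    change counit (R := k') ((1 : k') ⊗ₜ[k] c) = _
    simp [Algebra.algebraMap_eq_smul_one]
  map_g V := rfl
  map_cap c := by
    change cap (baseChangeFunctional k' M.y) ((1 : k') ⊗ₜ[k] c) = _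
    rw [cap_baseChangeFunctional]
    rfl

-- Apply `Z_cap` to g_V, whose cap product with y is e_V g_V. The formula shows that g_V becomes 1
-- when e_V is made zero, and it also drives the interpolation between 1 and g_V.
omit [IsCocomm k C] in
lemma g_eq_one_add (V : D) : M.g V = 1 + M.y (M.g V) • M.Z (M.g V) := by
  have h := M.Z_cap (M.g V)
  rw [cap_grouplike _ (M.grouplike V), map_smul, (M.grouplike V).counit_eq_one, map_one] at h
  rw [h]; ring

/-! ### Change of the grading group. -/

variable {E : Type*} [CommGroup E] (q : D →* E) (hq : Function.Surjective q)

/-- The restriction of the grading group along a surjection. -/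
def pullback (N : CovFGL E k C) : CovFGL D k C where
  toCapOrientation := N.toCapOrientation
  g := N.g.comp q
  grouplike V := N.grouplike (q V)
  nil c := by
    obtain ⟨s, hs⟩ := N.nil c
    obtain ⟨t, rfl⟩ := List.map_surjective_iff.mpr hq s
    refine ⟨t, ?_⟩
    rw [CapOrientation.Yl, List.map_map] at hs
    rw [← hs, CapOrientation.Yl]
    congr 2
    refine List.map_congr_left fun V _ => LinearMap.ext fun c => ?_
    simp [CapOrientation.Yop_apply]

/-- The factorization of a map to a monoid through a surjection of groups. -/
def liftGrouplike {R : Type*} [CommRing R] (g : D →* R) (h : ∀ V, q V = 1 → g V = 1) : E →* R :=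
  (Units.coeHom R).comp (q.liftOfSurjective hq
    ⟨g.toHomUnits, fun V hV => Units.ext (h V (MonoidHom.mem_ker.mp hV))⟩)

lemma liftGrouplike_apply {R : Type*} [CommRing R] (g : D →* R) (h : ∀ V, q V = 1 → g V = 1)
    (V : D) : liftGrouplike q hq g h (q V) = g V := by
  have := q.liftOfRightInverse_comp_apply _ (Function.rightInverse_surjInv hq)
    ⟨g.toHomUnits, fun V hV => Units.ext (h V (MonoidHom.mem_ker.mp hV))⟩ V
  exact congrArg Units.val this

/-- The descent of the grading group along a surjection with kernel acting trivially. -/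
def descend (h : ∀ V, q V = 1 → M.g V = 1) : CovFGL E k C where
  toCapOrientation := M.toCapOrientation
  g := liftGrouplike q hq M.g h
  grouplike V := by
    obtain ⟨V, rfl⟩ := hq V
    rw [liftGrouplike_apply]
    exact M.grouplike V
  nil c := by
    obtain ⟨s, hs⟩ := M.nil c
    refine ⟨s.map q, ?_⟩
    rw [← hs, CapOrientation.Yl, CapOrientation.Yl, List.map_map]
    congr 2
    refine List.map_congr_left fun V _ => LinearMap.ext fun c => ?_
    simp only [Function.comp_apply, CapOrientation.Yop_apply, ← map_inv q, liftGrouplike_apply]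

omit [IsCocomm k C] in
lemma isHom_pullback {k' C' : Type*} [CommRing k'] [CommRing C'] [Bialgebra k' C']
    {N : CovFGL E k C} {N' : CovFGL E k' C'} {φ : k →+* k'} {Φ : C →+* C'} (H : N.IsHom N' φ Φ) :
    (N.pullback q hq).IsHom (N'.pullback q hq) φ Φ where
  map_algebraMap := H.map_algebraMap
  map_counit := H.map_counit
  map_g V := H.map_g (q V)
  map_cap := H.map_cap

omit [IsCocomm k C] in
lemma pullback_descend (h : ∀ V, q V = 1 → M.g V = 1) :
    (M.descend q hq h).pullback q hq = M := by
  have : (M.descend q hq h).g.comp q = M.g :=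
    MonoidHom.ext fun V => liftGrouplike_apply q hq M.g h V
  rcases M with ⟨O, g, h1, h2⟩
  simp only [pullback, descend] at this ⊢
  congr

end CovFGL

/-! ### Euler classes and restriction maps of the universal ring. -/

namespace UnivC

open Coalgebra CovTerm

variable {D : Type} [CommGroup D]

lemma eval_univ (t : CovTerm.{u} D) : eval (univ.{u} D) t = mk t := by
  refine ext_ev fun B => ?_
  rw [map_eval (isHom_univ B.model), ev_mk]

lemma ev_univ (c : UnivC.{u} D) : ev (univ.{u} D) c = c := by
  obtain ⟨t, rfl⟩ := mk_surjective c
  exact eval_univ t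

lemma evL_univ (l : L.{u} D) : evL (univ.{u} D) l = l :=
  ext_evL fun B => by
    have : evL (univ.{u} D) l = ε (l : UnivC.{u} D) := by rw [evL_apply, ev_univ]; rfl
    rw [this, evL_ε, evL_apply]

variable {k C k' C' : Type u} [CommRing k] [CommRing C] [Bialgebra k C] [IsCocomm k C]
  [CommRing k'] [CommRing C'] [Bialgebra k' C'] [IsCocomm k' C']

lemma map_ev {M : CovFGL D k C} {M' : CovFGL D k' C'} {φ : k →+* k'} {Φ : C →+* C'}
    (H : M.IsHom M' φ Φ) (c : UnivC.{u} D) : Φ (ev M c) = ev M' c := by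
  obtain ⟨t, rfl⟩ := mk_surjective c
  exact map_eval H t

lemma map_evL {M : CovFGL D k C} {M' : CovFGL D k' C'} {φ : k →+* k'} {Φ : C →+* C'}
    (H : M.IsHom M' φ Φ) (l : L.{u} D) : φ (evL M l) = evL M' l := by
  rw [evL_apply, evL_apply, ← map_ev H, H.map_counit]

/-- The Euler class of a character in the universal ring. -/
def euler (V : D) : L.{u} D := (univ D).y (g V)

lemma evL_euler (M : CovFGL D k C) (V : D) : evL M (euler V) = M.y (M.g V) := by
  rw [euler, ← (isHom_univ M).map_y, ev_g]

variable {E : Type} [CommGroup E] (q : D →* E) (hq : Function.Surjective q)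

/-- The restriction map of universal rings. -/
def res : L.{u} D →+* L.{u} E := evL ((univ E).pullback q hq)

lemma evL_pullback (N : CovFGL E k C) (l : L.{u} D) :
    evL (N.pullback q hq) l = evL N (res q hq l) :=
  (map_evL (CovFGL.isHom_pullback q hq (isHom_univ N)) l).symm

-- Only the letters `g V` see the grading group, and these lift because `q` is onto. This gives the
-- surjectivity of restriction.
omit [IsCocomm k C] in
lemma exists_eval_pullback (t : CovTerm.{u} E) : ∃ t' : CovTerm.{u} D,
    ∀ N : CovFGL E k C, eval (N.pullback q hq) t' = eval N t := by
  induction t with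
  | zero => exact ⟨.zero, fun _ => rfl⟩
  | one => exact ⟨.one, fun _ => rfl⟩
  | add a b ha hb =>
    obtain ⟨a, ha⟩ := ha
    obtain ⟨b, hb⟩ := hb
    exact ⟨.add a b, fun N => by rw [eval, eval, ha, hb]⟩
  | neg a ha =>
    obtain ⟨a, ha⟩ := ha
    exact ⟨.neg a, fun N => by rw [eval, eval, ha]⟩
  | mul a b ha hb =>
    obtain ⟨a, ha⟩ := ha
    obtain ⟨b, hb⟩ := hb
    exact ⟨.mul a b, fun N => by rw [eval, eval, ha, hb]⟩
  | g V =>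
    obtain ⟨V, rfl⟩ := hq V
    exact ⟨.g V, fun _ => rfl⟩
  | Y a ha =>
    obtain ⟨a, ha⟩ := ha
    exact ⟨.Y a, fun N => by rw [eval, eval, ha]; rfl⟩
  | Z a ha =>
    obtain ⟨a, ha⟩ := ha
    exact ⟨.Z a, fun N => by rw [eval, eval, ha]; rfl⟩
  | E a ha =>
    obtain ⟨a, ha⟩ := ha
    exact ⟨.E a, fun N => by rw [eval, eval, ha]⟩

lemma res_surjective : Function.Surjective (res.{u} q hq) := by
  rintro ⟨_, c, rfl⟩
  obtain ⟨t, rfl⟩ := mk_surjective c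
  obtain ⟨t', ht⟩ := exists_eval_pullback (k := L.{u} E) (C := UnivC.{u} E) q hq t
  refine ⟨ε (mk t'), ?_⟩
  rw [res, evL_ε, ev_mk, ht, eval_univ]
  rfl

lemma res_euler (V : D) : res.{u} q hq (euler V) = euler (q V) := evL_euler _ V

lemma euler_one : euler.{u} (1 : D) = 0 := by
  rw [euler, map_one, (univ D).y_one]

/-- Modulo e_V the grouplike element of V, and hence of each of its powers, is 1. The universal
model modulo e_V thus descends along `q`, and reduction modulo e_V factors through the restriction
map. -/
lemma res_ker (V : D) (hV : q.ker = Subgroup.zpowers V) :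
    RingHom.ker (res.{u} q hq) = Ideal.span {euler V} := by
  refine le_antisymm (fun l hl => ?_) ?_
  · have hg : ∀ W, q W = 1 → ((univ.{u} D).baseChange (L.{u} D ⧸ Ideal.span {euler V})).g W = 1 := by
      intro W hW
      obtain ⟨n, rfl⟩ := Subgroup.mem_zpowers_iff.mp (hV ▸ MonoidHom.mem_ker.mpr hW)
      have h1 : ((univ.{u} D).baseChange (L.{u} D ⧸ Ideal.span {euler V})).g V = 1 := by
        rw [CovFGL.g_eq_one_add,
          ← ((univ.{u} D).isHom_baseChange (L.{u} D ⧸ Ideal.span {euler V})).map_g,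
          ((univ.{u} D).isHom_baseChange (L.{u} D ⧸ Ideal.span {euler V})).map_y]
        have : algebraMap (L.{u} D) (L.{u} D ⧸ Ideal.span {euler V}) ((univ D).y ((univ D).g V)) = 0 :=
          Ideal.Quotient.eq_zero_iff_mem.mpr (Ideal.mem_span_singleton_self _)
        rw [this, zero_smul, add_zero]
      have h2 : V ∈ (MonoidHom.ker ((univ.{u} D).baseChange
          (L.{u} D ⧸ Ideal.span {euler V})).g) := h1
      exact (Subgroup.zpow_mem _ h2 n : _)
    -- The reduction is the classifying map of the base-changed model. That model is a pullback
    -- along `q`, so the reduction kills `l`.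
    have h := map_evL ((univ.{u} D).isHom_baseChange (L.{u} D ⧸ Ideal.span {euler V})) l
    rw [evL_univ, ← CovFGL.pullback_descend _ q hq hg, evL_pullback, RingHom.mem_ker.mp hl,
      map_zero (evL _)] at h
    exact Ideal.Quotient.eq_zero_iff_mem.mp h
  · rw [Ideal.span_singleton_le_iff_mem, RingHom.mem_ker, res_euler]
    have : q V = 1 := MonoidHom.mem_ker.mp (hV ▸ Subgroup.mem_zpowers V)
    rw [this, euler_one]

end UnivC

/-! ### The nilpotent part of an orientation -/

namespace CapOrientation

open Coalgebra
open CofreeOps (contract contract_tmul)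

variable {k C : Type*} {D : Type} [CommRing k] [CommRing C] [Bialgebra k C] [IsCocomm k C] [CommGroup D]
  (O : CapOrientation k C) (α : D →* C) (hα : ∀ V, IsGroupLikeElem k (α V))

omit [IsCocomm k C] in
lemma Yop_algebraMap (x : k) : O.Yop α 1 (algebraMap k C x) = 0 := by
  rw [CapOrientation.Yop_one, Algebra.algebraMap_eq_smul_one, map_smul,
    cap_grouplike _ (a := (1 : C)) .one, O.y_one, zero_smul, smul_zero]

omit [IsCocomm k C] in
lemma Zop_one (c : C) : O.Zop α 1 c = O.Z c := by simp [Zop_apply]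

/-- The subalgebra of elements killed by a finite product of operators. -/
def NilPart (O : CapOrientation k C) (α : D →* C) (hα : ∀ V, IsGroupLikeElem k (α V)) :
    Subalgebra k C where
  -- For grouplike elements `α` other than those of the model, nilpotence may fail on `C`. The
  -- largest part on which it holds still carries all of the structure.
  carrier := {c | ∃ s, O.Yl α s c = 0}
  mul_mem' := by
    rintro a b ⟨s, hs⟩ ⟨t, ht⟩
    exact ⟨prodList s t, O.Yl_prodList hα s t hs ht⟩
  add_mem' := by
    rintro a b ⟨s, hs⟩ ⟨t, ht⟩
    exact ⟨s ++ t, by rw [map_add, O.Yl_append_right hα hs, O.Yl_append_left ht, add_zero]⟩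
  algebraMap_mem' x := ⟨[1], O.Yop_algebraMap α x⟩

namespace NilPart

variable {O α hα}

lemma cap_mem (h : C →ₗ[k] k) {c : C} (hc : c ∈ NilPart O α hα) : cap h c ∈ NilPart O α hα := by
  obtain ⟨s, hs⟩ := hc
  exact ⟨s, by rw [← O.cap_Yl hα, hs, map_zero]⟩

lemma Yop_mem (V : D) {c : C} (hc : c ∈ NilPart O α hα) : O.Yop α V c ∈ NilPart O α hα := by
  rw [O.Yop_eq_cap hα]
  exact cap_mem _ hc

lemma Zop_mem (V : D) {c : C} (hc : c ∈ NilPart O α hα) : O.Zop α V c ∈ NilPart O α hα := by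
  obtain ⟨s, hs⟩ := hc
  exact ⟨V :: s, by rw [Yl_cons, O.Yop_Yl hα, Yop_Zop, hs]⟩

omit [IsCocomm k C] in
lemma _root_.CapOrientation.Yop_self (O : CapOrientation k C) (α : D →* C)
    (V : D) : O.Yop α V (α V) = 0 := by
  rw [Yop_apply, ← map_mul α, inv_mul_cancel, map_one, cap_grouplike _ (a := (1 : C)) .one,
    O.y_one, zero_smul, mul_zero]

lemma α_mem (V : D) : α V ∈ NilPart O α hα := ⟨[V], O.Yop_self α V⟩

variable (O α hα) in
/-- The restriction of an operator to the nilpotent part. -/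
def Yres (V : D) : Module.End k (NilPart O α hα) :=
  (O.Yop α V).restrict (p := (NilPart O α hα).toSubmodule)
    (q := (NilPart O α hα).toSubmodule) fun _ hc => Yop_mem (hα := hα) V hc

variable (O α hα) in
/-- The restriction of a section to the nilpotent part. -/
def Zres (V : D) : Module.End k (NilPart O α hα) :=
  (O.Zop α V).restrict (p := (NilPart O α hα).toSubmodule)
    (q := (NilPart O α hα).toSubmodule) fun _ hc => Zop_mem (hα := hα) V hc

variable (O α hα) in
/-- The operators on the nilpotent part. -/
def ops : CofreeOps k (NilPart O α hα) D where
  ε := counit ∘ₗ (NilPart O α hα).val.toLinearMap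
  Y := Yres O α hα
  Z := Zres O α hα
  g V := ⟨α V, α_mem V⟩
  Y_comm V W c := Subtype.ext (O.Yop_comm hα V W (c : C))
  Y_Z V c := Subtype.ext (O.Yop_Zop V (c : C))
  Z_Y V c := Subtype.ext (O.Zop_Yop hα V (c : C))
  ε_g V := (hα V).counit_eq_one
  nil c := by
    obtain ⟨s, hs⟩ := c.2
    refine ⟨s, Subtype.ext (Eq.trans ?_ hs)⟩
    clear hs
    induction s with
    | nil => rfl
    | cons V s ih =>
      rw [List.map_cons, List.prod_cons, Yl_cons, ← ih]
      rfl

lemma coe_Ys (s : List D) (c : NilPart O α hα) :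
    (((ops O α hα).Ys s c : NilPart O α hα) : C) = O.Yl α s c := by
  induction s with
  | nil => rfl
  | cons V s ih =>
    rw [CofreeOps.Ys_cons, Yl_cons, ← ih]
    rfl

variable (O α hα) in
/-- The inclusion of tensor squares of the nilpotent part. -/
def inclSquare : NilPart O α hα ⊗[k] NilPart O α hα →ₐ[k] C ⊗[k] C :=
  Algebra.TensorProduct.map (NilPart O α hα).val (NilPart O α hα).val

@[simp] lemma inclSquare_tmul (a b : NilPart O α hα) :
    inclSquare O α hα (a ⊗ₜ b) = (a : C) ⊗ₜ (b : C) := rfl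

lemma inclSquare_comulList (s : List D) {c : NilPart O α hα} (hc : (ops O α hα).Ys s c = 0) :
    inclSquare O α hα ((ops O α hα).comulList s c) = comul (c : C) := by
  induction s generalizing c with
  | nil =>
    obtain rfl : c = 0 := hc
    simp [CofreeOps.comulList]
  | cons V s ih =>
    rw [O.comul_eq_add hα V]
    have h1 : (ops O α hα).Ys s ((ops O α hα).Y V c) = 0 := by rw [← CofreeOps.Y_Ys]; simpa using hc
    have h2 := ih h1
    have h3 : ((((ops O α hα).Y V c) : NilPart O α hα) : C) = O.Yop α V c := rfl
    rw [← h3, ← h2]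
    simp only [CofreeOps.comulList, LinearMap.add_apply, map_add, LinearMap.comp_apply]
    congr 1
    generalize (ops O α hα).comulList s ((ops O α hα).Y V c) = w
    induction w using TensorProduct.induction_on with
    | zero => simp
    | tmul a b => rfl
    | add a b ha hb => simp only [map_add, ha, hb]

lemma inclSquare_comul (c : NilPart O α hα) :
    inclSquare O α hα ((ops O α hα).comul c) = comul (c : C) := by
  obtain ⟨s, hs⟩ := (ops O α hα).exists_Ys c
  rw [(ops O α hα).comul_eq_comulList hs, inclSquare_comulList s hs]

/-- The separating functionals factor through `inclSquare`. Identities in the tensor square of the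
nilpotent part can therefore be verified in C ⊗ C, although C is not assumed flat. -/
lemma τ₂_eq (s t : List D) (w : NilPart O α hα ⊗[k] NilPart O α hα) :
    (ops O α hα).τ₂ s t w = LinearMap.mul' k k (TensorProduct.map (counit ∘ₗ O.Yl α s)
      (counit ∘ₗ O.Yl α t) (inclSquare O α hα w)) := by
  induction w using TensorProduct.induction_on with
  | zero => simp
  | add a b ha hb => simp only [map_add, ha, hb]
  | tmul a b =>
    simp only [CofreeOps.τ₂_tmul, CofreeOps.τ_apply, inclSquare_tmul, TensorProduct.map_tmul,
      LinearMap.mul'_apply, LinearMap.comp_apply, ← coe_Ys]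
    rfl

instance : Bialgebra k (NilPart O α hα) :=
  letI := (ops O α hα).coalgebra
  Bialgebra.mk' _ _ (Bialgebra.counit_one (R := k) (A := C))
    (fun {a b} => Bialgebra.counit_mul (R := k) (a : C) (b : C))
    ((ops O α hα).ext₂ fun s t => by
      change (ops O α hα).τ₂ s t ((ops O α hα).comul 1) = _
      rw [τ₂_eq, τ₂_eq, inclSquare_comul, map_one (inclSquare O α hα), OneMemClass.coe_one,
        Bialgebra.comul_one])
    (fun {a b} => (ops O α hα).ext₂ fun s t => by
      change (ops O α hα).τ₂ s t ((ops O α hα).comul (a * b)) =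
        (ops O α hα).τ₂ s t ((ops O α hα).comul a * (ops O α hα).comul b)
      rw [τ₂_eq, τ₂_eq, inclSquare_comul, map_mul (inclSquare O α hα), inclSquare_comul,
        inclSquare_comul, MulMemClass.coe_mul, Bialgebra.comul_mul])

instance : IsCocomm k (NilPart O α hα) := (ops O α hα).isCocomm

lemma inclSquare_comul' (c : NilPart O α hα) :
    inclSquare O α hα (comul (R := k) c) = comul (c : C) := inclSquare_comul c

lemma coe_cap (h : C →ₗ[k] k) (c : NilPart O α hα) :
    ((cap (h ∘ₗ (NilPart O α hα).val.toLinearMap) c : NilPart O α hα) : C) = cap h (c : C) := by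
  rw [cap_apply, cap_apply, ← inclSquare_comul']
  generalize comul (R := k) c = w
  induction w using TensorProduct.induction_on with
  | zero => simp
  | tmul a b => rfl
  | add a b ha hb => simp only [map_add, ← ha, ← hb]; rfl

lemma isGroupLikeElem {c : NilPart O α hα} (hc : IsGroupLikeElem k (c : C)) :
    IsGroupLikeElem k c := by
  refine ⟨hc.counit_eq_one, (ops O α hα).ext₂ fun s t => ?_⟩
  rw [τ₂_eq, τ₂_eq, inclSquare_comul', hc.comul_eq_tmul_self, inclSquare_tmul]

variable (O α hα) in
/-- The covariant bialgebra on the nilpotent part. -/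
def model : CovFGL D k (NilPart O α hα) where
  y := O.y ∘ₗ (NilPart O α hα).val.toLinearMap
  Z := O.Z.restrict (p := (NilPart O α hα).toSubmodule) (q := (NilPart O α hα).toSubmodule)
    fun c hc => by rw [← O.Zop_one α]; exact Zop_mem (O := O) (α := α) (hα := hα) 1 hc
  cap_Z c := Subtype.ext ((coe_cap _ _).trans (O.cap_Z _))
  Z_cap c := Subtype.ext ((congrArg O.Z (coe_cap _ _)).trans (O.Z_cap _))
  g := α.codRestrict (NilPart O α hα).toSubmonoid α_mem
  grouplike V := isGroupLikeElem (hα V)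
  nil c := by
    obtain ⟨s, hs⟩ := (ops O α hα).nil c
    refine ⟨s, ?_⟩
    rw [← hs]
    refine congrArg (fun f : List (Module.End k (NilPart O α hα)) => f.prod c)
      (List.map_congr_left fun V _ => LinearMap.ext fun c => Subtype.ext ?_)
    change α V * ((cap (O.y ∘ₗ (NilPart O α hα).val.toLinearMap) _ : NilPart O α hα) : C) = _
    rw [coe_cap]
    rfl

end NilPart

end CapOrientation

/-! ### Adjoining a root of a grouplike element -/

section RootExt

open Coalgebra Polynomial
open CofreeOps (contract contract_tmul)

variable {k : Type*} {C : Type u} [CommRing k] [CommRing C] [Bialgebra k C]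

/-- The bialgebra obtained by adjoining a grouplike `m`-th root of a grouplike element. -/
def RootExt (m : ℕ) (a : C) (_ : IsGroupLikeElem k a) : Type u := AdjoinRoot (X ^ m - Polynomial.C a : C[X])

namespace RootExt

variable {m : ℕ} {a : C} {ha : IsGroupLikeElem k a}

instance : CommRing (RootExt m a ha) := inferInstanceAs (CommRing (AdjoinRoot _))

instance : Algebra k (RootExt m a ha) :=
  inferInstanceAs (Algebra k (AdjoinRoot (X ^ m - Polynomial.C a : C[X])))

/-- The inclusion of the base. -/
def of : C →ₐ[k] RootExt m a ha := AdjoinRoot.ofAlgHom k _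

/-- The adjoined root. -/
def root : RootExt m a ha := AdjoinRoot.root (X ^ m - Polynomial.C a : C[X])

lemma root_pow : (root : RootExt m a ha) ^ m = of a := by
  have h := AdjoinRoot.eval₂_root (X ^ m - Polynomial.C a : C[X])
  rw [eval₂_sub, eval₂_pow, eval₂_X, eval₂_C, sub_eq_zero] at h
  exact h

/-- The ring map out of an extension by a root. -/
def lift {T : Type*} [CommRing T] (i : C →+* T) (x : T) (h : x ^ m = i a) :
    RootExt m a ha →+* T :=
  AdjoinRoot.lift i x (by rw [eval₂_sub, eval₂_pow, eval₂_X, eval₂_C, h, sub_self])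

section

variable {T : Type*} [CommRing T] (i : C →+* T) (x : T) (h : x ^ m = i a)

@[simp] lemma lift_of (c : C) : lift (ha := ha) i x h (of c) = i c := AdjoinRoot.lift_of _

@[simp] lemma lift_root : lift (ha := ha) i x h root = x := AdjoinRoot.lift_root _

end

/-- The algebra map out of an extension by a root. -/
def liftₐ {T : Type*} [CommRing T] [Algebra k T] (i : C →ₐ[k] T) (x : T) (h : x ^ m = i a) :
    RootExt m a ha →ₐ[k] T where
  __ := lift i.toRingHom x h
  commutes' r := by
    change lift i.toRingHom x h (algebraMap k _ r) = _
    rw [← of.commutes, lift_of]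
    exact i.commutes r

section

variable {T : Type*} [CommRing T] [Algebra k T] (i : C →ₐ[k] T) (x : T) (h : x ^ m = i a)

@[simp] lemma liftₐ_of (c : C) : liftₐ (ha := ha) i x h (of c) = i c :=
  lift_of i.toRingHom x h c

@[simp] lemma liftₐ_root : liftₐ (ha := ha) i x h root = x := lift_root i.toRingHom x h

end

lemma algHom_ext {T : Type*} [CommRing T] [Algebra k T] {f g : RootExt m a ha →ₐ[k] T}
    (h : ∀ c, f (of c) = g (of c)) (hr : f root = g root) : f = g :=
  AdjoinRoot.algHom_ext' (AlgHom.ext h) hr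

lemma induction {p : RootExt m a ha → Prop} (hof : ∀ c, p (of c)) (hroot : p root)
    (hadd : ∀ x y, p x → p y → p (x + y)) (hmul : ∀ x y, p x → p y → p (x * y))
    (x : RootExt m a ha) : p x := by
  induction x using AdjoinRoot.induction_on with
  | ih q =>
    induction q using Polynomial.induction_on' with
    | add q r hq hr => rw [map_add]; exact hadd _ _ hq hr
    | monomial n c =>
      have h1 : AdjoinRoot.mk (X ^ m - Polynomial.C a : C[X]) (monomial n c)
          = (of c * root ^ n : RootExt m a ha) := by
        rw [← C_mul_X_pow_eq_monomial, map_mul, map_pow]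
        rfl
      rw [h1]
      clear h1
      induction n with
      | zero => rw [pow_zero, mul_one]; exact hof c
      | succ n ih => rw [pow_succ, ← mul_assoc]; exact hmul _ _ ih hroot

variable (m a ha) in
/-- The inclusion of tensor squares. -/
def ofSquare : C ⊗[k] C →ₐ[k] RootExt m a ha ⊗[k] RootExt m a ha :=
  Algebra.TensorProduct.map of of

@[simp] lemma ofSquare_tmul (x y : C) : ofSquare m a ha (x ⊗ₜ y) = of x ⊗ₜ of y := rfl

variable (m a ha) in
/-- The comultiplication of an extension by a root. -/
def comulₐ : RootExt m a ha →ₐ[k] RootExt m a ha ⊗[k] RootExt m a ha :=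
  liftₐ ((ofSquare m a ha).comp (Bialgebra.comulAlgHom k C)) (root ⊗ₜ root)
    (by simp [Algebra.TensorProduct.tmul_pow, root_pow, ha.comul_eq_tmul_self])

variable (m a ha) in
/-- The counit of an extension by a root. -/
def counitₐ : RootExt m a ha →ₐ[k] k :=
  liftₐ (Bialgebra.counitAlgHom k C) 1 (by simp [ha.counit_eq_one])

@[simp] lemma comulₐ_of (c : C) : comulₐ m a ha (of c) = ofSquare m a ha (comul c) :=
  liftₐ_of _ _ _ c

@[simp] lemma comulₐ_root : comulₐ m a ha root = root ⊗ₜ root := liftₐ_root _ _ _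

@[simp] lemma counitₐ_of (c : C) : counitₐ m a ha (of c) = counit c := liftₐ_of _ _ _ c

@[simp] lemma counitₐ_root : counitₐ m a ha root = 1 := liftₐ_root _ _ _

lemma assoc_map_comulₐ (w : C ⊗[k] C) :
    Algebra.TensorProduct.assoc k k k (RootExt m a ha) (RootExt m a ha) (RootExt m a ha)
      (Algebra.TensorProduct.map (comulₐ m a ha) (.id k (RootExt m a ha)) (ofSquare m a ha w))
      = Algebra.TensorProduct.map of (ofSquare m a ha)
        (TensorProduct.assoc k C C C (comul.rTensor C w)) := by
  induction w using TensorProduct.induction_on with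
  | zero => simp
  | add x y hx hy => simp only [map_add, hx, hy]
  | tmul x y =>
    simp only [ofSquare_tmul, Algebra.TensorProduct.map_tmul, comulₐ_of, LinearMap.rTensor_tmul,
      AlgHom.id_apply]
    generalize comul (R := k) x = v
    induction v using TensorProduct.induction_on with
    | zero => simp
    | add p q hp hq => simp only [map_add, TensorProduct.add_tmul, hp, hq]
    | tmul p q => rfl

lemma map_id_comulₐ (w : C ⊗[k] C) :
    Algebra.TensorProduct.map (.id k (RootExt m a ha)) (comulₐ m a ha) (ofSquare m a ha w)
      = Algebra.TensorProduct.map of (ofSquare m a ha) (comul.lTensor C w) := by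
  induction w using TensorProduct.induction_on with
  | zero => simp
  | add x y hx hy => simp only [map_add, hx, hy]
  | tmul x y => simp

lemma map_counitₐ_id (w : C ⊗[k] C) :
    Algebra.TensorProduct.map (counitₐ m a ha) (.id k (RootExt m a ha)) (ofSquare m a ha w)
      = (of : C →ₐ[k] RootExt m a ha).toLinearMap.lTensor k (counit.rTensor C w) := by
  induction w using TensorProduct.induction_on with
  | zero => simp
  | add x y hx hy => simp only [map_add, hx, hy]
  | tmul x y => simp

lemma map_id_counitₐ (w : C ⊗[k] C) :
    Algebra.TensorProduct.map (.id k (RootExt m a ha)) (counitₐ m a ha) (ofSquare m a ha w)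
      = (of : C →ₐ[k] RootExt m a ha).toLinearMap.rTensor k (counit.lTensor C w) := by
  induction w using TensorProduct.induction_on with
  | zero => simp
  | add x y hx hy => simp only [map_add, hx, hy]
  | tmul x y => simp

instance : Bialgebra k (RootExt m a ha) :=
  Bialgebra.ofAlgHom (comulₐ m a ha) (counitₐ m a ha)
    (algHom_ext (fun c => by
      change Algebra.TensorProduct.assoc k k k (RootExt m a ha) _ _
        (Algebra.TensorProduct.map _ _ (comulₐ m a ha (of c))) =
        Algebra.TensorProduct.map _ _ (comulₐ m a ha (of c))
      rw [comulₐ_of, assoc_map_comulₐ, map_id_comulₐ, coassoc_apply])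
      (by
        change Algebra.TensorProduct.assoc k k k (RootExt m a ha) _ _
          (Algebra.TensorProduct.map _ _ (comulₐ m a ha root)) =
          Algebra.TensorProduct.map _ _ (comulₐ m a ha root)
        simp))
    (algHom_ext (fun c => by
      change Algebra.TensorProduct.map _ _ (comulₐ m a ha (of c)) = _
      rw [comulₐ_of, map_counitₐ_id, rTensor_counit_comul]
      rfl) (by
        change Algebra.TensorProduct.map _ _ (comulₐ m a ha root) = _
        simp))
    (algHom_ext (fun c => by
      change Algebra.TensorProduct.map _ _ (comulₐ m a ha (of c)) = _
      rw [comulₐ_of, map_id_counitₐ, lTensor_counit_comul]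
      rfl) (by
        change Algebra.TensorProduct.map _ _ (comulₐ m a ha root) = _
        simp))

lemma comul_of (c : C) : comul (R := k) (of c : RootExt m a ha)
    = ofSquare m a ha (comul (R := k) c) := comulₐ_of c

lemma counit_of (c : C) : counit (R := k) (of c : RootExt m a ha) = counit c :=
  counitₐ_of (m := m) (ha := ha) c

lemma isGroupLikeElem_root : IsGroupLikeElem k (root : RootExt m a ha) :=
  ⟨counitₐ_root (m := m) (ha := ha), comulₐ_root⟩

lemma isGroupLikeElem_of {c : C} (hc : IsGroupLikeElem k c) :
    IsGroupLikeElem k (of c : RootExt m a ha) :=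
  ⟨by rw [counit_of, hc.counit_eq_one], by
    rw [comul_of, hc.comul_eq_tmul_self, ofSquare_tmul]⟩

instance [IsCocomm k C] : IsCocomm k (RootExt m a ha) where
  comm_comp_comul := by
    have : (Algebra.TensorProduct.comm k _ _).toAlgHom.comp
        (Bialgebra.comulAlgHom k (RootExt m a ha)) = Bialgebra.comulAlgHom k _ :=
      algHom_ext (fun c => by
        change Algebra.TensorProduct.comm k _ _ (comul (of c)) = comul (of c)
        rw [comul_of]
        have h : ∀ w : C ⊗[k] C, Algebra.TensorProduct.comm k (RootExt m a ha) (RootExt m a ha)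
            (ofSquare m a ha w)
            = ofSquare m a ha (TensorProduct.comm k C C w) := fun w => by
          induction w using TensorProduct.induction_on with
          | zero => simp
          | add x y hx hy => simp only [map_add, hx, hy]
          | tmul x y => simp
        rw [h, comm_comul])
        (by
          change Algebra.TensorProduct.comm k _ _ (comul root) = comul root
          rw [isGroupLikeElem_root.comul_eq_tmul_self, Algebra.TensorProduct.comm_tmul])
    exact congrArg AlgHom.toLinearMap this

lemma contract_ofSquare (h : RootExt m a ha →ₗ[k] k) (w : C ⊗[k] C) :
    contract h (ofSquare m a ha w) = of (contract (h ∘ₗ of.toLinearMap) w) := by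
  induction w using TensorProduct.induction_on with
  | zero => simp
  | add x y hx hy => simp only [map_add, hx, hy]
  | tmul x y => simp

lemma cap_of (h : RootExt m a ha →ₗ[k] k) (c : C) :
    cap h (of c) = of (cap (h ∘ₗ of.toLinearMap) c) := by
  rw [cap_apply, comul_of, contract_ofSquare, cap_apply]

/-- Powers of the root are grouplike, so cap products preserve the decomposition into multiples of
these powers. An orientation can be prescribed on each summand separately. -/
lemma cap_root_mul_of (h : RootExt m a ha →ₗ[k] k) (i : ℕ) (c : C) :
    cap h (root ^ i * of c)
      = root ^ i * of (cap (h ∘ₗ LinearMap.mulLeft k (root ^ i) ∘ₗ of.toLinearMap) c) := by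
  have : IsGroupLikeElem k ((root : RootExt m a ha) ^ i) := isGroupLikeElem_root.pow
  rw [cap_grouplike_mul _ this, cap_of, LinearMap.comp_assoc]

section Basis

variable [Nontrivial C] [NeZero m]

instance : Module C (RootExt m a ha) :=
  inferInstanceAs (Module C (AdjoinRoot (X ^ m - Polynomial.C a : C[X])))

instance : IsScalarTower k C (RootExt m a ha) :=
  inferInstanceAs (IsScalarTower k C (AdjoinRoot (X ^ m - Polynomial.C a : C[X])))

omit [Nontrivial C] [NeZero m] in
lemma mul_of (c : C) (x : RootExt m a ha) : x * of c = c • x :=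
  (mul_comm _ _).trans (Algebra.smul_def (A := AdjoinRoot (X ^ m - Polynomial.C a : C[X])) c x).symm

lemma exists_basis : ∃ b : Module.Basis (Fin m) C (RootExt m a ha),
    ∀ i, b i = root ^ (i : ℕ) := by
  have h := natDegree_X_pow_sub_C (R := C) (n := m) (r := a)
  have : ∃ b : Module.Basis (Fin m) C (AdjoinRoot (X ^ m - Polynomial.C a : C[X])),
      ∀ i, b i = AdjoinRoot.root (X ^ m - Polynomial.C a : C[X]) ^ (i : ℕ) :=
    ⟨(AdjoinRoot.powerBasis' (monic_X_pow_sub_C a (NeZero.ne m))).basis.reindex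
      (finCongr h), fun i => (Module.Basis.reindex_apply _ _ _).trans
        (PowerBasis.basis_eq_pow _ _)⟩
  exact this

variable (m a ha) in
/-- The basis of powers of the root. -/
def basis : Module.Basis (Fin m) C (RootExt m a ha) := exists_basis.choose

lemma basis_apply (i : Fin m) : basis m a ha i = root ^ (i : ℕ) := exists_basis.choose_spec i

variable (m a ha) in
/-- The coordinates of an extension by a root. -/
def coord (i : Fin m) : RootExt m a ha →ₗ[k] C := ((basis m a ha).coord i).restrictScalars k

lemma coord_root_mul_of (i j : Fin m) (c : C) :
    coord m a ha i (root ^ (j : ℕ) * of c) = if j = i then c else 0 := by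
  rw [mul_of, ← basis_apply]
  change (basis m a ha).coord i _ = _
  rw [map_smul,
    Module.Basis.coord_apply, Module.Basis.repr_self, Finsupp.single_apply]
  simp

lemma sum_coord (x : RootExt m a ha) :
    ∑ i : Fin m, root ^ (i : ℕ) * of (coord m a ha i x) = x := by
  conv_rhs => rw [← (basis m a ha).sum_repr x]
  refine Finset.sum_congr rfl fun i _ => ?_
  rw [mul_of, basis_apply]
  rfl

lemma linearMap_ext {N : Type*} [AddCommGroup N] [Module k N] {f g : RootExt m a ha →ₗ[k] N}
    (h : ∀ (i : Fin m) c, f (root ^ (i : ℕ) * of c) = g (root ^ (i : ℕ) * of c)) : f = g := by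
  ext x
  rw [← sum_coord x, map_sum, map_sum]
  exact Finset.sum_congr rfl fun i _ => h i _

/-- The linear map with prescribed values on multiples of the powers of the root. -/
def ofCoords {N : Type*} [AddCommGroup N] [Module k N] (f : Fin m → C →ₗ[k] N) :
    RootExt m a ha →ₗ[k] N := ∑ i, f i ∘ₗ coord m a ha i

lemma ofCoords_apply {N : Type*} [AddCommGroup N] [Module k N] (f : Fin m → C →ₗ[k] N)
    (i : Fin m) (c : C) : ofCoords (ha := ha) f (root ^ (i : ℕ) * of c) = f i c := by
  simp [ofCoords, coord_root_mul_of, apply_ite]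

end Basis

end RootExt

end RootExt

/-! ### Induced covariant bialgebras -/

section

open Coalgebra

variable {k C : Type*} [CommRing k] [CommRing C] [Bialgebra k C]

lemma isGroupLikeElem_of_mul_eq_one {a b : C} (ha : IsGroupLikeElem k a) (h : a * b = 1) :
    IsGroupLikeElem k b := by
  constructor
  · have := congrArg (counit (R := k)) h
    rwa [Bialgebra.counit_mul, ha.counit_eq_one, one_mul, Bialgebra.counit_one] at this
  · have h1 := congrArg (comul (R := k)) h
    rw [Bialgebra.comul_mul, ha.comul_eq_tmul_self, Bialgebra.comul_one] at h1
    calc comul (R := k) b = (b ⊗ₜ b * a ⊗ₜ a) * comul (R := k) b := by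
          rw [Algebra.TensorProduct.tmul_mul_tmul, mul_comm b a, h,
            ← Algebra.TensorProduct.one_def, one_mul]
      _ = b ⊗ₜ b := by rw [mul_assoc, h1, mul_one]

variable (k C) in
/-- The group of grouplike units. -/
def grouplikeUnits : Subgroup Cˣ where
  carrier := {a | IsGroupLikeElem k (a : C)}
  one_mem' := .one
  mul_mem' ha hb := ha.mul hb
  inv_mem' {a} ha := isGroupLikeElem_of_mul_eq_one ha a.mul_inv

lemma isGroupLikeElem_zpow {a : Cˣ} (ha : IsGroupLikeElem k (a : C)) (n : ℤ) :
    IsGroupLikeElem k ((a ^ n : Cˣ) : C) :=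
  (grouplikeUnits k C).zpow_mem ha n

/-- A functional whose cap product is surjective with kernel spanned by the unit is an
orientation. -/
def CapOrientation.ofExact (y : C →ₗ[k] k) (hs : Function.Surjective (cap y))
    (hk : ∀ c, cap y c = 0 → ∃ x : k, c = algebraMap k C x) (h1 : y 1 = 0) :
    CapOrientation k C :=
  have h1' (x : k) : cap y (algebraMap k C x) = 0 := by
    rw [Algebra.algebraMap_eq_smul_one, map_smul, cap_grouplike _ (a := (1 : C)) .one, h1,
      zero_smul, smul_zero]
  -- The cap product kills the scalars, so it restricts to a bijection on the kernel of the counit.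
  -- The inverse of that bijection is the normalized section.
  have hb : Function.Bijective (cap y ∘ₗ (LinearMap.ker (counit (R := k) (A := C))).subtype) := by
    constructor
    · rw [injective_iff_map_eq_zero]
      rintro ⟨c, hc⟩ h
      obtain ⟨x, rfl⟩ := hk c h
      rw [LinearMap.mem_ker, Bialgebra.counit_algebraMap] at hc
      subst hc
      exact Subtype.ext (map_zero _)
    · intro c
      obtain ⟨b, rfl⟩ := hs c
      refine ⟨⟨b - algebraMap k C (counit b), ?_⟩, ?_⟩
      · rw [LinearMap.mem_ker, map_sub, Bialgebra.counit_algebraMap, sub_self]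
      · change cap y (b - algebraMap k C (counit b)) = _
        rw [map_sub, h1', sub_zero]
  { y := y
    Z := (LinearMap.ker (counit (R := k) (A := C))).subtype ∘ₗ
      (LinearEquiv.ofBijective _ hb).symm.toLinearMap
    cap_Z := (LinearEquiv.ofBijective _ hb).apply_symm_apply
    Z_cap := fun c => by
      have h : c - algebraMap k C (counit c) ∈ LinearMap.ker (counit (R := k) (A := C)) := by
        rw [LinearMap.mem_ker, map_sub, Bialgebra.counit_algebraMap, sub_self]
      have h2 : cap y c = LinearEquiv.ofBijective _ hb ⟨_, h⟩ := by
        change _ = cap y (c - algebraMap k C (counit c))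
        rw [map_sub, h1', sub_zero]
      rw [h2]
      change ((((LinearEquiv.ofBijective _ hb).symm _ :
        LinearMap.ker (counit (R := k) (A := C)))) : C) = _
      rw [LinearEquiv.symm_apply_apply] }

variable {D : Type*} [CommGroup D] [IsCocomm k C]

/-- Filter by the kernels of products of operators. The cap product commutes with the operators and
acts on each successive layer, spanned by a g_V, through the unit h(g_V). Induction on a killing
list gives both injectivity and surjectivity. -/
lemma CovFGL.cap_bijective (M : CovFGL D k C) {h : C →ₗ[k] k} (hu : ∀ V, IsUnit (h (M.g V))) :
    Function.Bijective (cap h) := by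
  have hY : ∀ V c, M.Yop M.g V (cap h c) = cap h (M.Yop M.g V c) := fun V c => by
    rw [M.Yop_eq_cap M.grouplike, cap_comm]
  have hker : ∀ V c, M.Yop M.g V c = 0 → c = counit (R := k) c • M.g V := fun V c hc => by
    have := M.Zop_Yop M.grouplike V c
    rwa [hc, map_zero, eq_comm, sub_eq_zero] at this
  constructor
  · rw [injective_iff_map_eq_zero]
    intro c
    obtain ⟨s, hs⟩ := M.nil c
    induction s generalizing c with
    | nil => exact fun _ => hs
    | cons V s ih =>
      intro h0
      rw [CapOrientation.Yl_cons, M.Yop_Yl M.grouplike] at hs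
      have h1 := hker V c (ih _ hs (by rw [← hY, h0, map_zero]))
      have h2 := congrArg (counit (R := k)) h0
      rw [h1, map_smul, cap_grouplike _ (M.grouplike V), map_smul, map_smul,
        (M.grouplike V).counit_eq_one, map_zero, smul_eq_mul, smul_eq_mul, mul_one,
        IsUnit.mul_left_eq_zero (hu V)] at h2
      rw [h1, h2, zero_smul]
  · intro c
    obtain ⟨s, hs⟩ := M.nil c
    induction s generalizing c with
    | nil => exact ⟨0, by rw [map_zero]; exact hs.symm⟩
    | cons V s ih =>
      rw [CapOrientation.Yl_cons, M.Yop_Yl M.grouplike] at hs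
      obtain ⟨b, hb⟩ := ih _ hs
      have h1 := hker V (c - cap h (M.Zop M.g V b)) (by
        rw [map_sub, hY, M.Yop_Zop, hb, sub_self])
      obtain ⟨x, hx⟩ := hu V
      refine ⟨M.Zop M.g V b + (counit (R := k) (c - cap h (M.Zop M.g V b)) * ↑x⁻¹) • M.g V, ?_⟩
      rw [map_add, map_smul, cap_grouplike _ (M.grouplike V), smul_smul, ← hx, mul_assoc,
        Units.inv_mul, mul_one, ← h1]
      ring

end

/-! ### Characters of degree divisible by `m`. -/

section Multiples

variable {D : Type*} [CommGroup D] (φ : D →* Multiplicative ℤ) (m : ℕ)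

/-- The preimage of the multiples of `m`. -/
def multiples : Subgroup D where
  carrier := {V | (m : ℤ) ∣ (φ V).toAdd}
  one_mem' := by simp
  mul_mem' ha hb := by
    simp only [Set.mem_ofPred_eq, map_mul, toAdd_mul] at *
    exact dvd_add ha hb
  inv_mem' ha := by
    simp only [Set.mem_ofPred_eq, map_inv, toAdd_inv, dvd_neg] at *
    exact ha

lemma mem_multiples {V : D} : V ∈ multiples φ m ↔ (m : ℤ) ∣ (φ V).toAdd := Iff.rfl

variable {φ} {d : D} (hd : φ d = Multiplicative.ofAdd 1)

include hd in
lemma toAdd_map_zpow (n : ℤ) : (φ (d ^ n)).toAdd = n := by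
  rw [map_zpow, hd]; simp

/-- The complement of the section of `φ` given by `d`. -/
def projMultiples : D →* multiples φ m where
  toFun V := ⟨V * (d ^ (φ V).toAdd)⁻¹, by
    rw [mem_multiples, map_mul, map_inv, toAdd_mul, toAdd_inv, toAdd_map_zpow hd, add_neg_cancel]
    exact dvd_zero _⟩
  map_one' := by simp
  map_mul' V W := Subtype.ext (by
    simp only [map_mul, toAdd_mul, zpow_add, mul_inv, Subgroup.coe_mul]
    exact mul_mul_mul_comm _ _ _ _)

/-- The power of `d` in the subgroup of multiples. -/
def powMultiples : multiples φ m := ⟨d ^ m, by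
  rw [mem_multiples, ← zpow_natCast, toAdd_map_zpow hd]⟩

lemma projMultiples_mul (V : multiples φ m) :
    projMultiples m hd V * powMultiples m hd ^ ((φ V).toAdd / m) = V := by
  refine Subtype.ext ?_
  change (V : D) * (d ^ (φ V).toAdd)⁻¹ * ((powMultiples m hd ^ ((φ V).toAdd / (m : ℤ)) :
    multiples φ m) : D) = V
  rw [Subgroup.coe_zpow]
  change (V : D) * (d ^ (φ V).toAdd)⁻¹ * (d ^ m) ^ ((φ V).toAdd / (m : ℤ)) = V
  rw [← zpow_natCast, ← zpow_mul, Int.mul_ediv_cancel' V.2, inv_mul_cancel_right]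

lemma projMultiples_self : projMultiples m hd d = 1 := by
  refine Subtype.ext ?_
  change d * (d ^ (φ d).toAdd)⁻¹ = 1
  rw [hd]; simp

end Multiples

namespace CovFGL

open Coalgebra RootExt

variable {k : Type*} {C : Type u} {D : Type} [CommRing k] [CommRing C] [Bialgebra k C]
  [IsCocomm k C] [CommGroup D] {φ : D →* Multiplicative ℤ} {m : ℕ} {d : D}
  (hd : φ d = Multiplicative.ofAdd 1) (M : CovFGL (multiples φ m) k C)

/-- The underlying bialgebra of an induced covariant bialgebra. -/
abbrev IndAlg : Type u := RootExt m (M.g (powMultiples m hd)) (M.grouplike _)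

variable [NeZero m]

/-- The root as a unit. -/
def rootUnit : (IndAlg hd M)ˣ :=
  ((isUnit_pow_iff (NeZero.ne m)).mp (by
    rw [root_pow]
    exact (((Group.isUnit (powMultiples m hd)).map M.g).map of)) :
      IsUnit (root : IndAlg hd M)).unit

omit [IsCocomm k C] in
@[simp] lemma coe_rootUnit : ((rootUnit hd M : (IndAlg hd M)ˣ) : IndAlg hd M) = root := rfl

/-- The grouplike elements of an induced covariant bialgebra. -/
def indG : D →* IndAlg hd M :=
  ((of : C →ₐ[k] IndAlg hd M).toMonoidHom.comp (M.g.comp (projMultiples m hd))) *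
    (Units.coeHom _).comp ((zpowersHom _ (rootUnit hd M)).comp φ)

omit [IsCocomm k C] in
lemma indG_apply (V : D) : indG hd M V
    = of (M.g (projMultiples m hd V)) * ((rootUnit hd M ^ (φ V).toAdd : (IndAlg hd M)ˣ) : IndAlg hd M) := rfl

omit [IsCocomm k C] in
lemma isGroupLikeElem_indG (V : D) : IsGroupLikeElem k (indG hd M V) := by
  rw [indG_apply]
  exact (isGroupLikeElem_of (M.grouplike _)).mul
    (isGroupLikeElem_zpow (a := rootUnit hd M) isGroupLikeElem_root _)

omit [IsCocomm k C] in
lemma indG_self : indG hd M d = root := by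
  rw [indG_apply, projMultiples_self, hd]
  simp

-- A character of degree nm is V d^(−nm) times (d^m)^n, and the root has m-th power g(d^m). The
-- induced grouplike elements thus extend those given on the subgroup.
omit [IsCocomm k C] in
lemma indG_coe (V : multiples φ m) : indG hd M V = of (M.g V) := by
  have h1 : (rootUnit hd M) ^ (m : ℤ) = Units.map (of : C →ₐ[k] IndAlg hd M).toMonoidHom
      (M.g.toHomUnits (powMultiples m hd)) := Units.ext (by
    rw [zpow_natCast, Units.val_pow_eq_pow_val, coe_rootUnit, root_pow]
    rfl)
  obtain ⟨n, hn⟩ := V.2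
  have h2 := projMultiples_mul m hd V
  have hm : (m : ℤ) ≠ 0 := by exact_mod_cast NeZero.ne m
  rw [hn, Int.mul_ediv_cancel_left _ hm] at h2
  rw [indG_apply, hn, zpow_mul, h1]
  conv_rhs => rw [← h2]
  rw [map_mul M.g, map_mul of, ← map_zpow, ← map_zpow]
  rfl

variable [Nontrivial C] (h : ℕ → C →ₗ[k] k) (h0 : h 0 = M.y)
  (hu : ∀ i, 0 < i → i < m → ∀ V, IsUnit (h i (M.g V)))

/-- The orientation functional of an induced covariant bialgebra. -/
def indY : IndAlg hd M →ₗ[k] k := ofCoords fun i => h i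

omit [IsCocomm k C] in
lemma indY_apply (i : Fin m) (c : C) : indY hd M h (root ^ (i : ℕ) * of c) = h i c :=
  ofCoords_apply _ _ _

omit [IsCocomm k C] in
lemma cap_indY (i : Fin m) (c : C) :
    cap (indY hd M h) (root ^ (i : ℕ) * of c) = root ^ (i : ℕ) * of (cap (h i) c) := by
  rw [cap_root_mul_of]
  congr 4
  ext c
  exact indY_apply hd M h i c

omit [IsCocomm k C] in
lemma coord_cap_indY (i : Fin m) (x : IndAlg hd M) :
    coord m _ _ i (cap (indY hd M h) x) = cap (h i) (coord m _ _ i x) := by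
  have : coord m _ _ i ∘ₗ cap (indY hd M h) = cap (h i) ∘ₗ coord m _ _ i :=
    linearMap_ext fun j c => by
      simp only [LinearMap.comp_apply, cap_indY, coord_root_mul_of]
      split_ifs with hij
      · rw [hij]
      · rw [map_zero]
  exact LinearMap.congr_fun this x

include h0 in
omit [IsCocomm k C] in
lemma indY_of (c : C) : indY hd M h (of c) = M.y c := by
  have := indY_apply hd M h 0 c
  rwa [Fin.coe_ofNat_eq_mod, Nat.zero_mod, pow_zero, one_mul, h0] at this

include h0 in
omit [IsCocomm k C] in
lemma cap_indY_of (c : C) : cap (indY hd M h) (of c) = of (cap M.y c) := by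
  have := cap_indY hd M h 0 c
  rwa [Fin.coe_ofNat_eq_mod, Nat.zero_mod, pow_zero, one_mul, one_mul, h0] at this

/-- The orientation of an induced covariant bialgebra. -/
def indOrientation : CapOrientation k (IndAlg hd M) :=
  CapOrientation.ofExact (indY hd M h)
    (by
      rw [← LinearMap.range_eq_top, eq_top_iff]
      rintro x -
      rw [← sum_coord x]
      refine sum_mem fun i _ => ?_
      -- On the summand of exponent 0 the old section applies. On the others the cap product is
      -- bijective, as the functional takes unit values on grouplike elements.
      rcases Nat.eq_zero_or_pos (i : ℕ) with hi | hi
      · rw [hi, pow_zero, one_mul]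
        exact ⟨of (M.Z (coord m _ _ i x)), by rw [cap_indY_of _ _ _ h0, M.cap_Z]⟩
      · obtain ⟨c, hc⟩ := (M.cap_bijective (hu i hi i.2)).2 (coord m _ _ i x)
        exact ⟨root ^ (i : ℕ) * of c, by rw [cap_indY, hc]⟩)
    (fun x hx => by
      have h1 : ∀ i : Fin m, cap (h i) (coord m _ _ i x) = 0 := fun i => by
        rw [← coord_cap_indY, hx, map_zero]
      refine ⟨counit (coord m _ _ 0 x), ?_⟩
      -- By bijectivity on the other summands, only exponent 0 contributes to the kernel.
      have h4 : x = of (coord m _ _ 0 x) := by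
        conv_lhs => rw [← sum_coord x]
        rw [Finset.sum_eq_single 0]
        · rw [Fin.coe_ofNat_eq_mod, Nat.zero_mod, pow_zero, one_mul]
        · intro i _ hi
          have hi' : 0 < (i : ℕ) := Nat.pos_of_ne_zero fun h => hi (Fin.ext h)
          rw [(M.cap_bijective (hu i hi' i.2)).1 ((h1 i).trans (map_zero _).symm), map_zero,
            mul_zero]
        · simp
      have h2 := M.Z_cap (coord m _ _ 0 x)
      have h3 := h1 0
      rw [Fin.coe_ofNat_eq_mod, Nat.zero_mod, h0] at h3
      rw [h3, map_zero, eq_comm, sub_eq_zero] at h2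
      rw [← of.commutes, ← h2]
      exact h4)
    (by rw [← map_one of, indY_of _ _ _ h0, M.y_one])

omit [Nontrivial C] [IsCocomm k C] in
lemma Yl_map_coe (O : CapOrientation k (IndAlg hd M)) (hO : ∀ c, cap O.y (of c) = of (cap M.y c))
    (s : List (multiples φ m)) (c : C) :
    O.Yl (indG hd M) (s.map (↑)) (of c) = of (M.Yl M.g s c) := by
  induction s with
  | nil => rfl
  | cons V s ih =>
    rw [List.map_cons, CapOrientation.Yl_cons, CapOrientation.Yl_cons, ih,
      CapOrientation.Yop_apply, CapOrientation.Yop_apply, ← Subgroup.coe_inv, indG_coe, indG_coe,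
      ← map_mul of, hO, ← map_mul of]

-- The nilpotent part is a subalgebra that contains the image of `C` and the root, the latter being
-- the grouplike element of `d`. These generate.
omit [Nontrivial C] in
lemma mem_nilPart (O : CapOrientation k (IndAlg hd M))
    (hO : ∀ c, cap O.y (of c) = of (cap M.y c)) (x : IndAlg hd M) :
    x ∈ O.NilPart (indG hd M) (isGroupLikeElem_indG hd M) := by
  induction x using RootExt.induction with
  | hof c =>
    obtain ⟨s, hs⟩ := M.nil c
    exact ⟨s.map (↑), by rw [Yl_map_coe hd M _ hO, hs, map_zero]⟩
  | hroot =>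
    have := CapOrientation.NilPart.α_mem (O := O) (α := indG hd M)
      (hα := isGroupLikeElem_indG hd M) d
    rwa [indG_self hd M] at this
  | hadd x y hx hy => exact add_mem hx hy
  | hmul x y hx hy => exact mul_mem hx hy

lemma indOrientation_y : (indOrientation hd M h h0 hu).y = indY hd M h := rfl

/-- The induced covariant bialgebra. -/
def ind : CovFGL D k (IndAlg hd M) where
  toCapOrientation := indOrientation hd M h h0 hu
  g := indG hd M
  grouplike := isGroupLikeElem_indG hd M
  nil x := mem_nilPart hd M (indOrientation hd M h h0 hu)
    (fun c => by rw [indOrientation_y, cap_indY_of hd M h h0]) x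

end CovFGL

/-! ### Splitting off a character of finite degree -/

namespace CovFGL

open Coalgebra

section BaseChangeEval

variable {k C k' D : Type*} [CommRing k] [CommRing C] [Bialgebra k C] [CommRing k'] [Algebra k k']
  [CommGroup D] [IsCocomm k C] (M : CovFGL D k C) (p : k' →ₐ[k] k)

/-- The evaluation of a base change along a retraction. -/
def baseChangeEval : k' ⊗[k] C →ₐ[k] C :=
  Algebra.TensorProduct.productMap ((Algebra.ofId k C).comp p) (AlgHom.id k C)

omit [IsCocomm k C] in
@[simp] lemma baseChangeEval_tmul (a : k') (c : C) : baseChangeEval (C := C) p (a ⊗ₜ c) = p a • c := by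
  rw [baseChangeEval, Algebra.TensorProduct.productMap_apply_tmul, Algebra.smul_def]
  rfl

lemma isHom_baseChangeEval : (M.baseChange k').IsHom M p.toRingHom
    (baseChangeEval (C := C) p).toRingHom where
  map_algebraMap x := by
    change baseChangeEval p (algebraMap k' (k' ⊗[k] C) x) = algebraMap k C (p x)
    rw [Algebra.TensorProduct.algebraMap_apply, baseChangeEval_tmul, Algebra.algebraMap_self,
      RingHom.id_apply, Algebra.algebraMap_eq_smul_one]
  map_counit c := by
    change counit (baseChangeEval p c) = p (counit c)
    induction c using TensorProduct.induction_on with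
    | zero => simp
    | add x y hx hy => simp only [map_add, hx, hy]
    | tmul a c => simp [mul_comm]
  map_g V := by
    change baseChangeEval p ((1 : k') ⊗ₜ[k] M.g V) = _
    simp
  map_cap c := by
    change _ = baseChangeEval p (cap (baseChangeFunctional k' M.y) c)
    change cap M.y (baseChangeEval p c) = _
    rw [cap_baseChangeFunctional]
    induction c using TensorProduct.induction_on with
    | zero => simp
    | add x y hx hy => simp only [map_add, hx, hy]
    | tmul a c => simp

omit [IsCocomm k C] in
lemma one_tmul_g (V : D) : (1 : k') ⊗ₜ[k] M.g V
    = 1 + algebraMap k k' (M.y (M.g V)) ⊗ₜ M.Z (M.g V) := by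
  conv_lhs => rw [M.g_eq_one_add]
  rw [TensorProduct.tmul_add, ← TensorProduct.smul_tmul, Algebra.algebraMap_eq_smul_one]
  rfl

end BaseChangeEval

variable {k C : Type u} {D : Type} [CommRing k] [CommRing C] [Bialgebra k C] [IsCocomm k C]
  [CommGroup D] (M : CovFGL D k C) (W : D)

/-- The ring obtained from the ground ring by adjoining an idempotent multiple of an Euler
class. -/
abbrev SplitRing : Type u := QuadraticAlgebra k 0 (M.y (M.g W))

/-- The two retractions of the split ring. -/
def splitEval (x : k) (hx : x * x = M.y (M.g W) * x) : SplitRing M W →ₐ[k] k :=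
  QuadraticAlgebra.lift ⟨x, by simpa using hx⟩

omit [IsCocomm k C] in
lemma splitEval_apply (x : k) (hx : x * x = M.y (M.g W) * x) (a : SplitRing M W) :
    splitEval M W x hx a = a.re + a.im * x := by
  simp [splitEval, QuadraticAlgebra.lift]

-- The norm of a + bω is a(a + e_W b), the product of the values at ω = 0 and at ω = e_W.
omit [IsCocomm k C] in
lemma isUnit_of_splitEval {a : SplitRing M W} (h0 : IsUnit (splitEval M W 0 (by simp) a))
    (h1 : IsUnit (splitEval M W (M.y (M.g W)) rfl a)) : IsUnit a := by
  rw [splitEval_apply] at h0 h1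
  rw [QuadraticAlgebra.isUnit_iff_norm_isUnit, QuadraticAlgebra.norm_def]
  have := h0.mul h1
  convert this using 1
  ring

/-- The base change to the split ring. -/
abbrev splitModel : CovFGL D (SplitRing M W) (SplitRing M W ⊗[k] C) := M.baseChange (SplitRing M W)

/-- The adjoined element of the split ring. -/
abbrev splitOmega : SplitRing M W := QuadraticAlgebra.omega

omit [IsCocomm k C] in
lemma splitOmega_mul_self : splitOmega M W * splitOmega M W
    = algebraMap k _ (M.y (M.g W)) * splitOmega M W := by
  rw [QuadraticAlgebra.omega_mul_omega_eq_add, zero_smul, zero_add, Algebra.smul_def]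

/-- The grouplike unit interpolating between `1` and `g W`. -/
def splitZ : SplitRing M W ⊗[k] C := 1 + splitOmega M W ⊗ₜ M.Z (M.g W)

lemma splitModel_g (V : D) : (splitModel M W).g V = (1 : SplitRing M W) ⊗ₜ M.g V := rfl

/-- From ω² = e_W ω one gets (z − 1)² = (g_W − 1)(z − 1). This says that z and 1 + g_W − z have
product g_W, and so it makes z invertible. -/
lemma splitZ_mul : splitZ M W * (1 + (splitModel M W).g W - splitZ M W) = (splitModel M W).g W := by
  have h1 : (splitModel M W).g W = 1 + (algebraMap k (SplitRing M W) (M.y (M.g W))) ⊗ₜ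
      M.Z (M.g W) := by
    rw [splitModel_g, one_tmul_g]
  have h2 : (splitOmega M W ⊗ₜ[k] M.Z (M.g W)) * (splitOmega M W ⊗ₜ[k] M.Z (M.g W))
      = (algebraMap k (SplitRing M W) (M.y (M.g W))) ⊗ₜ M.Z (M.g W) *
        (splitOmega M W ⊗ₜ[k] M.Z (M.g W)) := by
    rw [Algebra.TensorProduct.tmul_mul_tmul, Algebra.TensorProduct.tmul_mul_tmul,
      splitOmega_mul_self]
  rw [splitZ, h1]
  linear_combination -h2

/-- The interpolating grouplike unit. -/
def splitUnit : (SplitRing M W ⊗[k] C)ˣ where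
  val := splitZ M W
  inv := (1 + (splitModel M W).g W - splitZ M W) * (splitModel M W).g W⁻¹
  val_inv := by
    rw [← mul_assoc, splitZ_mul, ← map_mul, mul_inv_cancel, map_one]
  inv_val := by
    rw [mul_comm, ← mul_assoc, splitZ_mul, ← map_mul, mul_inv_cancel, map_one]

omit [IsCocomm k C] in
lemma comul_Z_g : comul (R := k) (M.Z (M.g W))
    = 1 ⊗ₜ M.Z (M.g W) + M.Z (M.g W) ⊗ₜ M.g W := by
  rw [M.comul_eq_add M.grouplike 1, CapOrientation.Yop_one, M.cap_Z,
    (M.grouplike W).comul_eq_tmul_self, map_one M.g]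
  simp [CapOrientation.Zop_apply]

/-- With b = Z(g_W), Δb = 1 ⊗ b + b ⊗ g_W and g_W = 1 + e_W b. The mixed term of Δz is e_W ω b ⊗ b
and that of z ⊗ z is ω² b ⊗ b; the relation on ω makes them equal. -/
lemma isGroupLikeElem_splitZ : IsGroupLikeElem (SplitRing M W) (splitZ M W) := by
  have hb : splitOmega M W ⊗ₜ[k] M.Z (M.g W)
      = splitOmega M W • ((1 : SplitRing M W) ⊗ₜ[k] M.Z (M.g W)) := by
    simp [TensorProduct.smul_tmul']
  constructor
  · rw [splitZ, map_add, Bialgebra.counit_one, TensorProduct.counit_tmul]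
    have : counit (R := k) (M.Z (M.g W)) = 0 := by
      have := M.ops.ε_Z 1 (M.g W)
      simpa [CapOrientation.Zop_apply] using this
    rw [this]; simp
  · rw [splitZ, hb, map_add, map_smul, Bialgebra.comul_one, comul_one_tmul, comul_Z_g, map_add,
      tensorSquare_tmul, tensorSquare_tmul]
    change 1 + splitOmega M W • ((1 : SplitRing M W ⊗[k] C) ⊗ₜ[SplitRing M W]
      ((1 : SplitRing M W) ⊗ₜ[k] M.Z (M.g W)) +
      ((1 : SplitRing M W) ⊗ₜ[k] M.Z (M.g W)) ⊗ₜ[SplitRing M W] ((splitModel M W).g W)) = _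
    have h1 : (splitModel M W).g W = 1 + algebraMap k (SplitRing M W) (M.y (M.g W)) •
        ((1 : SplitRing M W) ⊗ₜ M.Z (M.g W)) := by
      rw [splitModel_g, one_tmul_g, TensorProduct.smul_tmul', smul_eq_mul, mul_one]
    rw [h1]
    simp only [TensorProduct.add_tmul, TensorProduct.tmul_add, TensorProduct.tmul_smul,
      ← TensorProduct.smul_tmul', smul_add, smul_smul, Algebra.TensorProduct.one_def,
      splitOmega_mul_self, mul_comm (splitOmega M W)]
    abel

variable {φ : D →* Multiplicative ℤ} {m : ℕ} [NeZero m]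

variable (φ m) in
/-- The quotient by `m` on the preimage of its multiples. -/
def quoMultiples : multiples φ m →* Multiplicative ℤ where
  toFun V := Multiplicative.ofAdd ((φ V).toAdd / m)
  map_one' := by simp
  map_mul' V V' := by
    rw [← ofAdd_add, ← Int.add_ediv_of_dvd_left V.2]
    simp

variable (φ m) in
/-- The twisted grouplike elements. -/
def splitG : multiples φ m →* SplitRing M W ⊗[k] C :=
  ((splitModel M W).g.comp (multiples φ m).subtype) *
    -- A character V is divided by the power of z with exponent φ(V)/m. If W has degree m it goes to
    -- g_W/z, which is g_W at ω = 0 and 1 at ω = e_W.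
    (Units.coeHom _).comp ((zpowersHom _ (splitUnit M W)⁻¹).comp (quoMultiples φ m))

omit [NeZero m] in
lemma splitG_apply (V : multiples φ m) : splitG M W φ m V = (splitModel M W).g V *
    (((splitUnit M W)⁻¹ ^ ((φ V).toAdd / (m : ℤ)) : (SplitRing M W ⊗[k] C)ˣ) :
      SplitRing M W ⊗[k] C) := rfl

omit [NeZero m] in
lemma isGroupLikeElem_splitG (V : multiples φ m) :
    IsGroupLikeElem (SplitRing M W) (splitG M W φ m V) := by
  rw [splitG_apply]
  refine ((splitModel M W).grouplike V).mul (isGroupLikeElem_zpow (a := (splitUnit M W)⁻¹) ?_ _)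
  exact (grouplikeUnits _ _).inv_mem (x := splitUnit M W) (isGroupLikeElem_splitZ M W)

omit [IsCocomm k C] in
lemma baseChangeEval_splitZ (x : k) (hx : x * x = M.y (M.g W) * x) :
    baseChangeEval (splitEval M W x hx) (splitZ M W) = 1 + x • M.Z (M.g W) := by
  rw [splitZ, map_add, map_one, baseChangeEval_tmul, splitEval_apply]
  simp

lemma baseChangeEval_g (p : SplitRing M W →ₐ[k] k) (V : D) :
    baseChangeEval p ((splitModel M W).g V) = M.g V := by
  rw [splitModel_g, baseChangeEval_tmul, map_one, one_smul]

-- Used with x = 0 and U = 1, and with x = e_W and U = W. At either specialization the twisted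
-- characters are ordinary ones again.
omit [NeZero m] in
lemma baseChangeEval_splitG (x : k) (hx : x * x = M.y (M.g W) * x) (U : D)
    (hU : 1 + x • M.Z (M.g W) = M.g U) (V : multiples φ m) :
    baseChangeEval (splitEval M W x hx) (splitG M W φ m V)
      = M.g (V * U⁻¹ ^ ((φ V).toAdd / (m : ℤ))) := by
  have h1 : Units.map (baseChangeEval (C := C) (splitEval M W x hx)).toMonoidHom (splitUnit M W)
      = M.g.toHomUnits U := Units.ext ((baseChangeEval_splitZ M W x hx).trans hU)
  rw [splitG_apply, map_mul, baseChangeEval_g, map_mul M.g]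
  congr 1
  change ((Units.map (baseChangeEval (C := C) (splitEval M W x hx)).toMonoidHom
    ((splitUnit M W)⁻¹ ^ ((φ V).toAdd / (m : ℤ))) : Cˣ) : C) = _
  rw [map_zpow, map_inv, h1, ← map_inv, ← map_zpow]
  rfl

/-- The twisted nilpotent part. -/
abbrev splitNil : CovFGL (multiples φ m) (SplitRing M W)
    ((splitModel M W).NilPart (splitG M W φ m) (isGroupLikeElem_splitG M W)) :=
  CapOrientation.NilPart.model (splitModel M W).toCapOrientation (splitG M W φ m)
    (isGroupLikeElem_splitG M W)

variable (φ m) in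
/-- The functionals defining the orientation of the induced model. -/
def splitFun (d : D) (i : ℕ) :
    (splitModel M W).NilPart (splitG M W φ m) (isGroupLikeElem_splitG M W) →ₗ[SplitRing M W]
      SplitRing M W :=
  ((splitModel M W).y ∘ₗ LinearMap.mulLeft _ ((splitModel M W).g (d ^ i))) ∘ₗ
    ((splitModel M W).NilPart (splitG M W φ m) (isGroupLikeElem_splitG M W)).val.toLinearMap

omit [NeZero m] in
lemma splitFun_zero (d : D) : splitFun M W φ m d 0 = (splitNil M W (φ := φ) (m := m)).y := by
  refine LinearMap.ext fun c => ?_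
  change (splitModel M W).y ((splitModel M W).g (d ^ 0) * c) = (splitModel M W).y c
  rw [pow_zero, map_one, one_mul]

variable {d : D} (hd : φ d = Multiplicative.ofAdd 1)
  (hu : ∀ V, V ∉ multiples φ m → IsUnit (M.y (M.g V)))

-- A unit of the split ring is detected at ω = 0 and ω = e_W. There the value is an Euler class of
-- degree congruent to i modulo m, hence not divisible by m, and such classes are invertible by
-- assumption.
include hd hu in
omit [NeZero m] in
lemma isUnit_splitFun (hW : W ∈ multiples φ m) (i : ℕ) (hi : 0 < i) (him : i < m)
    (V : multiples φ m) :
    IsUnit (splitFun M W φ m d i ((splitNil M W (φ := φ) (m := m)).g V)) := by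
  have key : ∀ U ∈ multiples φ m, ∀ n : ℤ, IsUnit (M.y (M.g (d ^ i) * M.g (V * U⁻¹ ^ n))) := by
    intro U hU n
    rw [← map_mul M.g]
    refine hu _ fun h => ?_
    rw [Subgroup.mul_mem_cancel_right _ (mul_mem V.2 (zpow_mem (inv_mem hU) _)), mem_multiples,
      ← zpow_natCast, toAdd_map_zpow hd] at h
    have := Int.le_of_dvd (by exact_mod_cast hi) h
    omega
  change IsUnit ((splitModel M W).y ((splitModel M W).g (d ^ i) * splitG M W φ m V))
  have hy : ∀ (p : SplitRing M W →ₐ[k] k) c, p ((splitModel M W).y c)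
      = M.y (baseChangeEval p c) := fun p c => ((M.isHom_baseChangeEval p).map_y c).symm
  refine isUnit_of_splitEval M W ?_ ?_
  · rw [hy, map_mul, baseChangeEval_g, baseChangeEval_splitG M W _ _ 1 (by simp)]
    exact key 1 (one_mem _) _
  · rw [hy, map_mul, baseChangeEval_g, baseChangeEval_splitG M W _ _ W (M.g_eq_one_add W).symm]
    exact key W hW _

end CovFGL

/-! ### Regularity of Euler classes -/

namespace CovFGL

open Coalgebra

variable {k C : Type u} {D : Type} [CommRing k] [CommRing C] [Bialgebra k C] [IsCocomm k C]
  [CommGroup D] (M : CovFGL D k C) (W : D) {φ : D →* Multiplicative ℤ} {m : ℕ} [NeZero m]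
  {d : D} (hd : φ d = Multiplicative.ofAdd 1)
  (hu : ∀ V, V ∉ multiples φ m → IsUnit (M.y (M.g V)))

lemma cap_baseChangeEval {k' : Type*} [CommRing k'] [Algebra k k'] (p : k' →ₐ[k] k)
    (c : k' ⊗[k] C) : cap M.y (baseChangeEval p c)
      = baseChangeEval p (cap (M.baseChange k').y c) :=
  (M.isHom_baseChangeEval p).map_cap c

-- Under a specialization the root goes to g_d. This is the compatibility with orientations, summand
-- by summand, that `exists_isHom_ind` asks for.
omit [NeZero m] in
lemma cap_splitFun (p : SplitRing M W →ₐ[k] k) (i : ℕ)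
    (c : (splitModel M W).NilPart (splitG M W φ m) (isGroupLikeElem_splitG M W)) :
    cap M.y (M.g d ^ i * baseChangeEval p (c : SplitRing M W ⊗[k] C))
      = M.g d ^ i * baseChangeEval p
        ((cap (splitFun M W φ m d i) c : CapOrientation.NilPart _ _ _) : SplitRing M W ⊗[k] C) := by
  rw [splitFun, CapOrientation.NilPart.coe_cap, ← map_pow, ← baseChangeEval_g M W p,
    ← map_mul (baseChangeEval (C := C) p), ← map_mul (baseChangeEval (C := C) p),
    ← cap_grouplike_mul _ ((splitModel M W).grouplike _), cap_baseChangeEval]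

section IndLift

variable {k' C' : Type u} [CommRing k'] [CommRing C'] [Bialgebra k' C'] [IsCocomm k' C']
  [Nontrivial C'] (N : CovFGL (multiples φ m) k' C') (h : ℕ → C' →ₗ[k'] k') (h0 : h 0 = N.y)
  (hh : ∀ i, 0 < i → i < m → ∀ V, IsUnit (h i (N.g V)))
  (p : k' →+* k) (Φ : C' →+* C)

omit [IsCocomm k C] in
/-- The universal property of an induced covariant bialgebra. -/
lemma exists_isHom_ind (h1 : ∀ x, Φ (algebraMap k' C' x) = algebraMap k C (p x))
    (h2 : ∀ c, counit (R := k) (Φ c) = p (counit c)) (h3 : ∀ V, Φ (N.g V) = M.g V)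
    (h4 : ∀ i < m, ∀ c, cap M.y (M.g d ^ i * Φ c) = M.g d ^ i * Φ (cap (h i) c)) :
    ∃ Ψ, (ind hd N h h0 hh).IsHom M p Ψ := by
  have hr : M.g d ^ m = Φ (N.g (powMultiples m hd)) := by
    rw [h3, ← map_pow]
    rfl
  refine ⟨RootExt.lift Φ (M.g d) hr, ⟨fun x => ?_, fun c => ?_, fun V => ?_, fun c => ?_⟩⟩
  · rw [← RootExt.of.commutes, RootExt.lift_of, h1]
  · induction c using RootExt.induction with
    | hof c => rw [RootExt.lift_of, RootExt.counit_of, h2]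
    | hroot =>
      rw [RootExt.lift_root, (M.grouplike d).counit_eq_one,
        RootExt.isGroupLikeElem_root.counit_eq_one, map_one]
    | hadd x y hx hy => simp only [map_add, hx, hy]
    | hmul x y hx hy => rw [map_mul, Bialgebra.counit_mul, Bialgebra.counit_mul, map_mul, hx, hy]
  · have h5 : Units.map (RootExt.lift Φ (M.g d) hr).toMonoidHom (rootUnit hd N)
        = M.g.toHomUnits d := Units.ext (RootExt.lift_root Φ (M.g d) hr)
    change RootExt.lift Φ (M.g d) hr (indG hd N V) = _
    rw [indG_apply, map_mul, RootExt.lift_of, h3]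
    change _ * ((Units.map (RootExt.lift Φ (M.g d) hr).toMonoidHom (rootUnit hd N ^ _) : Cˣ) : C) = _
    rw [map_zpow, h5, ← map_zpow]
    change M.g (V * (d ^ (φ V).toAdd)⁻¹) * M.g _ = _
    rw [← map_mul, inv_mul_cancel_right]
  · change _ = RootExt.lift Φ (M.g d) hr (cap (indY hd N h) c)
    rw [← RootExt.sum_coord c]
    simp only [map_sum]
    refine Finset.sum_congr rfl fun i _ => ?_
    rw [cap_indY, map_mul (RootExt.lift Φ (M.g d) hr), map_mul (RootExt.lift Φ (M.g d) hr),
      map_pow, RootExt.lift_root, RootExt.lift_of, RootExt.lift_of, h4 i i.2]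

lemma evL_ind (h1 : ∀ x, Φ (algebraMap k' C' x) = algebraMap k C (p x))
    (h2 : ∀ c, counit (R := k) (Φ c) = p (counit c)) (h3 : ∀ V, Φ (N.g V) = M.g V)
    (h4 : ∀ i < m, ∀ c, cap M.y (M.g d ^ i * Φ c) = M.g d ^ i * Φ (cap (h i) c))
    (x : UnivC.L.{u} D) : p (UnivC.evL (ind hd N h h0 hh) x) = UnivC.evL M x := by
  obtain ⟨Ψ, hΨ⟩ := exists_isHom_ind M hd N h h0 hh p Φ h1 h2 h3 h4
  exact UnivC.map_evL hΨ x

end IndLift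

instance [Nontrivial k] : Nontrivial
    ((splitModel M W).NilPart (splitG M W φ m) (isGroupLikeElem_splitG M W)) :=
  (Bialgebra.counitAlgHom (SplitRing M W) _).toRingHom.domain_nontrivial

include hd hu in
/-- The deformation of the classifying map along the split ring. -/
lemma exists_split (hW : (φ W).toAdd = m) : ∃ f : UnivC.L.{u} D →+* SplitRing M W,
    f (UnivC.euler W) = algebraMap k _ (M.y (M.g W)) - splitOmega M W ∧
      ∀ x, (f x).re = UnivC.evL M x := by
  -- The basis of powers of the root is only set up over a nontrivial ring; over the zero ring there
  -- is nothing to prove.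
  rcases subsingleton_or_nontrivial k with hk | hk
  · exact ⟨(algebraMap k _).comp (UnivC.evL M), Subsingleton.elim _ _,
      fun x => Subsingleton.elim _ _⟩
  have hWm : W ∈ multiples φ m := by rw [mem_multiples, hW]
  set N := splitNil M W (φ := φ) (m := m)
  have hh := isUnit_splitFun M W hd hu hWm
  set M₂ := ind hd N (splitFun M W φ m d) (splitFun_zero M W d) hh
  refine ⟨UnivC.evL M₂, ?_, fun x => ?_⟩
  · rw [UnivC.evL_euler]
    change indY hd N _ (indG hd N W) = _
    have h1 : indG hd N W = RootExt.of (N.g ⟨W, hWm⟩) := indG_coe hd N ⟨W, hWm⟩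
    rw [h1, indY_of _ _ _ (splitFun_zero M W d)]
    change (splitModel M W).y (splitG M W φ m ⟨W, hWm⟩) = _
    -- The explicit inverse of z gives g_W/z = 1 + g_W − z.
    have h2 : splitG M W φ m ⟨W, hWm⟩ = (1 : SplitRing M W) ⊗ₜ M.g W
        - splitOmega M W ⊗ₜ M.Z (M.g W) := by
      rw [splitG_apply, hW, Int.ediv_self (by exact_mod_cast NeZero.ne m), zpow_one]
      change (splitModel M W).g W * ((1 + (splitModel M W).g W - splitZ M W) *
        (splitModel M W).g W⁻¹) = _
      rw [mul_comm, mul_assoc, ← map_mul, inv_mul_cancel, map_one, mul_one, splitZ, splitModel_g]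
      ring
    -- Since y(Z c) is the counit of c, the functional y takes the value 1 on Z(g_W), which yields
    -- exactly e_W − ω.
    rw [h2, map_sub]
    change baseChangeFunctional _ M.y _ - baseChangeFunctional _ M.y _ = _
    rw [baseChangeFunctional_tmul, baseChangeFunctional_tmul, M.y_Z,
      (M.grouplike W).counit_eq_one, one_smul, Algebra.algebraMap_eq_smul_one]
  -- At ω = 0 the twist disappears, so the induced model maps to `M`. By naturality of classifying
  -- maps, the real part of `f` is the original classifying map.
  · have h0 := M.isHom_baseChangeEval (splitEval M W 0 (by simp))
    have h3 := evL_ind M hd N (splitFun M W φ m d) (splitFun_zero M W d) hh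
      (splitEval M W 0 (by simp)).toRingHom
      ((baseChangeEval (C := C) (splitEval M W 0 (by simp))).toRingHom.comp
        ((splitModel M W).NilPart (splitG M W φ m) (isGroupLikeElem_splitG M W)).val.toRingHom)
      (fun x => h0.map_algebraMap x) (fun c => h0.map_counit c)
      (fun V => by
        change baseChangeEval (splitEval M W 0 (by simp)) (splitG M W φ m V) = _
        rw [baseChangeEval_splitG M W _ _ 1 (by simp)]
        simp)
      (fun i _ c => cap_splitFun M W _ i c) x
    have h4 : ∀ a : SplitRing M W, a.re = (splitEval M W 0 (by simp)).toRingHom a := fun a => by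
      change _ = splitEval M W 0 (by simp) a
      rw [splitEval_apply, mul_zero, add_zero]
    exact (h4 _).trans h3

end CovFGL

/-! ### The induction on the degree. -/

namespace UnivC

open Coalgebra

variable {D : Type} [CommGroup D]

/-- Multiply g_W = 1 + e_W Z(g_W) by g_V and apply y. -/
lemma euler_mul (V W : D) : ∃ x, euler.{u} (V * W) = euler V + x * euler W := by
  refine ⟨(univ D).y (g V * (univ D).Z ((univ D).g W)), ?_⟩
  have h := (univ.{u} D).g_eq_one_add W
  generalize (univ D).Z ((univ D).g W) = c at h
  change (g W : UnivC.{u} D) = 1 + euler W • c at h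
  rw [euler, map_mul g, h, mul_add, mul_one, map_add, mul_smul_comm, map_smul, smul_eq_mul,
    mul_comm (euler W)]
  rfl

/-- On elements annihilated by e_W, multiplying a character by W does not change its Euler class.
This lets degrees be reduced modulo the degree of W. -/
lemma euler_mul_zpow {W : D} {x : L.{u} D} (hx : x * euler W = 0) (V : D) (n : ℤ) :
    x * euler (V * W ^ n) = x * euler V := by
  have h1 : ∀ U, x * euler (U * W) = x * euler U := fun U => by
    obtain ⟨a, ha⟩ := euler_mul.{u} U W
    rw [ha]; linear_combination a * hx
  induction n with
  | zero => simp
  | succ n ih => rw [zpow_add_one, ← mul_assoc, h1, ih]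
  | pred n ih => rw [← ih, ← h1 (V * W ^ (-(n : ℤ) - 1)), mul_assoc, ← zpow_add_one, sub_add_cancel]

/-- Characters of positive degree have regular Euler classes. -/
theorem eq_zero_of_mul_euler {φ : D →* Multiplicative ℤ} {d : D}
    (hd : φ d = Multiplicative.ofAdd 1) (m : ℕ) (hm : 0 < m) (W : D) (hW : (φ W).toAdd = m)
    (x : L.{u} D) (hx : x * euler W = 0) : x = 0 := by
  induction m using Nat.strong_induction_on generalizing W x with
  | _ m ih =>
  have : NeZero m := ⟨hm.ne'⟩
  -- These are the Euler classes that must be invertible for the induced orientation to exist.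
  set S : Submonoid (L.{u} D) := Submonoid.closure (euler '' {V | V ∉ multiples φ m})
  set k := Localization S
  set M := (univ.{u} D).baseChange k
  have hM : ∀ V, M.y (M.g V) = algebraMap (L.{u} D) k (euler V) := fun V => by
    have h := (univ.{u} D).isHom_baseChange k
    rw [← h.map_g, h.map_y]
    rfl
  obtain ⟨f, hf1, hf2⟩ := M.exists_split W hd (fun V hV => by
    rw [hM]
    exact IsLocalization.map_units k (⟨_, Submonoid.subset_closure ⟨V, hV, rfl⟩⟩ : S)) hW
  have hk : algebraMap (L.{u} D) k x = 0 := by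
    -- Writing f(x) = a + bω, the ω-coefficient of (a + bω)(e_W − ω) is −a, because the two terms in
    -- e_W b cancel. Here a is the image of x in the localization.
    have h1 := congrArg f hx
    rw [map_mul, hf1, map_zero] at h1
    have h3 := congrArg QuadraticAlgebra.im h1
    have h4 := hf2 x
    rw [← map_evL ((univ.{u} D).isHom_baseChange k), evL_univ] at h4
    rw [← h4]
    simp only [QuadraticAlgebra.im_mul, QuadraticAlgebra.re_sub, QuadraticAlgebra.im_sub,
      QuadraticAlgebra.algebraMap_re, QuadraticAlgebra.algebraMap_im, QuadraticAlgebra.omega_re,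
      QuadraticAlgebra.omega_im, QuadraticAlgebra.im_zero] at h3
    linear_combination -h3
  -- It remains to cancel a product of inverted Euler classes, one factor at a time, keeping the
  -- relation with e_W.
  obtain ⟨⟨s, hs⟩, hsx⟩ := (IsLocalization.map_eq_zero_iff S k x).mp hk
  change s * x = 0 at hsx
  clear hk
  induction hs using Submonoid.closure_induction generalizing x with
  | one => simpa using hsx
  | mul a b _ _ ha hb =>
    exact hb x hx (ha (b * x) (by rw [mul_assoc, hx, mul_zero]) (by rw [← mul_assoc, hsx]))
  | mem a ha =>
    obtain ⟨V, hV, rfl⟩ := ha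
    -- Shifting V by a power of W replaces its degree by the remainder modulo m. This remainder is
    -- nonzero because m does not divide φ(V), so the induction hypothesis applies.
    rw [mul_comm, ← euler_mul_zpow hx V (-((φ V).toAdd / m))] at hsx
    have h0 : (m : ℤ) ≠ 0 := by exact_mod_cast hm.ne'
    have h1 := Int.emod_nonneg (φ V).toAdd h0
    have h2 := Int.emod_lt_of_pos (φ V).toAdd (show (0 : ℤ) < m by exact_mod_cast hm)
    have h3 : (φ V).toAdd % m ≠ 0 := fun h => hV (Int.dvd_of_emod_eq_zero h)
    refine ih ((φ V).toAdd % m).toNat (by omega) (by omega) _ ?_ x hsx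
    rw [map_mul, map_zpow, toAdd_mul, toAdd_zpow, hW, Int.toNat_of_nonneg h1, Int.emod_def,
      smul_eq_mul]
    ring

end UnivC

/-! ### Continuous functionals on an equivariant formal group law -/

section QuotFun

variable {k R : Type*} [CommRing k] [CommRing R] [Algebra k R]

/-- The functional on a quotient induced by a functional killing an ideal. -/
def quotFun (l : R →ₗ[k] k) (J : Ideal R) (h : ∀ x ∈ J, l x = 0) : (R ⧸ J) →ₗ[k] k :=
  (J.restrictScalars k).liftQ l h ∘ₗ (Submodule.Quotient.restrictScalarsEquiv k J).symm.toLinearMap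

@[simp] lemma quotFun_mk (l : R →ₗ[k] k) (J : Ideal R) (h : ∀ x ∈ J, l x = 0) (x : R) :
    quotFun l J h (Ideal.Quotient.mk J x) = l x := rfl

/-- The contraction of the first tensor factor with a functional. -/
def contractFst {M : Type*} [AddCommGroup M] [Module k M] (l : M →ₗ[k] k) (N : Type*)
    [AddCommGroup N] [Module k N] : M ⊗[k] N →ₗ[k] N :=
  (TensorProduct.lid k N).toLinearMap ∘ₗ l.rTensor N

section

variable {M N N' : Type*} [AddCommGroup M] [Module k M] [AddCommGroup N] [Module k N]
  [AddCommGroup N'] [Module k N']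

@[simp] lemma contractFst_tmul (l : M →ₗ[k] k) (a : M) (b : N) :
    contractFst l N (a ⊗ₜ b) = l a • b := rfl

lemma contractFst_map {M' : Type*} [AddCommGroup M'] [Module k M'] (l : M' →ₗ[k] k)
    (S : M →ₗ[k] M') (T : N →ₗ[k] N') (w : M ⊗[k] N) :
    contractFst l N' (TensorProduct.map S T w) = T (contractFst (l ∘ₗ S) N w) := by
  induction w using TensorProduct.induction_on with
  | zero => simp
  | tmul a b => simp
  | add a b ha hb => simp only [map_add, ha, hb]

lemma contractFst_comm (l : M →ₗ[k] k) (l' : N →ₗ[k] k) (w : M ⊗[k] N) :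
    l (contractFst l' M (TensorProduct.comm k M N w)) = l' (contractFst l N w) := by
  induction w using TensorProduct.induction_on with
  | zero => simp
  | tmul a b => simp [mul_comm]
  | add a b ha hb => simp only [map_add, ha, hb]

end

end QuotFun

namespace EquivariantFGL

variable {D : Type v} [CommGroup D] (G : EquivariantFGL.{u} D)

variable {G} in
/-- The intersection of open ideals. -/
def infIdeal (J K : OpenIdeal G.R) : OpenIdeal G.R := ⟨J.1 ⊓ K.1, J.2.inter K.2⟩

/-- The continuous functionals. -/
def Cov : Submodule G.k (G.R →ₗ[G.k] G.k) where
  carrier := {l | ∃ J : OpenIdeal G.R, ∀ x ∈ J.1, l x = 0}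
  zero_mem' := ⟨⟨⊤, isOpen_univ⟩, fun _ _ => rfl⟩
  add_mem' := by
    rintro a b ⟨J, hJ⟩ ⟨K, hK⟩
    exact ⟨infIdeal J K, fun x hx => by
      rw [LinearMap.add_apply, hJ x hx.1, hK x hx.2, add_zero]⟩
  smul_mem' := by
    rintro c a ⟨J, hJ⟩
    exact ⟨J, fun x hx => by rw [LinearMap.smul_apply, hJ x hx, smul_zero]⟩

variable {G}

lemma comulComponent_mono {J J' K K' : OpenIdeal G.R} (hJ : J.1 ≤ J'.1) (hK : K.1 ≤ K'.1)
    (x : G.R) : Algebra.TensorProduct.map (Ideal.Quotient.factorₐ G.k hJ)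
      (Ideal.Quotient.factorₐ G.k hK) (comulComponent G.Δ J K x) = comulComponent G.Δ J' K' x :=
  (G.Δ x).2 (J, K) (J', K') hJ hK

/-- The contraction of a component of the comultiplication with a functional. -/
def actQ (l : G.R →ₗ[G.k] G.k) (J : OpenIdeal G.R) (h : ∀ x ∈ J.1, l x = 0) (K : OpenIdeal G.R) :
    G.R →ₗ[G.k] (G.R ⧸ K.1) :=
  contractFst (quotFun l J.1 h) (G.R ⧸ K.1) ∘ₗ (comulComponent G.Δ J K).toLinearMap

lemma actQ_apply (l : G.R →ₗ[G.k] G.k) (J : OpenIdeal G.R) (h : ∀ x ∈ J.1, l x = 0)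
    (K : OpenIdeal G.R) (x : G.R) : actQ l J h K x
      = contractFst (quotFun l J.1 h) (G.R ⧸ K.1) (comulComponent G.Δ J K x) := rfl

lemma actQ_mono (l : G.R →ₗ[G.k] G.k) {J J' K K' : OpenIdeal G.R} (h : ∀ x ∈ J'.1, l x = 0)
    (hJ : J.1 ≤ J'.1) (hK : K.1 ≤ K'.1) (x : G.R) : Ideal.Quotient.factor hK
      (actQ l J (fun x hx => h x (hJ hx)) K x) = actQ l J' h K' x := by
  rw [actQ_apply, actQ_apply, ← comulComponent_mono hJ hK]
  have h1 : quotFun l J'.1 h ∘ₗ (Ideal.Quotient.factorₐ G.k hJ).toLinearMap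
      = quotFun l J.1 (fun x hx => h x (hJ hx)) := by
    refine LinearMap.ext fun z => ?_
    obtain ⟨z, rfl⟩ := Ideal.Quotient.mk_surjective z
    rfl
  have h2 := contractFst_map (quotFun l J'.1 h) (Ideal.Quotient.factorₐ G.k hJ).toLinearMap
    (Ideal.Quotient.factorₐ G.k hK).toLinearMap (comulComponent G.Δ J K x)
  rw [h1] at h2
  exact h2.symm

lemma actQ_eq (l : G.R →ₗ[G.k] G.k) {J J' : OpenIdeal G.R} (h : ∀ x ∈ J.1, l x = 0)
    (h' : ∀ x ∈ J'.1, l x = 0) (K : OpenIdeal G.R) (x : G.R) :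
    actQ l J h K x = actQ l J' h' K x := by
  rw [← actQ_mono l (J := infIdeal J J') h inf_le_left le_rfl,
    ← actQ_mono l (J := infIdeal J J') h' inf_le_right le_rfl]

lemma ext_mk {x y : G.R} (h : ∀ K : OpenIdeal G.R,
    Ideal.Quotient.mk K.1 x = Ideal.Quotient.mk K.1 y) : x = y := by
  rw [← sub_eq_zero]
  exact G.complete.separated _ fun K => Ideal.Quotient.eq.mp (h K)

/-- The contractions of Δ(x) with `l` form a compatible family in the quotients of R, and
completeness assembles them into an element of R. -/
lemma exists_act (l : G.Cov) (x : G.R) : ∃ t : G.R, ∀ (J : OpenIdeal G.R)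
    (h : ∀ x ∈ J.1, l.1 x = 0) (K : OpenIdeal G.R), Ideal.Quotient.mk K.1 t = actQ l.1 J h K x := by
  obtain ⟨J₀, h₀⟩ := l.2
  choose f hf using fun K : OpenIdeal G.R => Ideal.Quotient.mk_surjective (actQ l.1 J₀ h₀ K x)
  obtain ⟨t, ht⟩ := G.complete.complete f fun K K' hK => by
    rw [← Ideal.Quotient.eq, hf, ← actQ_mono l.1 h₀ le_rfl hK, ← hf K]
    rfl
  exact ⟨t, fun J h K => by rw [Ideal.Quotient.eq.mpr (ht K), hf, actQ_eq]⟩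

/-- The action of continuous functionals through the comultiplication. -/
def act (l : G.Cov) : G.R →ₗ[G.k] G.R where
  toFun x := (exists_act l x).choose
  map_add' x y := ext_mk fun K => by
    obtain ⟨J, h⟩ := l.2
    rw [map_add, (exists_act l _).choose_spec J h, (exists_act l _).choose_spec J h,
      (exists_act l _).choose_spec J h, map_add]
  map_smul' c x := ext_mk fun K => by
    obtain ⟨J, h⟩ := l.2
    have h1 : ∀ z : G.R, Ideal.Quotient.mk K.1 (c • z) = c • Ideal.Quotient.mk K.1 z :=
      fun z => map_smul (Ideal.Quotient.mkₐ G.k K.1) c z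
    rw [RingHom.id_apply, h1, (exists_act l _).choose_spec J h, (exists_act l _).choose_spec J h,
      map_smul]

lemma mk_act (l : G.Cov) {J : OpenIdeal G.R} (h : ∀ x ∈ J.1, l.1 x = 0) (K : OpenIdeal G.R)
    (x : G.R) : Ideal.Quotient.mk K.1 (act l x) = actQ l.1 J h K x :=
  (exists_act l x).choose_spec J h K

lemma apply_act (l m : G.Cov) {J K : OpenIdeal G.R} (h : ∀ x ∈ J.1, l.1 x = 0)
    (h' : ∀ x ∈ K.1, m.1 x = 0) (x : G.R) : m.1 (act l x)
      = quotFun m.1 K.1 h' (contractFst (quotFun l.1 J.1 h) _ (comulComponent G.Δ J K x)) := by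
  rw [← actQ_apply, ← mk_act, quotFun_mk]

lemma apply_act_eq_zero (l m : G.Cov) {J K : OpenIdeal G.R} (h : ∀ x ∈ J.1, l.1 x = 0)
    (h' : ∀ x ∈ K.1, m.1 x = 0) {x : G.R} (hx : x ∈ (comulKer G.comul_continuous J K).1) :
    m.1 (act l x) = 0 := by
  rw [apply_act l m h h', RingHom.mem_ker.mp hx, map_zero, map_zero]

instance : Mul G.Cov where
  -- As `act l` is (l ⊗̂ id)Δ, this is the convolution (l ⊗ m)Δ.
  mul l m := ⟨m.1 ∘ₗ act l, by
    obtain ⟨J, h⟩ := l.2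
    obtain ⟨K, h'⟩ := m.2
    exact ⟨comulKer G.comul_continuous J K, fun x hx => apply_act_eq_zero l m h h' hx⟩⟩

lemma mul_apply (l m : G.Cov) (x : G.R) : (l * m).1 x = m.1 (act l x) := rfl

lemma cov_mul_comm (l m : G.Cov) : l * m = m * l := by
  obtain ⟨J, h⟩ := l.2
  obtain ⟨K, h'⟩ := m.2
  refine Subtype.ext (LinearMap.ext fun x => ?_)
  rw [mul_apply, mul_apply, apply_act l m h h', apply_act m l h' h, ← G.comul_cocomm J K]
  exact (contractFst_comm _ _ _).symm

/-- Contract the two sides of coassociativity with `l` and `m` in the first two factors. -/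
lemma act_mul (l m : G.Cov) (x : G.R) : act (l * m) x = act m (act l x) := by
  obtain ⟨J, h⟩ := l.2
  obtain ⟨K, h'⟩ := m.2
  refine ext_mk fun L => ?_
  have hlm : ∀ x ∈ (comulKer G.comul_continuous J K).1, (l * m).1 x = 0 :=
    fun x hx => apply_act_eq_zero l m h h' hx
  have h1 : ∀ w, contractFst (quotFun m.1 K.1 h') (G.R ⧸ L.1)
      (contractFst (quotFun l.1 J.1 h) ((G.R ⧸ K.1) ⊗[G.k] (G.R ⧸ L.1))
        (Algebra.TensorProduct.assoc G.k G.k G.k (G.R ⧸ J.1) (G.R ⧸ K.1) (G.R ⧸ L.1)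
          (Algebra.TensorProduct.map (comulBar G.comul_continuous J K) (AlgHom.id G.k (G.R ⧸ L.1))
            w))) = contractFst (quotFun (l * m).1 _ hlm) (G.R ⧸ L.1) w := by
    intro w
    induction w using TensorProduct.induction_on with
    | zero => simp
    | add a b ha hb => simp only [map_add, ha, hb]
    | tmul a b =>
      obtain ⟨a, rfl⟩ := Ideal.Quotient.mk_surjective a
      rw [contractFst_tmul, quotFun_mk, mul_apply, apply_act l m h h',
        Algebra.TensorProduct.map_tmul]
      change contractFst _ _ (contractFst _ _ (Algebra.TensorProduct.assoc G.k G.k G.k _ _ _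
        (comulComponent G.Δ J K a ⊗ₜ b))) = _
      generalize comulComponent G.Δ J K a = w
      induction w using TensorProduct.induction_on with
      | zero => simp
      | add p q hp hq => simp only [TensorProduct.add_tmul, map_add, hp, hq, add_smul]
      | tmul p q => simp [mul_smul]
  have h2 : ∀ w, contractFst (quotFun m.1 K.1 h') (G.R ⧸ L.1)
      (contractFst (quotFun l.1 J.1 h) ((G.R ⧸ K.1) ⊗[G.k] (G.R ⧸ L.1))
        (Algebra.TensorProduct.map (AlgHom.id G.k (G.R ⧸ J.1)) (comulBar G.comul_continuous K L)
          w)) = contractFst (quotFun m.1 K.1 h') (G.R ⧸ L.1) (comulBar G.comul_continuous K L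
            (contractFst (quotFun l.1 J.1 h) _ w)) := by
    intro w
    induction w using TensorProduct.induction_on with
    | zero => simp
    | add a b ha hb => simp only [map_add, ha, hb]
    | tmul a b => simp
  have h3 := h1 (comulComponent G.Δ (comulKer G.comul_continuous J K) L x)
  rw [G.comul_coassoc J K L x, h2, ← actQ_apply, ← actQ_apply, ← mk_act, ← mk_act] at h3
  rw [← h3, mk_act m h']
  rfl

variable (G) in
/-- The augmentations as continuous functionals. -/
def gr (V : D) : G.Cov :=
  ⟨(G.θ V).toLinearMap, ⟨⟨_, isOpen_ker_of_hasBasis G.basis V⟩, fun _ hx => hx⟩⟩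

lemma gr_apply (V : D) (x : G.R) : (G.gr V).1 x = G.θ V x := rfl

lemma contractFst_quotFun (f : G.R →ₐ[G.k] G.k) (N : Type*) [CommRing N] [Algebra G.k N]
    (w : (G.R ⧸ RingHom.ker f) ⊗[G.k] N) :
    contractFst (quotFun f.toLinearMap (RingHom.ker f) fun _ hx => hx) N w
      = Algebra.TensorProduct.productMap ((Algebra.ofId G.k N).comp (Ideal.kerLiftAlg f))
        (AlgHom.id G.k N) w := by
  induction w using TensorProduct.induction_on with
  | zero => simp
  | add a b ha hb => simp only [map_add, ha, hb]
  | tmul a b =>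
    obtain ⟨a, rfl⟩ := Ideal.Quotient.mk_surjective a
    rw [Algebra.TensorProduct.productMap_apply_tmul, contractFst_tmul]
    exact Algebra.smul_def (f a) b

lemma act_gr_one (x : G.R) : act (G.gr 1) x = x := by
  refine ext_mk fun K => ?_
  rw [mk_act (G.gr 1) (J := ⟨_, isOpen_ker_of_hasBasis G.basis 1⟩) (fun _ hx => hx), ← G.counit K x]
  exact contractFst_quotFun _ _ _

instance : CommRing G.Cov where
  __ := (inferInstance : AddCommGroup G.Cov)
  __ := (inferInstance : Mul G.Cov)
  one := G.gr 1
  mul_assoc a b c := Subtype.ext (LinearMap.ext fun x => by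
    rw [mul_apply, mul_apply, mul_apply, act_mul])
  mul_comm := cov_mul_comm
  one_mul a := Subtype.ext (LinearMap.ext fun x => by
    change a.1 (act (G.gr 1) x) = _
    rw [act_gr_one])
  mul_one a := (cov_mul_comm _ _).trans (Subtype.ext (LinearMap.ext fun x => by
    change a.1 (act (G.gr 1) x) = _
    rw [act_gr_one]))
  left_distrib a b c := Subtype.ext (LinearMap.ext fun x => rfl)
  right_distrib a b c := by
    rw [cov_mul_comm, cov_mul_comm a, cov_mul_comm b]
    exact Subtype.ext (LinearMap.ext fun x => rfl)
  zero_mul a := by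
    rw [cov_mul_comm]
    exact Subtype.ext (LinearMap.ext fun x => rfl)
  mul_zero a := Subtype.ext (LinearMap.ext fun x => rfl)

instance : Algebra G.k G.Cov :=
  Algebra.ofModule
    (fun c a b => by
      rw [cov_mul_comm, cov_mul_comm a]
      exact Subtype.ext (LinearMap.ext fun x => rfl))
    (fun c a b => Subtype.ext (LinearMap.ext fun x => rfl))

lemma quotFun_contractFst_quotFun (f g : G.R →ₐ[G.k] G.k)
    (w : (G.R ⧸ RingHom.ker f) ⊗[G.k] (G.R ⧸ RingHom.ker g)) :
    quotFun g.toLinearMap (RingHom.ker g) (fun _ hx => hx)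
        (contractFst (quotFun f.toLinearMap (RingHom.ker f) fun _ hx => hx) _ w)
      = Algebra.TensorProduct.productMap (Ideal.kerLiftAlg f) (Ideal.kerLiftAlg g) w := by
  induction w using TensorProduct.induction_on with
  | zero => simp
  | add a b ha hb => simp only [map_add, ha, hb]
  | tmul a b =>
    obtain ⟨a, rfl⟩ := Ideal.Quotient.mk_surjective a
    obtain ⟨b, rfl⟩ := Ideal.Quotient.mk_surjective b
    rw [Algebra.TensorProduct.productMap_apply_tmul, contractFst_tmul, map_smul]
    rfl

lemma gr_mul (V W : D) : G.gr V * G.gr W = G.gr (V * W) := by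
  refine Subtype.ext (LinearMap.ext fun x => ?_)
  have h := apply_act (G.gr V) (G.gr W) (J := ⟨_, isOpen_ker_of_hasBasis G.basis V⟩)
    (K := ⟨_, isOpen_ker_of_hasBasis G.basis W⟩) (fun _ hx => hx) (fun _ hx => hx) x
  have h2 : (G.gr (V * W)).1 x = convolve G.Δ (G.θ V) (G.θ W) (isOpen_ker_of_hasBasis G.basis V)
      (isOpen_ker_of_hasBasis G.basis W) x := by
    rw [G.theta_mul]
    rfl
  rw [mul_apply, h, h2]
  exact quotFun_contractFst_quotFun _ _ _

variable (G) in
/-- The augmentations as a homomorphism. -/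
def grHom : D →* G.Cov where
  toFun := G.gr
  map_one' := rfl
  map_mul' V W := (gr_mul V W).symm

end EquivariantFGL

/-! ### Division by orientations -/

/-- Augmentations of an algebra whose kernels are generated by elements `y V`, together with the
division by `y V`. -/
structure DivisionSystem (k R D : Type*) [CommRing k] [CommRing R] [Algebra k R] where
  θ : D → R →ₐ[k] k
  y : D → R
  q : D → R →ₗ[k] R
  y_mul_q : ∀ V x, y V * q V x = x - algebraMap k R (θ V x)
  q_y_mul : ∀ V x, q V (y V * x) = x

namespace DivisionSystem

variable {k R D : Type*} [CommRing k] [CommRing R] [Algebra k R] (S : DivisionSystem k R D)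

/-- The product of the kernels of augmentations over a list. -/
def kerProd (s : List D) : Ideal R := (s.map fun V => RingHom.ker (S.θ V)).prod

@[simp] lemma kerProd_nil : S.kerProd [] = ⊤ := by
  simp [kerProd, Ideal.one_eq_top]

lemma kerProd_cons (V : D) (s : List D) :
    S.kerProd (V :: s) = RingHom.ker (S.θ V) * S.kerProd s := by
  simp [kerProd]

lemma kerProd_append (s t : List D) : S.kerProd (s ++ t) = S.kerProd s * S.kerProd t := by
  simp [kerProd]

lemma kerProd_append_le_left (s t : List D) : S.kerProd (s ++ t) ≤ S.kerProd s :=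
  (S.kerProd_append s t).trans_le Ideal.mul_le_left

lemma kerProd_append_le_right (s t : List D) : S.kerProd (s ++ t) ≤ S.kerProd t :=
  (S.kerProd_append s t).trans_le Ideal.mul_le_right

lemma θ_y (V : D) : S.θ V (S.y V) = 0 := by
  have h := S.y_mul_q V (S.y V * 1)
  rw [S.q_y_mul, mul_one, eq_comm, sub_eq_self] at h
  have h2 := congrArg (S.θ V) h
  rwa [AlgHom.commutes, map_zero] at h2

lemma ker_eq_span (V : D) : RingHom.ker (S.θ V) = Ideal.span {S.y V} := by
  refine le_antisymm (fun x hx => Ideal.mem_span_singleton.mpr ⟨S.q V x, ?_⟩)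
    ((Ideal.span_singleton_le_iff_mem _).mpr (S.θ_y V))
  have hx' : S.θ V x = 0 := hx
  rw [S.y_mul_q, hx', map_zero, sub_zero]

lemma mem_kerProd_cons {V : D} {s : List D} {x : R} :
    x ∈ S.kerProd (V :: s) ↔ ∃ z ∈ S.kerProd s, S.y V * z = x := by
  rw [kerProd_cons, ker_eq_span, Ideal.mem_span_singleton_mul]

lemma y_mul_mem {V : D} {s : List D} {x : R} (h : x ∈ S.kerProd s) :
    S.y V * x ∈ S.kerProd (V :: s) := S.mem_kerProd_cons.mpr ⟨x, h, rfl⟩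

lemma q_mem {V : D} {s : List D} {x : R} (h : x ∈ S.kerProd (V :: s)) : S.q V x ∈ S.kerProd s := by
  obtain ⟨z, hz, rfl⟩ := S.mem_kerProd_cons.mp h
  rwa [S.q_y_mul]

/-- The division with remainder x = θ(x) + y q(x) is linear in x, so it passes to the tensor product
with an arbitrary module. -/
lemma rTensor_eq_add (V : D) {N : Type*} [AddCommGroup N] [Module k N] (w : R ⊗[k] N) :
    w = 1 ⊗ₜ contractFst (S.θ V).toLinearMap N w
      + (LinearMap.mulLeft k (S.y V)).rTensor N ((S.q V).rTensor N w) := by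
  induction w using TensorProduct.induction_on with
  | zero => simp
  | tmul a b =>
    simp only [contractFst_tmul, LinearMap.rTensor_tmul, LinearMap.mulLeft_apply, S.y_mul_q,
      AlgHom.toLinearMap_apply, TensorProduct.tmul_smul, ← TensorProduct.smul_tmul',
      TensorProduct.sub_tmul, Algebra.algebraMap_eq_smul_one, add_sub_cancel]
  | add a b ha hb =>
    conv_lhs => rw [ha, hb]
    simp only [map_add, TensorProduct.tmul_add]
    abel

/-- Families of functionals, indexed by lists, large enough to test membership in the products of
kernels. -/
structure IsTester (P : List D → (R →ₗ[k] k) → Prop) : Prop where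
  θ : ∀ V s, P (V :: s) (S.θ V).toLinearMap
  q : ∀ V s l, P s l → P (V :: s) (l ∘ₗ S.q V)

variable {S}

lemma IsTester.mem_range {P : List D → (R →ₗ[k] k) → Prop} (hP : S.IsTester P) (s : List D)
    {N : Type*} [AddCommGroup N] [Module k N] {w : R ⊗[k] N}
    (h : ∀ l, P s l → contractFst l N w = 0) :
    w ∈ LinearMap.range (((S.kerProd s).restrictScalars k).subtype.rTensor N) := by
  induction s generalizing w with
  | nil =>
    clear h
    induction w using TensorProduct.induction_on with
    | zero => exact zero_mem _
    | tmul a b => exact ⟨⟨a, by simp⟩ ⊗ₜ b, rfl⟩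
    | add a b ha hb => exact add_mem ha hb
  | cons V s ih =>
    -- The remainder vanishes by the tester θ_V. The quotient is handled by induction, because
    -- testers for the tail composed with q_V are testers for the whole list.
    rw [S.rTensor_eq_add V w, h _ (hP.θ V s), TensorProduct.tmul_zero, zero_add]
    obtain ⟨w', hw'⟩ := ih (w := (S.q V).rTensor N w) fun l hl => by
      have h1 := contractFst_map l (S.q V) (LinearMap.id : N →ₗ[k] N) w
      rw [h (l ∘ₗ S.q V) (hP.q V s l hl)] at h1
      exact h1
    rw [← hw']
    refine ⟨((LinearMap.mulLeft k (S.y V)).restrict (q := (S.kerProd (V :: s)).restrictScalars k)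
      fun x hx => S.y_mul_mem hx).rTensor N w', ?_⟩
    rw [← LinearMap.rTensor_comp_apply, ← LinearMap.rTensor_comp_apply]
    rfl

lemma IsTester.mem_kerProd {P : List D → (R →ₗ[k] k) → Prop} (hP : S.IsTester P) (s : List D)
    {x : R} (h : ∀ l, P s l → l x = 0) : x ∈ S.kerProd s := by
  induction s generalizing x with
  | nil => simp
  | cons V s ih =>
    have h1 : S.θ V x = 0 := h _ (hP.θ V s)
    have h2 := S.y_mul_q V x
    rw [h1, map_zero, sub_zero] at h2
    rw [← h2]
    exact S.y_mul_mem (ih fun l hl => h _ (hP.q V s l hl))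

/-- Elements of `R ⊗ N` annihilated by the testers vanish modulo the products of kernels. -/
lemma IsTester.map_mk_eq_zero {P : List D → (R →ₗ[k] k) → Prop} (hP : S.IsTester P) {s : List D}
    {J : Ideal R} (hJ : S.kerProd s ≤ J) {N N' : Type*} [AddCommGroup N] [Module k N]
    [AddCommGroup N'] [Module k N'] (ψ : N →ₗ[k] N') (w : R ⊗[k] N)
    (h : ∀ l, P s l → ψ (contractFst l N w) = 0) :
    TensorProduct.map (Ideal.Quotient.mkₐ k J).toLinearMap ψ w = 0 := by
  obtain ⟨z, hz⟩ := hP.mem_range s (w := ψ.lTensor R w) fun l hl => by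
    rw [← h l hl]
    exact contractFst_map l LinearMap.id ψ w
  have h1 : TensorProduct.map (Ideal.Quotient.mkₐ k J).toLinearMap ψ w
      = (Ideal.Quotient.mkₐ k J).toLinearMap.rTensor N' (ψ.lTensor R w) := by
    rw [← LinearMap.comp_apply, LinearMap.rTensor_comp_lTensor]
  rw [h1, ← hz, ← LinearMap.rTensor_comp_apply]
  have h0 : (Ideal.Quotient.mkₐ k J).toLinearMap
      ∘ₗ ((S.kerProd s).restrictScalars k).subtype = 0 :=
    LinearMap.ext fun a => Ideal.Quotient.eq_zero_iff_mem.mpr (hJ a.2)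
  rw [h0, LinearMap.rTensor_zero, LinearMap.zero_apply]

end DivisionSystem

namespace EquivariantFGL

variable {D : Type v} [CommGroup D] {G : EquivariantFGL.{u} D}

lemma mk_act_gr (V : D) (K : OpenIdeal G.R) (x : G.R) : Ideal.Quotient.mk K.1 (act (G.gr V) x)
    = leftTranslate G.Δ (G.θ V) (isOpen_ker_of_hasBasis G.basis V) K x := by
  rw [mk_act (G.gr V) (J := ⟨_, isOpen_ker_of_hasBasis G.basis V⟩) (fun _ hx => hx)]
  exact contractFst_quotFun _ _ _

/-- The translation by a character. -/
def translate (V : D) : G.R →ₐ[G.k] G.R :=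
  AlgHom.ofLinearMap (act (G.gr V))
    (ext_mk fun K => by rw [mk_act_gr, map_one (leftTranslate _ _ _ _), map_one])
    (fun x z => ext_mk fun K => by
      rw [mk_act_gr, map_mul (leftTranslate _ _ _ _), map_mul (Ideal.Quotient.mk _), mk_act_gr,
        mk_act_gr])

lemma translate_apply (V : D) (x : G.R) : translate V x = act (G.gr V) x := rfl

lemma translate_translate (V W : D) (x : G.R) :
    translate V (translate W x) = translate (V * W) x := by
  rw [translate_apply, translate_apply, ← act_mul, gr_mul, mul_comm, translate_apply]

lemma translate_one (x : G.R) : translate 1 x = x := act_gr_one x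

lemma theta_translate (V W : D) (x : G.R) : G.θ W (translate V x) = G.θ (V * W) x := by
  rw [translate_apply, ← gr_apply, ← mul_apply, gr_mul, gr_apply]

variable (G) in
/-- The translate of the orientation generating the kernel of `θ V`. -/
def yv (V : D) : G.R := translate V⁻¹ G.y

lemma translate_yv (V : D) : translate V (G.yv V) = G.y := by
  rw [yv, translate_translate, mul_inv_cancel, translate_one]

lemma yv_one : G.yv 1 = G.y := by
  rw [yv, inv_one, translate_one]

lemma yv_mul_cancel {V : D} {x z : G.R} (h : G.yv V * x = G.yv V * z) : x = z := by
  have h1 := congrArg (translate V) h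
  rw [map_mul, map_mul, translate_yv] at h1
  have h2 := congrArg (translate V⁻¹) (G.y_regular.left h1)
  simpa [translate_translate, translate_one] using h2

/-- Translation by V carries the kernel of θ_V to the kernel of θ_ε, which is generated by y; divide
there and translate back. -/
lemma exists_q (V : D) (x : G.R) :
    ∃ z, G.yv V * z = x - algebraMap G.k G.R (G.θ V x) := by
  have h1 : translate V (x - algebraMap G.k G.R (G.θ V x)) ∈ RingHom.ker (G.θ 1) := by
    rw [RingHom.mem_ker, theta_translate, mul_one, map_sub, AlgHom.commutes]
    exact sub_self _
  rw [G.y_span, Ideal.mem_span_singleton] at h1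
  obtain ⟨z, hz⟩ := h1
  refine ⟨translate V⁻¹ z, ?_⟩
  rw [yv, ← map_mul, ← hz, translate_translate, inv_mul_cancel, translate_one]

variable (G) in
/-- The division by the translates of the orientation. -/
def div : DivisionSystem G.k G.R D where
  θ := G.θ
  y := G.yv
  q V :=
    { toFun := fun x => (exists_q V x).choose
      map_add' := fun a b => yv_mul_cancel (V := V) (by
        rw [mul_add, (exists_q V _).choose_spec, (exists_q V _).choose_spec,
          (exists_q V _).choose_spec]
        simp only [map_add]
        abel)
      map_smul' := fun c a => yv_mul_cancel (V := V) (by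
        rw [RingHom.id_apply, mul_smul_comm, (exists_q V _).choose_spec,
          (exists_q V _).choose_spec, map_smul, smul_sub, Algebra.smul_def c (algebraMap _ _ _),
          ← map_mul, smul_eq_mul]) }
  y_mul_q V x := (exists_q V x).choose_spec
  q_y_mul V x := yv_mul_cancel (V := V) (by
    have h0 : G.θ V (G.yv V) = 0 := by
      have h1 : G.y ∈ RingHom.ker (G.θ 1) := by
        rw [G.y_span]
        exact Ideal.mem_span_singleton_self _
      rw [yv, theta_translate, inv_mul_cancel]
      exact h1
    refine (exists_q V _).choose_spec.trans ?_
    rw [map_mul, h0, zero_mul, map_zero, sub_zero])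

lemma isOpen_kerProd (s : List D) : IsOpen (G.div.kerProd s : Set G.R) := by
  refine (G.div.kerProd s).toAddSubgroup.isOpen_of_mem_nhds (g := 0) ?_
  have h := G.basis.mem_of_mem (i := (s : Multiset D)) trivial
  rw [Multiset.map_coe, Multiset.prod_coe] at h
  exact h

lemma exists_kerProd_le (J : OpenIdeal G.R) : ∃ s : List D, G.div.kerProd s ≤ J.1 := by
  obtain ⟨s, -, hs⟩ := G.basis.mem_iff.mp (J.2.mem_nhds J.1.zero_mem)
  induction s using Quotient.inductionOn with
  | h s =>
    rw [Multiset.quot_mk_to_coe, Multiset.map_coe, Multiset.prod_coe] at hs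
    exact ⟨s, hs⟩

variable (G) in
/-- The product of kernels of augmentations over a list as an open ideal. -/
def kerOpen (s : List D) : OpenIdeal G.R := ⟨G.div.kerProd s, isOpen_kerProd s⟩

lemma exists_cov_killed (l : G.Cov) : ∃ s : List D, ∀ x ∈ G.div.kerProd s, l.1 x = 0 := by
  obtain ⟨J, h⟩ := l.2
  obtain ⟨s, hs⟩ := exists_kerProd_le J
  exact ⟨s, fun x hx => h x (hs hx)⟩

/-- The cap product with an element. -/
def capOp (f : G.R) : Module.End G.k G.Cov where
  toFun l := ⟨l.1 ∘ₗ LinearMap.mulLeft G.k f, l.2.imp fun J h _ hx => h _ (J.1.mul_mem_left f hx)⟩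
  map_add' _ _ := rfl
  map_smul' _ _ := rfl

lemma capOp_apply (f : G.R) (l : G.Cov) (x : G.R) : (capOp f l).1 x = l.1 (f * x) := rfl

lemma capOp_comm (f f' : G.R) (l : G.Cov) : capOp f (capOp f' l) = capOp f' (capOp f l) :=
  Subtype.ext (LinearMap.ext fun x => by
    rw [capOp_apply, capOp_apply, capOp_apply, capOp_apply, mul_left_comm])

/-- The transpose of the division by a translate of the orientation. -/
def divOp (V : D) : Module.End G.k G.Cov where
  toFun l := ⟨l.1 ∘ₗ G.div.q V, by
    obtain ⟨s, hs⟩ := exists_cov_killed l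
    exact ⟨G.kerOpen (V :: s), fun x hx => hs _ (G.div.q_mem hx)⟩⟩
  map_add' _ _ := rfl
  map_smul' _ _ := rfl

lemma divOp_apply (V : D) (l : G.Cov) (x : G.R) : (divOp V l).1 x = l.1 (G.div.q V x) := rfl

lemma capOp_list_apply (s : List D) (l : G.Cov) (x : G.R) :
    ((s.map fun V => capOp (G.yv V)).prod l).1 x = l.1 ((s.map G.yv).prod * x) := by
  induction s generalizing x with
  | nil => simp
  | cons V s ih =>
    rw [List.map_cons, List.prod_cons, Module.End.mul_apply, capOp_apply, ih, List.map_cons,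
      List.prod_cons]
    congr 1
    ring

lemma prod_yv_mul_mem (s : List D) (x : G.R) : (s.map G.yv).prod * x ∈ G.div.kerProd s := by
  induction s with
  | nil => simp
  | cons V s ih =>
    rw [List.map_cons, List.prod_cons, mul_assoc]
    exact G.div.y_mul_mem ih

variable (G) in
/-- The operators on the continuous functionals. -/
def covOps : CofreeOps G.k G.Cov D where
  ε := LinearMap.applyₗ (1 : G.R) ∘ₗ G.Cov.subtype
  Y V := capOp (G.yv V)
  Z := divOp
  g := G.gr
  Y_comm V W l := capOp_comm _ _ l
  Y_Z V l := Subtype.ext (LinearMap.ext fun x => by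
    rw [capOp_apply, divOp_apply]
    exact congrArg _ (G.div.q_y_mul V x))
  Z_Y V l := Subtype.ext (LinearMap.ext fun x => by
    rw [divOp_apply, capOp_apply]
    refine (congrArg l.1 (G.div.y_mul_q V x)).trans ?_
    rw [map_sub, Algebra.algebraMap_eq_smul_one, map_smul]
    change _ - G.θ V x * l.1 1 = l.1 x - l.1 1 * G.θ V x
    rw [mul_comm])
  ε_g V := map_one (G.θ V)
  nil l := by
    obtain ⟨s, hs⟩ := exists_cov_killed l
    exact ⟨s, Subtype.ext (LinearMap.ext fun x => by
      rw [capOp_list_apply, hs _ (prod_yv_mul_mem s x)]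
      rfl)⟩

end EquivariantFGL

/-! ### The covariant bialgebra of an equivariant formal group law -/

namespace EquivariantFGL

open CofreeOps (contract)

variable {D : Type v} [CommGroup D] {G : EquivariantFGL.{u} D}

/-- Evaluation at an element. -/
def evalAt (f : G.R) : G.Cov →ₗ[G.k] G.k := LinearMap.applyₗ f ∘ₗ G.Cov.subtype

@[simp] lemma evalAt_apply (f : G.R) (l : G.Cov) : evalAt f l = l.1 f := rfl

lemma evalAt_eq (f : G.R) : evalAt f = G.covOps.ε ∘ₗ capOp f :=
  LinearMap.ext fun l => by
    change l.1 f = l.1 (f * 1)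
    rw [mul_one]

lemma contract_evalAt_comul (f : G.R) (l : G.Cov) :
    contract (evalAt f) (G.covOps.comul l) = capOp f l := by
  rw [evalAt_eq]
  exact G.covOps.contract_comul_eq _ (fun V c => capOp_comm _ _ _) l

/-- Evaluation at a pair of elements. -/
def evalAt₂ (f f' : G.R) : G.Cov ⊗[G.k] G.Cov →ₗ[G.k] G.k :=
  LinearMap.mul' G.k G.k ∘ₗ TensorProduct.map (evalAt f) (evalAt f')

@[simp] lemma evalAt₂_tmul (f f' : G.R) (l m : G.Cov) :
    evalAt₂ f f' (l ⊗ₜ m) = l.1 f * m.1 f' := rfl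

lemma evalAt₂_eq (f f' : G.R) (w : G.Cov ⊗[G.k] G.Cov) :
    evalAt₂ f f' w = (contract (evalAt f) w).1 f' := by
  induction w using TensorProduct.induction_on with
  | zero => simp
  | tmul a b => rfl
  | add a b ha hb => rw [map_add, ha, hb, map_add]; rfl

/-- The comultiplication built from the operators is the transpose of the multiplication of R, since
capping with evaluation at `f` is the transpose of multiplication by `f`. -/
lemma evalAt₂_comul (f f' : G.R) (l : G.Cov) :
    evalAt₂ f f' (G.covOps.comul l) = l.1 (f * f') := by
  rw [evalAt₂_eq, contract_evalAt_comul, capOp_apply]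

lemma exists_openIdeal_killed (S : Finset G.Cov) :
    ∃ J : OpenIdeal G.R, ∀ l ∈ S, ∀ x ∈ J.1, l.1 x = 0 := by
  classical
  induction S using Finset.induction_on with
  | empty => exact ⟨⟨⊤, isOpen_univ⟩, by simp⟩
  | insert l S _ ih =>
    obtain ⟨J, h⟩ := l.2
    obtain ⟨K, hK⟩ := ih
    refine ⟨infIdeal J K, fun m hm x hx => ?_⟩
    rcases Finset.mem_insert.mp hm with rfl | hm
    · exact h x hx.1
    · exact hK m hm x hx.2

/-- Pairing of two functionals with a tensor. -/
def pair (l m : G.R →ₗ[G.k] G.k) : G.R ⊗[G.k] G.R →ₗ[G.k] G.k :=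
  LinearMap.mul' G.k G.k ∘ₗ TensorProduct.map l m

@[simp] lemma pair_tmul (l m : G.R →ₗ[G.k] G.k) (a b : G.R) :
    pair l m (a ⊗ₜ b) = l a * m b := rfl

/-- The projection to a component of the completed tensor product. -/
def mk₂ (J K : OpenIdeal G.R) : G.R ⊗[G.k] G.R →ₐ[G.k] (G.R ⧸ J.1) ⊗[G.k] (G.R ⧸ K.1) :=
  Algebra.TensorProduct.map (Ideal.Quotient.mkₐ G.k J.1) (Ideal.Quotient.mkₐ G.k K.1)

lemma mk₂_surjective (J K : OpenIdeal G.R) : Function.Surjective (mk₂ J K) :=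
  TensorProduct.map_surjective Ideal.Quotient.mk_surjective Ideal.Quotient.mk_surjective

lemma pair_eq {J K : OpenIdeal G.R} (l m : G.Cov) (h : ∀ x ∈ J.1, l.1 x = 0)
    (h' : ∀ x ∈ K.1, m.1 x = 0) (x : G.R) (w : G.R ⊗[G.k] G.R)
    (hw : mk₂ J K w = comulComponent G.Δ J K x) : pair l.1 m.1 w = (l * m).1 x := by
  rw [mul_apply, apply_act l m h h', ← hw]
  clear hw
  induction w using TensorProduct.induction_on with
  | zero => simp
  | tmul a b =>
    change _ = quotFun m.1 K.1 h' (contractFst _ _ ((Ideal.Quotient.mk J.1 a) ⊗ₜ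
      (Ideal.Quotient.mk K.1 b)))
    rw [contractFst_tmul, map_smul, quotFun_mk, quotFun_mk]
    rfl
  | add a b ha hb => simp only [map_add, ha, hb]

/-- This is the bialgebra axiom for functionals, dual to the multiplicativity of Δ on R. Only
finitely many functionals occur in the two comultiplications. An open ideal J killing them all lets
Δf and Δf' be replaced by honest tensors lifting their (J, J)-components. -/
lemma evalAt₂_comul_mul_comul (f f' : G.R) (l m : G.Cov) :
    evalAt₂ f f' (G.covOps.comul l * G.covOps.comul m) = (l * m).1 (f * f') := by
  classical
  obtain ⟨S, hS⟩ := TensorProduct.exists_finset (G.covOps.comul l)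
  obtain ⟨T, hT⟩ := TensorProduct.exists_finset (G.covOps.comul m)
  obtain ⟨J, hJ⟩ := exists_openIdeal_killed
    (insert l (insert m (S.image Prod.fst ∪ S.image Prod.snd ∪ (T.image Prod.fst ∪ T.image Prod.snd))))
  obtain ⟨w, hw⟩ := mk₂_surjective J J (comulComponent G.Δ J J f)
  obtain ⟨w', hw'⟩ := mk₂_surjective J J (comulComponent G.Δ J J f')
  have hl := hJ l (by simp)
  have hm := hJ m (by simp)
  have hS1 : ∀ i ∈ S, ∀ x ∈ J.1, i.1.1 x = 0 := fun i hi => hJ _ (by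
    simp only [Finset.mem_insert, Finset.mem_union]
    exact .inr (.inr (.inl (.inl (Finset.mem_image_of_mem _ hi)))))
  have hS2 : ∀ i ∈ S, ∀ x ∈ J.1, i.2.1 x = 0 := fun i hi => hJ _ (by
    simp only [Finset.mem_insert, Finset.mem_union]
    exact .inr (.inr (.inl (.inr (Finset.mem_image_of_mem _ hi)))))
  have hT1 : ∀ i ∈ T, ∀ x ∈ J.1, i.1.1 x = 0 := fun i hi => hJ _ (by
    simp only [Finset.mem_insert, Finset.mem_union]
    exact .inr (.inr (.inr (.inl (Finset.mem_image_of_mem _ hi)))))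
  have hT2 : ∀ i ∈ T, ∀ x ∈ J.1, i.2.1 x = 0 := fun i hi => hJ _ (by
    simp only [Finset.mem_insert, Finset.mem_union]
    exact .inr (.inr (.inr (.inr (Finset.mem_image_of_mem _ hi)))))
  rw [← pair_eq l m hl hm (f * f') (w * w') (by
    rw [map_mul (mk₂ J J), map_mul (comulComponent G.Δ J J), hw, hw'])]
  have h1 : evalAt₂ f f' (G.covOps.comul l * G.covOps.comul m)
      = ∑ i ∈ S, ∑ j ∈ T, pair i.1.1 j.1.1 w * pair i.2.1 j.2.1 w' := by
    rw [hS, hT, Finset.sum_mul_sum, map_sum]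
    refine Finset.sum_congr rfl fun i hi => ?_
    rw [map_sum]
    refine Finset.sum_congr rfl fun j hj => ?_
    rw [Algebra.TensorProduct.tmul_mul_tmul, evalAt₂_tmul,
      pair_eq i.1 j.1 (hS1 i hi) (hT1 j hj) f w hw, pair_eq i.2 j.2 (hS2 i hi) (hT2 j hj) f' w' hw']
  rw [h1]
  clear h1 hw hw'
  induction w using TensorProduct.induction_on with
  | zero => simp
  | add a b ha hb => simp only [map_add, add_mul, Finset.sum_add_distrib, ha, hb]
  | tmul a b =>
    induction w' using TensorProduct.induction_on with
    | zero => simp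
    | add a b ha hb => simp only [map_add, mul_add, Finset.sum_add_distrib, ha, hb]
    | tmul c d =>
      rw [Algebra.TensorProduct.tmul_mul_tmul, pair_tmul, ← evalAt₂_comul, ← evalAt₂_comul, hS, hT,
        map_sum, map_sum, Finset.sum_mul_sum]
      simp only [pair_tmul, evalAt₂_tmul]
      exact Finset.sum_congr rfl fun i _ => Finset.sum_congr rfl fun j _ => by ring

lemma act_one (l : G.Cov) : act l 1 = l.1 1 • 1 := by
  refine ext_mk fun K => ?_
  obtain ⟨J, h⟩ := l.2
  rw [mk_act l h, actQ_apply, map_one (comulComponent _ _ _)]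
  rfl

lemma covOps_τ (s : List D) : G.covOps.τ s = evalAt (s.map G.yv).prod := by
  refine LinearMap.ext fun l => ?_
  refine (capOp_list_apply s l 1).trans ?_
  rw [mul_one]
  rfl

lemma covOps_ext₂ {w w' : G.Cov ⊗[G.k] G.Cov} (h : ∀ f f', evalAt₂ f f' w = evalAt₂ f f' w') :
    w = w' := by
  refine G.covOps.ext₂ fun s t => ?_
  have h1 : G.covOps.τ₂ s t = evalAt₂ (s.map G.yv).prod (t.map G.yv).prod := by
    rw [CofreeOps.τ₂, covOps_τ, covOps_τ]
    rfl
  rw [h1, h]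

lemma comul_gr (V : D) : G.covOps.comul (G.gr V) = G.gr V ⊗ₜ G.gr V :=
  covOps_ext₂ fun f f' => by
    rw [evalAt₂_comul, evalAt₂_tmul, gr_apply, map_mul]
    rfl

instance : Bialgebra G.k G.Cov :=
  letI := G.covOps.coalgebra
  Bialgebra.mk' _ _ (map_one (G.θ 1))
    (fun {l m} => by
      change (l * m).1 1 = l.1 1 * m.1 1
      rw [mul_apply, act_one, map_smul, smul_eq_mul])
    (comul_gr 1)
    (fun {l m} => covOps_ext₂ fun f f' => by
      change evalAt₂ f f' (G.covOps.comul (l * m)) = _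
      rw [evalAt₂_comul, ← evalAt₂_comul_mul_comul]
      rfl)

instance : Coalgebra.IsCocomm G.k G.Cov := G.covOps.isCocomm

lemma cap_evalAt (f : G.R) (l : G.Cov) : cap (evalAt f) l = capOp f l := contract_evalAt_comul f l

lemma isGroupLikeElem_gr (V : D) : IsGroupLikeElem G.k (G.gr V) :=
  ⟨map_one (G.θ V), comul_gr V⟩

lemma algebraMap_cov_apply (c : G.k) (x : G.R) :
    (algebraMap G.k G.Cov c).1 x = c * G.θ 1 x := by
  rw [Algebra.algebraMap_eq_smul_one]
  rfl

variable (G) in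
/-- The orientation of the covariant bialgebra. -/
def covOrientation : CapOrientation G.k G.Cov where
  y := evalAt G.y
  Z := divOp 1
  cap_Z l := by
    rw [cap_evalAt, ← yv_one]
    exact G.covOps.Y_Z 1 l
  Z_cap l := by
    rw [cap_evalAt, ← yv_one, Algebra.algebraMap_eq_smul_one]
    exact G.covOps.Z_Y 1 l

/-- Multiplication by `gr V` is the transpose of translation by V, so conjugation turns
multiplication by y into multiplication by its translate. -/
lemma covOrientation_Yop (V : D) : (G.covOrientation).Yop G.grHom V = capOp (G.yv V) := by
  refine LinearMap.ext fun l => ?_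
  rw [CapOrientation.Yop_apply]
  change G.gr V * cap (evalAt G.y) (G.gr V⁻¹ * l) = _
  rw [cap_evalAt]
  refine Subtype.ext (LinearMap.ext fun x => ?_)
  rw [mul_apply, capOp_apply, mul_apply, capOp_apply, ← translate_apply, ← translate_apply, map_mul,
    translate_translate, inv_mul_cancel, translate_one]
  rfl

variable (G) in
/-- The covariant bialgebra of an equivariant formal group law. -/
def covModel : CovFGL D G.k G.Cov where
  __ := G.covOrientation
  g := G.grHom
  grouplike := isGroupLikeElem_gr
  nil l := by
    have h : (G.covOrientation).Yop G.grHom = fun V => capOp (G.yv V) :=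
      funext covOrientation_Yop
    simp only [CapOrientation.Yl, h]
    exact G.covOps.nil l

end EquivariantFGL

/-! ### The coordinate ring of a covariant bialgebra -/

namespace CovFGL

open Coalgebra CapOrientation

variable {k C : Type u} {D : Type v} [CommRing k] [CommRing C] [Bialgebra k C]
  [IsCocomm k C] [CommGroup D] (M : CovFGL D k C)

/-- The coordinate ring: the dual of the covariant bialgebra. -/
def Coord (_ : CovFGL D k C) : Type u := WithConv (C →ₗ[k] k)

instance : CommRing M.Coord := inferInstanceAs (CommRing (WithConv (C →ₗ[k] k)))

instance : Algebra k M.Coord := inferInstanceAs (Algebra k (WithConv (C →ₗ[k] k)))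

/-- The linear functionals as elements of the coordinate ring. -/
def coordEquiv : (C →ₗ[k] k) ≃ₗ[k] M.Coord := (WithConv.linearEquiv k (C →ₗ[k] k)).symm

/-- Evaluation of elements of the coordinate ring. -/
def evalC : C →ₗ[k] M.Coord →ₗ[k] k := M.coordEquiv.symm.toLinearMap.flip

variable {M}

lemma coord_ext {f f' : M.Coord} (h : ∀ c, M.evalC c f = M.evalC c f') : f = f' :=
  M.coordEquiv.symm.injective (LinearMap.ext h)

@[simp] lemma evalC_coordEquiv (l : C →ₗ[k] k) (c : C) : M.evalC c (M.coordEquiv l) = l c := rfl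

lemma evalC_mul (f f' : M.Coord) (c : C) :
    M.evalC c (f * f') = M.evalC (cap (M.coordEquiv.symm f) c) f' :=
  (LinearMap.congr_fun (comp_cap_eq_conv (M.coordEquiv.symm f') (M.coordEquiv.symm f)) c).symm

@[simp] lemma evalC_one (c : C) : M.evalC c 1 = counit (R := k) c := rfl

lemma evalC_algebraMap (a : k) (c : C) :
    M.evalC c (algebraMap k M.Coord a) = a * counit (R := k) c := by
  rw [Algebra.algebraMap_eq_smul_one, map_smul, evalC_one, smul_eq_mul]

lemma evalC_grouplike_mul {a : C} (ha : IsGroupLikeElem k a) (f f' : M.Coord) :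
    M.evalC a (f * f') = M.evalC a f * M.evalC a f' := by
  rw [evalC_mul, cap_grouplike _ ha, map_smul]
  rfl

variable (M)

/-- The orientations and augmentations of the coordinate ring. -/
def division : DivisionSystem k M.Coord D where
  θ V := AlgHom.ofLinearMap (M.evalC (M.g V))
    (by rw [evalC_one, (M.grouplike V).counit_eq_one]) (evalC_grouplike_mul (M.grouplike V))
  y V := M.coordEquiv (M.y ∘ₗ LinearMap.mulLeft k (M.g V⁻¹))
  q V := M.coordEquiv.toLinearMap ∘ₗ LinearMap.lcomp k k (M.Zop M.g V) ∘ₗ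
    M.coordEquiv.symm.toLinearMap
  y_mul_q V f := coord_ext fun c => by
    rw [evalC_mul, LinearEquiv.symm_apply_apply, ← M.Yop_eq_cap M.grouplike, map_sub,
      evalC_algebraMap]
    change M.evalC (M.Zop M.g V (M.Yop M.g V c)) f = _
    rw [M.Zop_Yop M.grouplike, map_sub, map_smul, LinearMap.sub_apply, LinearMap.smul_apply,
      smul_eq_mul, mul_comm]
    rfl
  q_y_mul V f := coord_ext fun c => by
    refine (evalC_mul _ f (M.Zop M.g V c)).trans ?_
    rw [LinearEquiv.symm_apply_apply, ← M.Yop_eq_cap M.grouplike, M.Yop_Zop]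

variable {M}

lemma evalC_division_y_mul (V : D) (f : M.Coord) (c : C) :
    M.evalC c (M.division.y V * f) = M.evalC (M.Yop M.g V c) f := by
  rw [M.Yop_eq_cap M.grouplike]
  exact evalC_mul _ _ _

lemma evalC_division_q (V : D) (f : M.Coord) (c : C) :
    M.evalC c (M.division.q V f) = M.evalC (M.Zop M.g V c) f := rfl

lemma Yop_g (V : D) : M.Yop M.g V (M.g V) = 0 := M.ops.Y_g V

lemma isTester_evalC : M.division.IsTester fun s l => ∃ c, M.Yl M.g s c = 0 ∧ M.evalC c = l where
  θ V s := ⟨M.g V, by rw [Yl_cons, M.Yop_Yl M.grouplike, Yop_g, map_zero], rfl⟩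
  q V s l := by
    rintro ⟨c, hc, rfl⟩
    exact ⟨M.Zop M.g V c, by rw [Yl_cons, M.Yop_Yl M.grouplike, M.Yop_Zop, hc], rfl⟩

/-- Multiplication by y_V on the dual is the transpose of the operator Y_V, and division is the
transpose of Z_V. Products of kernels of augmentations are thus the annihilators of kernels of
products of operators. -/
lemma mem_division_kerProd {s : List D} {f : M.Coord} :
    f ∈ M.division.kerProd s ↔ ∀ c, M.Yl M.g s c = 0 → M.evalC c f = 0 := by
  refine ⟨fun hf => ?_, fun h => isTester_evalC.mem_kerProd s (by
    rintro _ ⟨c, hc, rfl⟩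
    exact h c hc)⟩
  induction s generalizing f with
  | nil =>
    intro c hc
    obtain rfl : c = 0 := hc
    simp
  | cons V s ih =>
    intro c hc
    obtain ⟨z, hz, rfl⟩ := M.division.mem_kerProd_cons.mp hf
    rw [evalC_division_y_mul]
    refine ih hz _ ?_
    rw [← M.Yop_Yl M.grouplike]
    simpa using hc

lemma map_mk_eq_zero (s : List D) (J : Ideal M.Coord) (hJ : M.division.kerProd s ≤ J)
    {N N' : Type*} [AddCommGroup N] [Module k N] [AddCommGroup N'] [Module k N'] (ψ : N →ₗ[k] N')
    (w : M.Coord ⊗[k] N) (h : ∀ c, M.Yl M.g s c = 0 → ψ (contractFst (M.evalC c) N w) = 0) :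
    TensorProduct.map (Ideal.Quotient.mkₐ k J).toLinearMap ψ w = 0 :=
  isTester_evalC.map_mk_eq_zero hJ ψ w (by
    rintro _ ⟨c, hc, rfl⟩
    exact h c hc)

/-! #### The topology -/

variable (M) in
lemma ringSubgroupsBasis :
    RingSubgroupsBasis fun s : List D => (M.division.kerProd s).toAddSubgroup :=
  RingSubgroupsBasis.of_comm _
    (fun s t => ⟨s ++ t, le_inf (M.division.kerProd_append_le_left s t)
      (M.division.kerProd_append_le_right s t)⟩)
    (fun s => ⟨s, by
      rintro _ ⟨a, ha, b, hb, rfl⟩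
      exact Ideal.mul_mem_left _ a hb⟩)
    (fun x s => ⟨s, fun a ha => Ideal.mul_mem_left _ x ha⟩)

instance : TopologicalSpace M.Coord := (ringSubgroupsBasis M).topology

instance : IsTopologicalRing M.Coord :=
  (ringSubgroupsBasis M).toRingFilterBasis.isTopologicalRing

lemma hasBasis_coord : (𝓝 (0 : M.Coord)).HasBasis (fun _ : List D => True)
    fun s => (M.division.kerProd s : Set M.Coord) :=
  (ringSubgroupsBasis M).hasBasis_nhds_zero

lemma hasBasis_coord_multiset : (𝓝 (0 : M.Coord)).HasBasis (fun _ : Multiset D => True)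
    (fun s => ((s.map fun V => RingHom.ker (M.division.θ V)).prod : Set M.Coord)) := by
  refine hasBasis_coord.to_hasBasis (fun s _ => ⟨s, trivial, ?_⟩) (fun s _ => ?_)
  · rw [Multiset.map_coe, Multiset.prod_coe]
    rfl
  · induction s using Quotient.inductionOn with
    | h s =>
      refine ⟨s, trivial, ?_⟩
      rw [Multiset.quot_mk_to_coe, Multiset.map_coe, Multiset.prod_coe]
      rfl

lemma isOpen_coord_kerProd (s : List D) : IsOpen (M.division.kerProd s : Set M.Coord) :=
  (M.division.kerProd s).toAddSubgroup.isOpen_of_mem_nhds (g := 0)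
    (hasBasis_coord.mem_of_mem trivial)

variable (M) in
/-- The products of kernels as open ideals. -/
def kerOpen (s : List D) : OpenIdeal M.Coord := ⟨M.division.kerProd s, isOpen_coord_kerProd s⟩

lemma exists_coord_kerProd_le (J : OpenIdeal M.Coord) :
    ∃ s : List D, M.division.kerProd s ≤ J.1 := by
  obtain ⟨s, -, hs⟩ := hasBasis_coord.mem_iff.mp (J.2.mem_nhds J.1.zero_mem)
  exact ⟨s, hs⟩

lemma isLinearlyComplete_coord : IsLinearlyComplete M.Coord where
  separated f hf := coord_ext fun c => by
    obtain ⟨s, hs⟩ := M.nil c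
    rw [mem_division_kerProd.mp (hf (M.kerOpen s)) c hs, map_zero]
  complete x hx := by
    choose s hs using M.nil
    -- The value at c does not depend on the killing list; any two lists are compared through their
    -- concatenation. The limit is then a functional defined on all of C, since the kernels exhaust
    -- C.
    have key : ∀ c t, M.Yl M.g t c = 0 →
        M.evalC c (x (M.kerOpen (s c))) = M.evalC c (x (M.kerOpen t)) := by
      have h1 : ∀ c t t', M.Yl M.g t c = 0 → M.division.kerProd t' ≤ M.division.kerProd t →
          M.evalC c (x (M.kerOpen t')) = M.evalC c (x (M.kerOpen t)) := fun c t t' ht h => by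
        rw [← sub_eq_zero, ← map_sub]
        exact mem_division_kerProd.mp (hx (M.kerOpen t') (M.kerOpen t) h) c ht
      intro c t ht
      rw [← h1 c t (s c ++ t) ht (M.division.kerProd_append_le_right _ _),
        ← h1 c (s c) (s c ++ t) (hs c) (M.division.kerProd_append_le_left _ _)]
    let l : C →ₗ[k] k :=
      { toFun := fun c => M.evalC c (x (M.kerOpen (s c)))
        map_add' := fun a b => by
          have ha := M.Yl_append_right M.grouplike (hs a) (s b)
          have hb := M.Yl_append_left (hs b) (s a)
          rw [key a _ ha, key b _ hb, key (a + b) (s a ++ s b) (by rw [map_add, ha, hb, add_zero]),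
            map_add]
          rfl
        map_smul' := fun a c => by
          rw [key (a • c) (s c) (by rw [map_smul, hs, smul_zero]), map_smul]
          rfl }
    refine ⟨M.coordEquiv l, fun J => ?_⟩
    obtain ⟨t, ht⟩ := exists_coord_kerProd_le J
    have h1 : M.coordEquiv l - x (M.kerOpen t) ∈ M.division.kerProd t :=
      mem_division_kerProd.mpr fun c hc => by
        rw [map_sub, evalC_coordEquiv, sub_eq_zero]
        exact key c t hc
    simpa using add_mem (ht h1) (hx (M.kerOpen t) J ht)

end CovFGL

/-! ### The comultiplication of the coordinate ring -/

namespace CovFGL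

open Coalgebra CapOrientation

variable {k C : Type u} {D : Type v} [CommRing k] [CommRing C] [Bialgebra k C]
  [IsCocomm k C] [CommGroup D] {M : CovFGL D k C}

lemma exists_finset_comul {s : List D} {c : C} (hc : M.Yl M.g s c = 0) :
    ∃ S : Finset (LinearMap.ker (M.Yl M.g s) × C),
      comul (R := k) c = ∑ i ∈ S, (i.1 : C) ⊗ₜ[k] i.2 := by
  obtain ⟨w, hw⟩ := M.comul_mem_range M.grouplike hc
  obtain ⟨S, hS⟩ := TensorProduct.exists_finset (TensorProduct.comm k _ _ w)
  refine ⟨S, ?_⟩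
  have h1 : ∀ w, TensorProduct.comm k C C ((LinearMap.ker (M.Yl M.g s)).subtype.lTensor C w)
      = (LinearMap.ker (M.Yl M.g s)).subtype.rTensor C (TensorProduct.comm k _ _ w) := fun w => by
    induction w using TensorProduct.induction_on with
    | zero => simp
    | tmul a b => simp
    | add a b ha hb => simp only [map_add, ha, hb]
  rw [← comm_comul k c, ← hw, h1, hS, map_sum]
  rfl

variable (M) in
/-- Evaluation of a tensor at a pair of elements. -/
def eval₂ (c c' : C) : M.Coord ⊗[k] M.Coord →ₗ[k] k :=
  M.evalC c' ∘ₗ contractFst (M.evalC c) M.Coord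

@[simp] lemma eval₂_tmul (c c' : C) (a b : M.Coord) :
    M.eval₂ c c' (a ⊗ₜ b) = M.evalC c a * M.evalC c' b := by
  simp [eval₂]

/-- The tensor `w` represents the comultiplication of `f` on the kernels of products of
operators. -/
def Represents (s t : List D) (f : M.Coord) (w : M.Coord ⊗[k] M.Coord) : Prop :=
  ∀ c c', M.Yl M.g s c = 0 → M.Yl M.g t c' = 0 → M.eval₂ c c' w = M.evalC (c * c') f

lemma Represents.mono {s s' t t' : List D} {f : M.Coord} {w : M.Coord ⊗[k] M.Coord}
    (h : Represents (s ++ s') (t ++ t') f w) : Represents s t f w :=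
  fun c c' hc hc' => h c c' (M.Yl_append_right M.grouplike hc _)
    (M.Yl_append_right M.grouplike hc' _)

lemma Represents.mono' {s s' t t' : List D} {f : M.Coord} {w : M.Coord ⊗[k] M.Coord}
    (h : Represents (s' ++ s) (t' ++ t) f w) : Represents s t f w :=
  fun c c' hc hc' => h c c' (M.Yl_append_left hc _) (M.Yl_append_left hc' _)

/-- A bilinear form restricted to ker × C comes from a finite tensor: for the list V :: s take 1 ⊗
F(g_V, ·) plus y_V times a tensor for F(Z_V ·, ·). With F(c, c') = f(cc') this supplies the
components of Δf. -/
lemma exists_eval₂_eq (s : List D) (F : C →ₗ[k] C →ₗ[k] k) : ∃ w : M.Coord ⊗[k] M.Coord,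
    ∀ c c', M.Yl M.g s c = 0 → M.eval₂ c c' w = F c c' := by
  induction s generalizing F with
  | nil =>
    refine ⟨0, fun c c' hc => ?_⟩
    obtain rfl : c = 0 := hc
    simp
  | cons V s ih =>
    obtain ⟨w, hw⟩ := ih (F ∘ₗ M.Zop M.g V)
    refine ⟨1 ⊗ₜ M.coordEquiv (F (M.g V)) +
      (LinearMap.mulLeft k (M.division.y V)).rTensor M.Coord w, fun c c' hc => ?_⟩
    have h1 : ∀ w, M.eval₂ c c' ((LinearMap.mulLeft k (M.division.y V)).rTensor M.Coord w)
        = M.eval₂ (M.Yop M.g V c) c' w := fun w => by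
      induction w using TensorProduct.induction_on with
      | zero => simp
      | tmul a b => simp [evalC_division_y_mul]
      | add a b ha hb => simp only [map_add, ha, hb]
    rw [map_add, eval₂_tmul, h1, hw _ _ (by rw [← M.Yop_Yl M.grouplike]; simpa using hc),
      LinearMap.comp_apply, M.Zop_Yop M.grouplike, evalC_one, evalC_coordEquiv, map_sub, map_smul,
      LinearMap.sub_apply, LinearMap.smul_apply, smul_eq_mul, add_sub_cancel]

lemma exists_represents (s t : List D) (f : M.Coord) : ∃ w, Represents s t f w := by
  obtain ⟨w, hw⟩ := exists_eval₂_eq (M := M) s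
    ((LinearMap.mul k C).compr₂ (M.coordEquiv.symm f))
  exact ⟨w, fun c c' hc _ => hw c c' hc⟩

/-- Convolution of functionals and the bialgebra axiom Δ(cc') = Δ(c)Δ(c') turn f f'(cc') into a
double sum. The first tensor factors stay in the kernels where `w` is known, and the second ones are
reassembled by cap products, which preserve these kernels. -/
lemma Represents.mul {s t : List D} {f f' : M.Coord} {w w' : M.Coord ⊗[k] M.Coord}
    (h : Represents s t f w) (h' : Represents s t f' w') :
    Represents s t (f * f') (w * w') := by
  intro c c' hc hc'
  obtain ⟨S, hS⟩ := exists_finset_comul hc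
  obtain ⟨T, hT⟩ := exists_finset_comul hc'
  have hS' : ∀ a : C →ₗ[k] k, cap a c = ∑ i ∈ S, a i.1 • i.2 := fun a => by
    rw [cap_apply, hS, map_sum]
    rfl
  have hT' : ∀ a : C →ₗ[k] k, cap a c' = ∑ i ∈ T, a i.1 • i.2 := fun a => by
    rw [cap_apply, hT, map_sum]
    rfl
  have h1 : M.evalC (c * c') (f * f')
      = ∑ i ∈ S, ∑ j ∈ T, M.eval₂ i.1 j.1 w * M.evalC (i.2 * j.2) f' := by
    rw [evalC_mul, cap_apply, Bialgebra.comul_mul, hS, hT, Finset.sum_mul_sum, map_sum, map_sum,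
      LinearMap.sum_apply]
    refine Finset.sum_congr rfl fun i _ => ?_
    rw [map_sum, map_sum, LinearMap.sum_apply]
    refine Finset.sum_congr rfl fun j _ => ?_
    rw [Algebra.TensorProduct.tmul_mul_tmul, CofreeOps.contract_tmul, map_smul,
      LinearMap.smul_apply, h _ _ i.1.2 j.1.2]
    rfl
  rw [h1]
  clear h1 h
  induction w using TensorProduct.induction_on with
  | zero => simp
  | add a b ha hb => simp only [map_add, add_mul, Finset.sum_add_distrib, ha, hb]
  | tmul a b =>
    have hcap : ∀ (e : C →ₗ[k] k) {r : List D} {x : C}, M.Yl M.g r x = 0 →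
        M.Yl M.g r (cap e x) = 0 := fun e r x hx => by
      rw [← M.cap_Yl M.grouplike, hx, map_zero]
    have h2 : M.eval₂ c c' (a ⊗ₜ b * w')
        = M.eval₂ (cap (M.coordEquiv.symm a) c) (cap (M.coordEquiv.symm b) c') w' := by
      clear h'
      induction w' using TensorProduct.induction_on with
      | zero => simp
      | add a b ha hb => simp only [map_add, mul_add, ha, hb]
      | tmul a' b' =>
        rw [Algebra.TensorProduct.tmul_mul_tmul, eval₂_tmul, eval₂_tmul, evalC_mul, evalC_mul]
    rw [h2, h' _ _ (hcap _ hc) (hcap _ hc'), hS', hT', Finset.sum_mul_sum, map_sum,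
      LinearMap.sum_apply]
    refine Finset.sum_congr rfl fun i _ => ?_
    rw [map_sum, LinearMap.sum_apply]
    refine Finset.sum_congr rfl fun j _ => ?_
    rw [smul_mul_smul_comm, map_smul, LinearMap.smul_apply, eval₂_tmul]
    rfl

/-- The projection to a component of the completed tensor product. -/
def mk₂ (J K : Ideal M.Coord) : M.Coord ⊗[k] M.Coord →ₐ[k] (M.Coord ⧸ J) ⊗[k] (M.Coord ⧸ K) :=
  Algebra.TensorProduct.map (Ideal.Quotient.mkₐ k J) (Ideal.Quotient.mkₐ k K)

lemma mk_eq_zero (s : List D) {J : Ideal M.Coord} (hJ : M.division.kerProd s ≤ J) {f : M.Coord}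
    (h : ∀ c, M.Yl M.g s c = 0 → M.evalC c f = 0) : Ideal.Quotient.mk J f = 0 :=
  Ideal.Quotient.eq_zero_iff_mem.mpr (hJ (mem_division_kerProd.mpr h))

lemma mk₂_eq_zero {s t : List D} {J K : Ideal M.Coord} (hJ : M.division.kerProd s ≤ J)
    (hK : M.division.kerProd t ≤ K) {w : M.Coord ⊗[k] M.Coord}
    (h : ∀ c c', M.Yl M.g s c = 0 → M.Yl M.g t c' = 0 → M.eval₂ c c' w = 0) :
    mk₂ J K w = 0 :=
  map_mk_eq_zero s J hJ (Ideal.Quotient.mkₐ k K).toLinearMap w fun c hc =>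
    mk_eq_zero t hK fun c' hc' => h c c' hc hc'

lemma Represents.unique {s t : List D} {J K : Ideal M.Coord} (hJ : M.division.kerProd s ≤ J)
    (hK : M.division.kerProd t ≤ K) {f : M.Coord} {w w' : M.Coord ⊗[k] M.Coord}
    (h : Represents s t f w) (h' : Represents s t f w') : mk₂ J K w = mk₂ J K w' := by
  rw [← sub_eq_zero, ← map_sub (mk₂ J K)]
  refine mk₂_eq_zero hJ hK fun c c' hc hc' => ?_
  rw [map_sub, h c c' hc hc', h' c c' hc hc', sub_self]

/-- A list of characters whose product of kernels lies in an open ideal. -/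
def idealList (J : OpenIdeal M.Coord) : List D := (exists_coord_kerProd_le J).choose

lemma kerProd_idealList (J : OpenIdeal M.Coord) : M.division.kerProd (idealList J) ≤ J.1 :=
  (exists_coord_kerProd_le J).choose_spec

/-- The value of a component of the comultiplication. -/
def comulFun (J K : OpenIdeal M.Coord) (f : M.Coord) : (M.Coord ⧸ J.1) ⊗[k] (M.Coord ⧸ K.1) :=
  mk₂ J.1 K.1 (exists_represents (idealList J) (idealList K) f).choose

/-- A tensor representing f on concatenated lists represents it on both original pairs of lists,
which proves independence of the chosen lists. -/
lemma comulFun_eq {s t : List D} {J K : OpenIdeal M.Coord} (hJ : M.division.kerProd s ≤ J.1)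
    (hK : M.division.kerProd t ≤ K.1) {f : M.Coord} {w : M.Coord ⊗[k] M.Coord}
    (h : Represents s t f w) : comulFun J K f = mk₂ J.1 K.1 w := by
  obtain ⟨w', hw'⟩ := exists_represents (s ++ idealList J) (t ++ idealList K) f
  refine Eq.trans ?_ (Represents.unique hJ hK hw'.mono h)
  exact Represents.unique (kerProd_idealList J) (kerProd_idealList K)
    (exists_represents (idealList J) (idealList K) f).choose_spec hw'.mono'

lemma Represents.add {s t : List D} {f f' : M.Coord} {w w' : M.Coord ⊗[k] M.Coord}
    (h : Represents s t f w) (h' : Represents s t f' w') :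
    Represents s t (f + f') (w + w') := fun c c' hc hc' => by
  rw [map_add, map_add, h c c' hc hc', h' c c' hc hc']

lemma represents_algebraMap (s t : List D) (a : k) :
    Represents (M := M) s t (algebraMap k _ a) (algebraMap k _ a) := fun c c' _ _ => by
  rw [Algebra.TensorProduct.algebraMap_apply, eval₂_tmul, evalC_algebraMap, evalC_algebraMap,
    Bialgebra.counit_mul, evalC_one, mul_assoc]

/-- A component of the comultiplication. -/
def comulHom (J K : OpenIdeal M.Coord) :
    M.Coord →ₐ[k] (M.Coord ⧸ J.1) ⊗[k] (M.Coord ⧸ K.1) where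
  toFun := comulFun J K
  map_one' := by
    have h := represents_algebraMap (M := M) (idealList J) (idealList K) 1
    rw [map_one, map_one] at h
    rw [comulFun_eq (kerProd_idealList J) (kerProd_idealList K) h, map_one]
  map_mul' f f' := by
    obtain ⟨w, hw⟩ := exists_represents (idealList J) (idealList K) f
    obtain ⟨w', hw'⟩ := exists_represents (idealList J) (idealList K) f'
    rw [comulFun_eq (kerProd_idealList J) (kerProd_idealList K) hw,
      comulFun_eq (kerProd_idealList J) (kerProd_idealList K) hw',
      comulFun_eq (kerProd_idealList J) (kerProd_idealList K) (hw.mul hw'), map_mul (mk₂ J.1 K.1)]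
  map_zero' := by
    have h := represents_algebraMap (M := M) (idealList J) (idealList K) 0
    rw [map_zero, map_zero] at h
    rw [comulFun_eq (kerProd_idealList J) (kerProd_idealList K) h, map_zero]
  map_add' f f' := by
    obtain ⟨w, hw⟩ := exists_represents (idealList J) (idealList K) f
    obtain ⟨w', hw'⟩ := exists_represents (idealList J) (idealList K) f'
    rw [comulFun_eq (kerProd_idealList J) (kerProd_idealList K) hw,
      comulFun_eq (kerProd_idealList J) (kerProd_idealList K) hw',
      comulFun_eq (kerProd_idealList J) (kerProd_idealList K) (hw.add hw'), map_add]
  commutes' a := by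
    rw [comulFun_eq (kerProd_idealList J) (kerProd_idealList K) (represents_algebraMap _ _ a),
      AlgHom.commutes]

lemma comulHom_eq {s t : List D} {J K : OpenIdeal M.Coord} (hJ : M.division.kerProd s ≤ J.1)
    (hK : M.division.kerProd t ≤ K.1) {f : M.Coord} {w : M.Coord ⊗[k] M.Coord}
    (h : Represents s t f w) : comulHom J K f = mk₂ J.1 K.1 w := comulFun_eq hJ hK h

variable (M) in
/-- The comultiplication of the coordinate ring. -/
def coordComul : M.Coord →ₐ[k] CompletedTensor k M.Coord :=
  (AlgHom.pi fun p : OpenIdeal M.Coord × OpenIdeal M.Coord =>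
    comulHom p.1 p.2).codRestrict _ fun f p q h₁ h₂ => by
      obtain ⟨w, hw⟩ := exists_represents (idealList p.1) (idealList p.2) f
      change Algebra.TensorProduct.map _ _ (comulHom p.1 p.2 f) = comulHom q.1 q.2 f
      rw [comulHom_eq (kerProd_idealList _) (kerProd_idealList _) hw,
        comulHom_eq ((kerProd_idealList _).trans h₁) ((kerProd_idealList _).trans h₂) hw]
      clear hw
      induction w using TensorProduct.induction_on with
      | zero => simp
      | add a b ha hb => simp only [map_add, ha, hb]
      | tmul a b => rfl

lemma comulComponent_coordComul (J K : OpenIdeal M.Coord) :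
    comulComponent M.coordComul J K = comulHom J K := rfl

/-- Dual of `Yl_prodList`: a functional vanishing on the kernel attached to `prodList s t` vanishes
on all products cc', so the zero tensor represents it. -/
lemma kerProd_prodList_le {s t : List D} {J K : OpenIdeal M.Coord}
    (hJ : M.division.kerProd s ≤ J.1) (hK : M.division.kerProd t ≤ K.1) :
    M.division.kerProd (prodList s t) ≤ RingHom.ker (comulComponent M.coordComul J K) := by
  intro f hf
  rw [RingHom.mem_ker, comulComponent_coordComul, comulHom_eq hJ hK (w := 0), map_zero]
  intro c c' hc hc'
  rw [map_zero]
  exact (mem_division_kerProd.mp hf _ (M.Yl_prodList M.grouplike s t hc hc')).symm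

variable (M) in
lemma comulContinuous_coord : ComulContinuous M.coordComul := fun J K => by
  obtain ⟨s, hs⟩ := exists_coord_kerProd_le J
  obtain ⟨t, ht⟩ := exists_coord_kerProd_le K
  exact AddSubgroup.isOpen_mono (H₁ := (M.division.kerProd (prodList s t)).toAddSubgroup)
    (H₂ := (RingHom.ker (comulComponent M.coordComul J K)).toAddSubgroup)
    (kerProd_prodList_le hs ht) (isOpen_coord_kerProd _)

variable (M) in
lemma comulCocommutative_coord : ComulCocommutative M.coordComul := fun J K f => by
  obtain ⟨w, hw⟩ := exists_represents (idealList J) (idealList K) f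
  have hw' : Represents (idealList K) (idealList J) f (TensorProduct.comm k _ _ w) :=
    fun c c' hc hc' => by
      rw [mul_comm, ← hw c' c hc' hc]
      clear hw
      induction w using TensorProduct.induction_on with
      | zero => simp
      | add a b ha hb => simp only [map_add, ha, hb]
      | tmul a b => simp [mul_comm]
  rw [comulComponent_coordComul, comulComponent_coordComul,
    comulHom_eq (kerProd_idealList _) (kerProd_idealList _) hw,
    comulHom_eq (kerProd_idealList _) (kerProd_idealList _) hw']
  clear hw hw'
  induction w using TensorProduct.induction_on with
  | zero => simp
  | add a b ha hb => simp only [map_add, ha, hb]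
  | tmul a b => rfl

variable (M) in
lemma comulCoassociative_coord : ComulCoassociative (comulContinuous_coord M) := by
  intro J K L f
  set s := idealList J
  set t := idealList K
  set r := idealList L
  have hJ : M.division.kerProd s ≤ J.1 := kerProd_idealList J
  have hK : M.division.kerProd t ≤ K.1 := kerProd_idealList K
  have hL : M.division.kerProd r ≤ L.1 := kerProd_idealList L
  obtain ⟨w, hw⟩ := exists_represents (prodList s t) r f
  obtain ⟨w', hw'⟩ := exists_represents s (prodList t r) f
  let P : M.Coord ⊗[k] (M.Coord ⊗[k] M.Coord) →ₗ[k]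
      (M.Coord ⧸ J.1) ⊗[k] ((M.Coord ⧸ K.1) ⊗[k] (M.Coord ⧸ L.1)) :=
    TensorProduct.map (Ideal.Quotient.mkₐ k J.1).toLinearMap (mk₂ K.1 L.1).toLinearMap
  -- Each iterated comultiplication is lifted to a triple tensor over the coordinate ring itself,
  -- with known values on triples of elements.
  have h1 : ∃ T, P T = Algebra.TensorProduct.assoc k k k (M.Coord ⧸ J.1) (M.Coord ⧸ K.1)
      (M.Coord ⧸ L.1) (Algebra.TensorProduct.map (comulBar (comulContinuous_coord M) J K)
        (AlgHom.id k (M.Coord ⧸ L.1)) (mk₂ _ L.1 w)) ∧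
      ∀ c c' c'', M.Yl M.g s c = 0 → M.Yl M.g t c' = 0 →
        M.eval₂ c' c'' (contractFst (M.evalC c) _ T) = M.eval₂ (c * c') c'' w := by
    clear hw
    induction w using TensorProduct.induction_on with
    | zero => exact ⟨0, by simp, fun _ _ _ _ _ => by simp⟩
    | add a b ha hb =>
      obtain ⟨T, hT, hT'⟩ := ha
      obtain ⟨T', h, h'⟩ := hb
      exact ⟨T + T', by simp only [map_add, hT, h], fun c c' c'' hc hc' => by
        simp only [map_add, hT' c c' c'' hc hc', h' c c' c'' hc hc']⟩
    | tmul a b =>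
      obtain ⟨u, hu⟩ := exists_represents s t a
      refine ⟨TensorProduct.assoc k _ _ _ (u ⊗ₜ b), ?_, fun c c' c'' hc hc' => ?_⟩
      · change _ = Algebra.TensorProduct.assoc k k k _ _ _
          (comulHom J K a ⊗ₜ Ideal.Quotient.mk L.1 b)
        rw [comulHom_eq hJ hK hu]
        clear hu
        induction u using TensorProduct.induction_on with
        | zero => simp
        | add a b ha hb => simp only [map_add, TensorProduct.add_tmul, ha, hb]
        | tmul a b => rfl
      · rw [eval₂_tmul, ← hu c c' hc hc']
        clear hu
        induction u using TensorProduct.induction_on with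
        | zero => simp
        | add a b ha hb => simp only [map_add, TensorProduct.add_tmul, ha, hb, add_mul]
        | tmul a b => simp [mul_assoc]
  have h2 : ∃ T, P T = Algebra.TensorProduct.map (AlgHom.id k (M.Coord ⧸ J.1))
      (comulBar (comulContinuous_coord M) K L) (mk₂ J.1 _ w') ∧
      ∀ c c' c'', M.Yl M.g t c' = 0 → M.Yl M.g r c'' = 0 →
        M.eval₂ c' c'' (contractFst (M.evalC c) _ T) = M.eval₂ c (c' * c'') w' := by
    clear hw'
    induction w' using TensorProduct.induction_on with
    | zero => exact ⟨0, by simp, fun _ _ _ _ _ => by simp⟩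
    | add a b ha hb =>
      obtain ⟨T, hT, hT'⟩ := ha
      obtain ⟨T', h, h'⟩ := hb
      exact ⟨T + T', by simp only [map_add, hT, h], fun c c' c'' hc hc' => by
        simp only [map_add, hT' c c' c'' hc hc', h' c c' c'' hc hc']⟩
    | tmul a b =>
      obtain ⟨u, hu⟩ := exists_represents t r b
      refine ⟨a ⊗ₜ u, ?_, fun c c' c'' hc hc' => ?_⟩
      · change (Ideal.Quotient.mk J.1 a) ⊗ₜ mk₂ K.1 L.1 u
          = (Ideal.Quotient.mk J.1 a) ⊗ₜ comulHom K L b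
        rw [comulHom_eq hK hL hu]
      · rw [eval₂_tmul, ← hu c' c'' hc hc', contractFst_tmul, map_smul, smul_eq_mul]
  obtain ⟨T, hT, hT'⟩ := h1
  obtain ⟨T', h, h'⟩ := h2
  rw [comulComponent_coordComul, comulComponent_coordComul,
    comulHom_eq (kerProd_prodList_le hJ hK) hL hw, comulHom_eq hJ (kerProd_prodList_le hK hL) hw']
  refine hT.symm.trans (Eq.trans ?_ h)
  -- Both lifts take the value f(cc'c''), by associativity in C, and the testers detect their
  -- difference modulo the open ideals.
  rw [← sub_eq_zero, ← map_sub]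
  refine map_mk_eq_zero s J.1 hJ _ _ fun c hc => mk₂_eq_zero hK hL fun c' c'' hc' hc'' => ?_
  rw [map_sub, map_sub, hT' c c' c'' hc hc', h' c c' c'' hc' hc'',
    hw _ _ (M.Yl_prodList M.grouplike s t hc hc') hc'',
    hw' _ _ hc (M.Yl_prodList M.grouplike t r hc' hc''), mul_assoc, sub_self]

lemma Yl_singleton_g (V : D) : M.Yl M.g [V] (M.g V) = 0 := by
  rw [Yl_cons, Yl_nil, Yop_g]

lemma kerProd_singleton (V : D) : M.division.kerProd [V] = RingHom.ker (M.division.θ V) := by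
  rw [DivisionSystem.kerProd_cons, DivisionSystem.kerProd_nil, Ideal.mul_top]

lemma division_y_one : M.division.y 1 = M.coordEquiv M.y := by
  change M.coordEquiv _ = _
  congr 1
  ext c
  simp

variable (M) in
/-- The equivariant formal group law with a given covariant bialgebra. -/
def realization : EquivariantFGL.{u} D where
  k := k
  R := M.Coord
  complete := isLinearlyComplete_coord
  Δ := M.coordComul
  θ := M.division.θ
  y := M.division.y 1
  comul_continuous := comulContinuous_coord M
  comul_cocomm := comulCocommutative_coord M
  comul_coassoc := comulCoassociative_coord M
  basis := hasBasis_coord_multiset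
  counit K f := by
    obtain ⟨w, hw⟩ := exists_represents [1] (idealList K) f
    have h1 := comulHom_eq (J := ⟨_, isOpen_ker_of_hasBasis hasBasis_coord_multiset 1⟩)
      (kerProd_singleton (M := M) 1).le (kerProd_idealList K) hw
    refine (congrArg (Algebra.TensorProduct.productMap ((Algebra.ofId k _).comp
      (Ideal.kerLiftAlg (M.division.θ 1))) (AlgHom.id k (M.Coord ⧸ K.1))) h1).trans ?_
    have h2 : Algebra.TensorProduct.productMap ((Algebra.ofId k _).comp
        (Ideal.kerLiftAlg (M.division.θ 1))) (AlgHom.id k (M.Coord ⧸ K.1))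
          (mk₂ (RingHom.ker (M.division.θ 1)) K.1 w)
        = Ideal.Quotient.mk K.1 (contractFst (M.evalC (M.g 1)) _ w) := by
      clear hw h1
      induction w using TensorProduct.induction_on with
      | zero => simp
      | add a b ha hb => simp only [map_add, ha, hb]
      | tmul a b =>
        refine (Algebra.TensorProduct.productMap_apply_tmul _ _ _ _).trans ?_
        rw [contractFst_tmul]
        exact (Algebra.smul_def (M.evalC (M.g 1) a) (Ideal.Quotient.mk K.1 b)).symm
    rw [h2, ← sub_eq_zero, ← map_sub]
    refine mk_eq_zero (idealList K) (kerProd_idealList K) fun c hc => ?_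
    have h3 := hw _ c (Yl_singleton_g 1) hc
    rw [map_one M.g, one_mul] at h3
    rw [map_sub, ← h3, map_one M.g]
    exact sub_self _
  theta_mul V W := by
    ext f
    obtain ⟨w, hw⟩ := exists_represents [V] [W] f
    have h1 := comulHom_eq (J := ⟨_, isOpen_ker_of_hasBasis hasBasis_coord_multiset V⟩)
      (K := ⟨_, isOpen_ker_of_hasBasis hasBasis_coord_multiset W⟩)
      (kerProd_singleton (M := M) V).le (kerProd_singleton (M := M) W).le hw
    refine (congrArg (Algebra.TensorProduct.productMap (Ideal.kerLiftAlg (M.division.θ V))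
      (Ideal.kerLiftAlg (M.division.θ W))) h1).trans ?_
    have h2 : Algebra.TensorProduct.productMap (Ideal.kerLiftAlg (M.division.θ V))
        (Ideal.kerLiftAlg (M.division.θ W))
          (mk₂ (RingHom.ker (M.division.θ V)) (RingHom.ker (M.division.θ W)) w)
        = M.eval₂ (M.g V) (M.g W) w := by
      clear hw h1
      induction w using TensorProduct.induction_on with
      | zero => simp
      | add a b ha hb => simp only [map_add, ha, hb]
      | tmul a b =>
        refine (Algebra.TensorProduct.productMap_apply_tmul _ _ _ _).trans ?_
        rw [eval₂_tmul]
        rfl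
    rw [h2, hw _ _ (Yl_singleton_g V) (Yl_singleton_g W), ← map_mul]
    rfl
  y_regular := by
    have h : IsLeftRegular (M.division.y 1) := fun f f' hf => by
      have h1 := congrArg (M.division.q 1) hf
      simpa only [DivisionSystem.q_y_mul] using h1
    exact ⟨h, fun f f' hf => h (by simpa only [mul_comm] using hf)⟩
  y_span := M.division.ker_eq_span 1

end CovFGL

/-! ### The morphism to an equivariant formal group law -/

namespace CovFGL

open Coalgebra EquivariantFGL

/-- Semilinear maps of quotients are followed on representatives, together with the pairings. This
turns compatibility with comultiplications into an identity of scalars. -/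
lemma exists_mk₂_eq_map {k C : Type u} {D : Type v} [CommRing k] [CommRing C] [Bialgebra k C]
    [IsCocomm k C] [CommGroup D] {M : CovFGL D k C} {G : EquivariantFGL.{u} D} (φ : k →+* G.k)
    (τ : M.Coord →+* G.R) (h : ∀ a, τ (algebraMap k M.Coord a) = algebraMap G.k G.R (φ a))
    (J K : OpenIdeal G.R) (w : M.Coord ⊗[k] M.Coord) : ∃ w' : G.R ⊗[G.k] G.R,
      EquivariantFGL.mk₂ J K w' = TensorProduct.map
        (quotMap φ τ h (J.1.comap τ) J.1 le_rfl) (quotMap φ τ h (K.1.comap τ) K.1 le_rfl)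
        (CovFGL.mk₂ (J.1.comap τ) (K.1.comap τ) w) ∧
      ∀ (l m : G.R →ₗ[G.k] G.k) (c c' : C), (∀ f, l (τ f) = φ (M.evalC c f)) →
        (∀ f, m (τ f) = φ (M.evalC c' f)) → pair l m w' = φ (M.eval₂ c c' w) := by
  induction w using TensorProduct.induction_on with
  | zero => exact ⟨0, by simp, by simp⟩
  | add a b ha hb =>
    obtain ⟨T, hT, hT'⟩ := ha
    obtain ⟨T', h, h'⟩ := hb
    exact ⟨T + T', by simp only [map_add, hT, h], fun l m c c' hl hm => by
      rw [map_add, map_add, map_add, hT' l m c c' hl hm, h' l m c c' hl hm]⟩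
  | tmul a b =>
    exact ⟨τ a ⊗ₜ τ b, rfl, fun l m c c' hl hm => by
      rw [pair_tmul, hl, hm, eval₂_tmul, map_mul]⟩

namespace IsHom

variable {k C : Type u} {D : Type v} [CommRing k] [CommRing C] [Bialgebra k C]
  [IsCocomm k C] [CommGroup D] {M : CovFGL D k C} {G : EquivariantFGL.{u} D}
  {φ : k →+* G.k} {Φ : C →+* G.Cov} (H : M.IsHom G.covModel φ Φ)

include H

lemma capOp_yv (V : D) (c : C) : capOp (G.yv V) (Φ c) = Φ (M.Yop M.g V c) :=
  (LinearMap.congr_fun (covOrientation_Yop V) (Φ c)).symm.trans (H.ops.map_Y V c)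

lemma divOp_eq (V : D) (c : C) : divOp V (Φ c) = Φ (M.Zop M.g V c) := by
  have h1 := G.covOps.Z_Y V (Φ (M.Zop M.g V c))
  have h2 : G.covOps.Y V (Φ (M.Zop M.g V c)) = Φ c := by
    refine (H.capOp_yv V _).trans ?_
    rw [M.Yop_Zop]
  have h3 : G.covOps.ε (Φ (M.Zop M.g V c)) = 0 := by
    refine (H.map_counit _).trans ?_
    have h4 : counit (R := k) (M.Zop M.g V c) = 0 := M.ops.ε_Z V c
    rw [h4, map_zero]
  rw [h2, h3, zero_smul, sub_zero] at h1
  exact h1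

lemma isTester : G.div.IsTester fun s l => ∃ c, M.Yl M.g s c = 0 ∧ (Φ c).1 = l where
  θ V s := ⟨M.g V, by
    rw [CapOrientation.Yl_cons, M.Yop_Yl M.grouplike, Yop_g, map_zero], by
      rw [H.map_g]
      rfl⟩
  q V s l := by
    rintro ⟨c, hc, rfl⟩
    refine ⟨M.Zop M.g V c, ?_, ?_⟩
    · rw [CapOrientation.Yl_cons, M.Yop_Yl M.grouplike, M.Yop_Zop, hc]
    · rw [← H.divOp_eq]
      rfl

lemma mem_kerProd {s : List D} {x : G.R} :
    x ∈ G.div.kerProd s ↔ ∀ c, M.Yl M.g s c = 0 → (Φ c).1 x = 0 := by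
  refine ⟨fun hf => ?_, fun h => H.isTester.mem_kerProd s (by
    rintro _ ⟨c, hc, rfl⟩
    exact h c hc)⟩
  induction s generalizing x with
  | nil =>
    intro c hc
    obtain rfl : c = 0 := hc
    rw [map_zero]
    rfl
  | cons V s ih =>
    intro c hc
    obtain ⟨z, hz, rfl⟩ := G.div.mem_kerProd_cons.mp hf
    have h1 : (Φ c).1 (G.div.y V * z) = (Φ (M.Yop M.g V c)).1 z := by
      rw [← H.capOp_yv]
      rfl
    rw [h1]
    refine ih hz _ ?_
    rw [← M.Yop_Yl M.grouplike]
    simpa using hc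

/-- The image of Φ contains the augmentations and is stable under transposed division. It therefore
tests membership in every product of kernels, even if it does not span the functionals. -/
lemma ext_total {x z : G.R} (h : ∀ c, (Φ c).1 x = (Φ c).1 z) : x = z := by
  rw [← sub_eq_zero]
  refine G.complete.separated _ fun J => ?_
  obtain ⟨s, hs⟩ := exists_kerProd_le J
  exact hs (H.mem_kerProd.mpr fun c _ => by rw [map_sub, h, sub_self])

/-- The element is built by iterated division: its remainder at V is φ(f(g_V)), and its quotient
corresponds to the quotient of f. -/
lemma exists_total_aux (s : List D) (f : M.Coord) : ∃ x : G.R, ∀ c, M.Yl M.g s c = 0 →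
    (Φ c).1 x = φ (M.evalC c f) := by
  induction s generalizing f with
  | nil =>
    refine ⟨0, fun c hc => ?_⟩
    obtain rfl : c = 0 := hc
    simp
  | cons V s ih =>
    obtain ⟨x, hx⟩ := ih (M.division.q V f)
    refine ⟨algebraMap G.k G.R (φ (M.evalC (M.g V) f)) + G.yv V * x, fun c hc => ?_⟩
    have h1 : (Φ c).1 (G.yv V * x) = (Φ (M.Yop M.g V c)).1 x := by
      rw [← H.capOp_yv]
      rfl
    have h2 : (Φ c).1 1 = φ (counit (R := k) c) := H.map_counit c
    rw [map_add, h1, hx _ (by rw [← M.Yop_Yl M.grouplike]; simpa using hc), evalC_division_q,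
      M.Zop_Yop M.grouplike, Algebra.algebraMap_eq_smul_one, map_smul, h2, map_sub, map_smul,
      LinearMap.sub_apply, LinearMap.smul_apply, map_sub, smul_eq_mul, smul_eq_mul, map_mul, mul_comm,
      add_sub_cancel]

/-- Approximations for longer lists agree with those for shorter ones modulo the corresponding
ideals, so completeness of R yields one element that works for all c. -/
lemma exists_total (f : M.Coord) : ∃ x : G.R, ∀ c, (Φ c).1 x = φ (M.evalC c f) := by
  choose x hx using fun s => H.exists_total_aux s f
  choose s hs using exists_kerProd_le (G := G)
  have hd : ∀ t t', G.div.kerProd t' ≤ G.div.kerProd t → (∀ c, M.Yl M.g t c = 0 →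
      M.Yl M.g t' c = 0) → x t' - x t ∈ G.div.kerProd t :=
    fun t t' h h' => H.mem_kerProd.mpr fun c hc => by
      rw [map_sub, hx t c hc, hx t' c (h' c hc), sub_self]
  have hl : ∀ t t', x (t ++ t') - x t ∈ G.div.kerProd t := fun t t' =>
    hd _ _ (G.div.kerProd_append_le_left _ _) fun c hc => M.Yl_append_right M.grouplike hc _
  have hr : ∀ t t', x (t' ++ t) - x t ∈ G.div.kerProd t := fun t t' =>
    hd _ _ (G.div.kerProd_append_le_right _ _) fun c hc => M.Yl_append_left hc _
  obtain ⟨z, hz⟩ := G.complete.complete (fun J => x (s J)) fun J J' hJ => by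
    simpa using sub_mem (hs J' (hr (s J') (s J))) (hJ (hs J (hl (s J) (s J'))))
  refine ⟨z, fun c => ?_⟩
  obtain ⟨t, ht⟩ := M.nil c
  have h1 : z - x t ∈ G.div.kerProd t := by
    have h3 := hs (G.kerOpen t) (hl (s (G.kerOpen t)) t)
    have h4 : z - x t = z - x (s (G.kerOpen t)) + -(x (s (G.kerOpen t) ++ t) - x (s (G.kerOpen t)))
        + (x (s (G.kerOpen t) ++ t) - x t) := by abel
    rw [h4]
    exact add_mem (add_mem (hz (G.kerOpen t)) (neg_mem h3)) (hr t _)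
  have h2 := H.mem_kerProd.mp h1 c ht
  rw [map_sub, sub_eq_zero] at h2
  rw [h2, hx t c ht]

/-- The value of the morphism from the coordinate ring. -/
def totalFun (f : M.Coord) : G.R := (H.exists_total f).choose

lemma apply_totalFun (c : C) (f : M.Coord) : (Φ c).1 (H.totalFun f) = φ (M.evalC c f) :=
  (H.exists_total f).choose_spec c

lemma apply_totalFun_mul (c : C) (f : M.Coord) (x : G.R) :
    (Φ c).1 (H.totalFun f * x) = (Φ (cap (M.coordEquiv.symm f) c)).1 x := by
  rw [← capOp_apply, ← cap_evalAt, cap_apply, cap_apply, ← H.map_comul]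
  congr 2
  generalize comul (R := k) c = w
  induction w using TensorProduct.induction_on with
  | zero => simp
  | add a b ha hb => simp only [map_add, ha, hb]
  | tmul a b =>
    rw [tensorSquare_tmul, CofreeOps.contract_tmul, CofreeOps.contract_tmul, evalAt_apply,
      H.apply_totalFun, Algebra.smul_def, Algebra.smul_def, map_mul Φ, H.map_algebraMap]
    rfl

/-- The morphism from the coordinate ring. -/
def total : M.Coord →+* G.R where
  toFun := H.totalFun
  map_one' := H.ext_total fun c => by
    rw [apply_totalFun, evalC_one]
    exact (H.map_counit c).symm
  map_zero' := H.ext_total fun c => by rw [apply_totalFun, map_zero, map_zero, map_zero]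
  map_add' f f' := H.ext_total fun c => by
    rw [map_add, apply_totalFun, apply_totalFun, apply_totalFun, map_add, map_add]
  map_mul' f f' := H.ext_total fun c => by
    rw [apply_totalFun_mul, apply_totalFun, apply_totalFun, evalC_mul]

lemma apply_total (c : C) (f : M.Coord) : (Φ c).1 (H.total f) = φ (M.evalC c f) :=
  H.apply_totalFun c f

lemma total_mem {s : List D} {f : M.Coord} (hf : f ∈ M.division.kerProd s) :
    H.total f ∈ G.div.kerProd s :=
  H.mem_kerProd.mpr fun c hc => by
    rw [apply_total, mem_division_kerProd.mp hf c hc, map_zero]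

lemma continuous_total : Continuous H.total := by
  refine continuous_of_continuousAt_zero H.total.toAddMonoidHom ?_
  rw [ContinuousAt, map_zero]
  refine (hasBasis_coord.tendsto_iff G.basis).mpr fun s _ => ?_
  induction s using Quotient.inductionOn with
  | h s =>
    refine ⟨s, trivial, fun f hf => ?_⟩
    rw [Multiset.quot_mk_to_coe, Multiset.map_coe, Multiset.prod_coe]
    exact H.total_mem hf

lemma total_algebraMap (a : k) :
    H.total (algebraMap k M.Coord a) = algebraMap G.k G.R (φ a) :=
  H.ext_total fun c => by
    have h2 : (Φ c).1 1 = φ (counit (R := k) c) := H.map_counit c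
    rw [apply_total, evalC_algebraMap, Algebra.algebraMap_eq_smul_one, map_smul, h2, map_mul,
      smul_eq_mul]

lemma mk₂_eq_zero {s t : List D} {J K : OpenIdeal G.R} (hJ : G.div.kerProd s ≤ J.1)
    (hK : G.div.kerProd t ≤ K.1) {w : G.R ⊗[G.k] G.R}
    (h : ∀ c c', M.Yl M.g s c = 0 → M.Yl M.g t c' = 0 → pair (Φ c).1 (Φ c').1 w = 0) :
    EquivariantFGL.mk₂ J K w = 0 := by
  refine H.isTester.map_mk_eq_zero hJ (Ideal.Quotient.mkₐ G.k K.1).toLinearMap w ?_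
  rintro _ ⟨c, hc, rfl⟩
  refine Ideal.Quotient.eq_zero_iff_mem.mpr (hK (H.mem_kerProd.mpr fun c' hc' => ?_))
  rw [← h c c' hc hc']
  clear h
  induction w using TensorProduct.induction_on with
  | zero => simp
  | add a b ha hb => simp only [map_add, ha, hb]
  | tmul a b => simp

/-- The morphism from the realization of a covariant bialgebra. -/
def hom : Hom M.realization G where
  base := φ
  total := H.total
  continuous_total := H.continuous_total
  map_algebraMap := H.total_algebraMap
  map_theta V f := by
    have h := H.apply_total (M.g V) f
    rw [H.map_g] at h
    exact h
  map_y := H.ext_total fun c => by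
    refine (H.apply_total c (M.division.y 1)).trans (Eq.trans ?_ (H.map_y c).symm)
    rw [ division_y_one]
    rfl
  map_comul J K f := by
    obtain ⟨s, hs⟩ := exists_kerProd_le J
    obtain ⟨t, ht⟩ := exists_kerProd_le K
    obtain ⟨w, hw⟩ := exists_represents s t f
    obtain ⟨w', hw'⟩ := EquivariantFGL.mk₂_surjective (G.kerOpen s) (G.kerOpen t)
      (comulComponent G.Δ (G.kerOpen s) (G.kerOpen t) (H.total f))
    have h1 : EquivariantFGL.mk₂ J K w' = comulComponent G.Δ J K (H.total f) := by
      rw [← comulComponent_mono (J := G.kerOpen s) (K := G.kerOpen t) hs ht, ← hw']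
      clear hw'
      induction w' using TensorProduct.induction_on with
      | zero => simp
      | add a b ha hb => simp only [map_add, ha, hb]
      | tmul a b => rfl
    obtain ⟨w'', h3, h4⟩ := exists_mk₂_eq_map φ H.total H.total_algebraMap J K w
    have h5 := comulHom_eq (J := OpenIdeal.comap H.total H.continuous_total J)
      (K := OpenIdeal.comap H.total H.continuous_total K)
      (fun x hx => hs (H.total_mem hx)) (fun x hx => ht (H.total_mem hx)) hw
    refine h1.symm.trans (Eq.trans ?_ (h3.trans (congrArg _ h5.symm)))
    rw [← sub_eq_zero, ← map_sub (EquivariantFGL.mk₂ J K)]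
    refine H.mk₂_eq_zero hs ht fun c c' hc hc' => ?_
    rw [map_sub, h4 _ _ c c' (H.apply_total c) (H.apply_total c'), hw c c' hc hc', pair_eq (Φ c) (Φ c') (fun x hx => H.mem_kerProd.mp hx c hc)
      (fun x hx => H.mem_kerProd.mp hx c' hc') _ _ hw', ← map_mul Φ]
    exact sub_eq_zero.mpr (H.apply_total (c * c') f)

end IsHom

end CovFGL

/-! ### The universal equivariant formal group law -/

lemma tensorMap_tensorMap {k k' k'' A A' A'' B B' B'' : Type*} [CommRing k] [CommRing k']
    [CommRing k''] [AddCommGroup A] [AddCommGroup A'] [AddCommGroup A''] [AddCommGroup B]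
    [AddCommGroup B'] [AddCommGroup B''] [Module k A] [Module k' A'] [Module k'' A''] [Module k B]
    [Module k' B'] [Module k'' B''] {σ : k →+* k'} {τ : k' →+* k''} {ρ : k →+* k''}
    (S : A →ₛₗ[σ] A') (T : B →ₛₗ[σ] B') (S' : A' →ₛₗ[τ] A'') (T' : B' →ₛₗ[τ] B'')
    (S'' : A →ₛₗ[ρ] A'') (T'' : B →ₛₗ[ρ] B'') (hS : ∀ a, S' (S a) = S'' a)
    (hT : ∀ b, T' (T b) = T'' b) (w : A ⊗[k] B) :
    TensorProduct.map S' T' (TensorProduct.map S T w) = TensorProduct.map S'' T'' w := by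
  induction w using TensorProduct.induction_on with
  | zero => simp
  | add a b ha hb => simp only [map_add, ha, hb]
  | tmul a b => simp [hS, hT]

namespace EquivariantFGL

namespace Hom

variable {D : Type v} [CommGroup D] {F G H : EquivariantFGL.{u} D}

/-- The identity morphism. -/
def id (F : EquivariantFGL.{u} D) : Hom F F where
  base := .id _
  total := .id _
  continuous_total := continuous_id
  map_algebraMap _ := rfl
  map_theta _ _ := rfl
  map_y := rfl
  map_comul J K x := by
    change comulComponent F.Δ J K x = TensorProduct.map _ _ (comulComponent F.Δ J K x)
    generalize comulComponent F.Δ J K x = w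
    induction w using TensorProduct.induction_on with
    | zero => simp
    | add a b ha hb =>
      conv_lhs => rw [ha, hb]
      rw [map_add]
    | tmul a b =>
      obtain ⟨a, rfl⟩ := Ideal.Quotient.mk_surjective a
      obtain ⟨b, rfl⟩ := Ideal.Quotient.mk_surjective b
      rfl

/-- The composite of morphisms. -/
def comp (g : Hom G H) (f : Hom F G) : Hom F H where
  base := g.base.comp f.base
  total := g.total.comp f.total
  continuous_total := g.continuous_total.comp f.continuous_total
  map_algebraMap c := by
    rw [RingHom.comp_apply, f.map_algebraMap, g.map_algebraMap, RingHom.comp_apply]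
  map_theta V x := by
    rw [RingHom.comp_apply, g.map_theta, f.map_theta, RingHom.comp_apply]
  map_y := by rw [RingHom.comp_apply, f.map_y, g.map_y]
  map_comul J K x := by
    refine (g.map_comul J K (f.total x)).trans ((congrArg _ (f.map_comul
      (OpenIdeal.comap g.total g.continuous_total J)
      (OpenIdeal.comap g.total g.continuous_total K) x)).trans ?_)
    exact tensorMap_tensorMap _ _ _ _ _ _ (fun a => by
      obtain ⟨a, rfl⟩ := Ideal.Quotient.mk_surjective a
      rfl) (fun b => by
      obtain ⟨b, rfl⟩ := Ideal.Quotient.mk_surjective b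
      rfl) _

end Hom

end EquivariantFGL

/-! ### Morphisms out of a realization. -/

namespace CovFGL

open Coalgebra EquivariantFGL CovTerm

variable {k C : Type u} {D : Type} [CommRing k] [CommRing C] [Bialgebra k C]
  [IsCocomm k C] [CommGroup D] {M : CovFGL D k C} {G : EquivariantFGL.{u} D}

lemma realization_total_mem (h : Hom M.realization G) {s : List D} {f : M.Coord}
    (hf : f ∈ M.division.kerProd s) : h.total f ∈ G.div.kerProd s := by
  induction s generalizing f with
  | nil => simp
  | cons V s ih =>
    obtain ⟨z, hz, rfl⟩ := M.division.mem_kerProd_cons.mp hf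
    have h1 : h.total (M.division.y V * z) = h.total (M.division.y V) * h.total z :=
      map_mul h.total _ _
    rw [h1, DivisionSystem.kerProd_cons]
    refine Ideal.mul_mem_mul ?_ (ih hz)
    change G.θ V (h.total (M.division.y V)) = 0
    refine (h.map_theta V (M.division.y V)).trans ?_
    exact (congrArg h.base (M.division.θ_y V)).trans (map_zero h.base)

/-- Every morphism is adjoint to the evaluation of terms, by induction on the term. As each element
of the universal bialgebra is a term, this forces uniqueness of morphisms out of its realization. -/
lemma apply_eval_total (h : Hom M.realization G) (t : CovTerm.{u} D) (f : M.Coord) :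
    (eval G.covModel t).1 (h.total f) = h.base (M.evalC (eval M t) f) := by
  induction t generalizing f with
  | zero =>
    have h1 : M.evalC (eval M zero) f = 0 := by
      rw [eval, map_zero, LinearMap.zero_apply]
    exact ((congrArg h.base h1).trans (map_zero h.base)).symm
  | one =>
    refine (h.map_theta 1 f).trans (congrArg h.base ?_)
    change M.evalC (M.g 1) f = M.evalC 1 f
    rw [map_one]
  | add a b ha hb =>
    refine (congrArg₂ (· + ·) (ha f) (hb f)).trans ?_
    rw [eval, map_add]
    exact (map_add h.base _ _).symm
  | neg a ha =>
    refine (congrArg (- ·) (ha f)).trans ?_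
    rw [eval, map_neg]
    exact (map_neg h.base _).symm
  | g V => exact h.map_theta V f
  | Y a ha =>
    have h1 : (eval G.covModel (CovTerm.Y a)).1 (h.total f)
        = (eval G.covModel a).1 (G.y * h.total f) := by
      change (cap (evalAt G.y) (eval G.covModel a)).1 _ = _
      rw [cap_evalAt, capOp_apply]
    have h2 : G.y * h.total f = h.total (M.division.y 1 * f) := by
      rw [← h.map_y]
      exact (map_mul h.total _ _).symm
    rw [h1, h2, ha, evalC_mul, division_y_one]
    rfl
  | Z a ha =>
    -- A morphism respects y and the counit, and y is regular; so it commutes with division by y.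
    have h1 : G.y * h.total (M.division.q 1 f) = G.yv 1 * G.div.q 1 (h.total f) := by
      refine Eq.trans ?_ (G.div.y_mul_q 1 (h.total f)).symm
      have h2 : h.total (M.division.y 1 * M.division.q 1 f)
          = h.total f - algebraMap G.k G.R (h.base (M.division.θ 1 f)) := by
        rw [M.division.y_mul_q]
        exact (map_sub h.total _ _).trans (congrArg (h.total f - ·) (h.map_algebraMap _))
      rw [← h.map_y]
      refine (map_mul h.total _ _).symm.trans (h2.trans ?_)
      exact congrArg (fun z => _ - algebraMap G.k G.R z) (h.map_theta 1 f).symm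
    rw [← yv_one] at h1
    have h3 := yv_mul_cancel h1
    change (eval G.covModel a).1 (G.div.q 1 (h.total f)) = _
    rw [← h3, ha, evalC_division_q]
    congr 2
    simp [CapOrientation.Zop_apply, eval]
  | E a ha =>
    have h1 := ha 1
    have h2 : h.total (1 : M.Coord) = 1 := map_one h.total
    rw [h2, evalC_one] at h1
    change (algebraMap G.k G.Cov ((eval G.covModel a).1 1)).1 _ = _
    rw [algebraMap_cov_apply, h1, eval, Algebra.algebraMap_eq_smul_one, map_smul,
      LinearMap.smul_apply, smul_eq_mul]
    refine Eq.trans ?_ (map_mul h.base _ _).symm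
    refine congrArg (_ * ·) ((h.map_theta 1 f).trans (congrArg h.base ?_))
    change M.evalC (M.g 1) f = M.evalC 1 f
    rw [map_one]
  | mul a b ha hb =>
    obtain ⟨s, hs⟩ := exists_cov_killed (eval G.covModel a)
    obtain ⟨t, ht⟩ := exists_cov_killed (eval G.covModel b)
    obtain ⟨s', hs'⟩ := M.nil (eval M a)
    obtain ⟨t', ht'⟩ := M.nil (eval M b)
    -- The lists must serve twice: they annihilate the two functionals on R, and they annihilate the
    -- two elements of C.
    obtain ⟨w, hw⟩ := exists_represents (s ++ s') (t ++ t') f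
    have h5 := comulHom_eq (J := OpenIdeal.comap h.total h.continuous_total (G.kerOpen s))
      (K := OpenIdeal.comap h.total h.continuous_total (G.kerOpen t))
      (fun x hx => realization_total_mem h (M.division.kerProd_append_le_left s s' hx))
      (fun x hx => realization_total_mem h (M.division.kerProd_append_le_left t t' hx)) hw
    have h6 := (h.map_comul (G.kerOpen s) (G.kerOpen t) f).trans (congrArg _ h5)
    obtain ⟨w', h3, h4⟩ := exists_mk₂_eq_map (k := k) (M := M) h.base h.total h.map_algebraMap (G.kerOpen s)
      (G.kerOpen t) w
    replace h4 := h4 _ _ _ _ ha hb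
    rw [hw _ _ (M.Yl_append_left hs' _) (M.Yl_append_left ht' _)] at h4
    refine Eq.trans ?_ h4
    exact (pair_eq (eval G.covModel a) (eval G.covModel b) hs ht _ w' (h3.trans h6.symm)).symm

end CovFGL

namespace UnivC

open Coalgebra EquivariantFGL CovTerm

variable {D : Type} [CommGroup D]

variable (D) in
/-- The universal equivariant formal group law. -/
def fgl : EquivariantFGL.{u} D := (univ.{u} D).realization

lemma apply_ev_total {G : EquivariantFGL.{u} D} (h : Hom (fgl D) G) (c : UnivC.{u} D)
    (f : (univ.{u} D).Coord) :
    (ev G.covModel c).1 (h.total f) = h.base ((univ D).evalC c f) := by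
  obtain ⟨t, rfl⟩ := mk_surjective c
  rw [ev_mk]
  refine (CovFGL.apply_eval_total h t f).trans ?_
  rw [eval_univ]
  rfl

/-- Pair with the unit of the coordinate ring, which a morphism preserves. -/
lemma base_eq {G : EquivariantFGL.{u} D} (h : Hom (fgl.{u} D) G) (l : L.{u} D) :
    h.base l = evL G.covModel l := by
  have h1 := apply_ev_total h (l : UnivC.{u} D) 1
  have h2 : h.total (1 : (univ.{u} D).Coord) = 1 := map_one h.total
  have h3 : counit (R := L.{u} D) (algebraMap (L.{u} D) (UnivC.{u} D) l) = l :=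
    Bialgebra.counit_algebraMap _
  rw [h2, CovFGL.evalC_one] at h1
  have h4 : counit (R := L.{u} D) (l : UnivC.{u} D) = l := h3
  rw [h4] at h1
  exact h1.symm

theorem isUniversal_fgl : (fgl.{u} D).IsUniversal := fun G =>
  ⟨{ default := (isHom_univ G.covModel).hom
     uniq := fun h => by
      have hb : h.base = evL G.covModel := RingHom.ext (base_eq h)
      have ht : h.total = (isHom_univ G.covModel).total := RingHom.ext fun f =>
        (isHom_univ G.covModel).ext_total fun c => by
          refine (apply_ev_total h c f).trans
            (Eq.trans ?_ ((isHom_univ G.covModel).apply_total c f).symm)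
          rw [hb]
          rfl
      rcases h with ⟨b, t, h1, h2, h3, h4, h5⟩
      obtain rfl : b = _ := hb
      obtain rfl : t = _ := ht
      rfl }⟩

end UnivC

namespace EquivariantFGL

open UnivC

variable {D E : Type} [CommGroup D] [CommGroup E]

namespace IsUniversal

lemma hom_eq {F : EquivariantFGL.{u} D} (hF : F.IsUniversal) {G : EquivariantFGL.{u} D}
    (f g : Hom F G) : f = g :=
  (@Unique.instSubsingleton _ (hF G).some).elim f g

variable {F : EquivariantFGL.{u} D} (hF : F.IsUniversal)

include hF

/-- The ground ring of a universal equivariant formal group law is the universal ring. -/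
lemma bijective_evL : Function.Bijective (evL.{u} F.covModel) := by
  let i : Hom (fgl D) F := (isUniversal_fgl F).some.default
  let j : Hom F (fgl D) := (hF (fgl D)).some.default
  have h1 : j.comp i = Hom.id _ := hom_eq isUniversal_fgl _ _
  have h2 : i.comp j = Hom.id _ := hom_eq hF _ _
  have h3 : ∀ l, j.base (i.base l) = l := fun l => congrArg (fun h => h.base l) h1
  have h4 : ∀ l, i.base (j.base l) = l := fun l => congrArg (fun h => h.base l) h2
  have h5 : ∀ l, i.base l = evL F.covModel l := base_eq i
  refine ⟨fun a b hab => ?_, fun x => ⟨j.base x, ?_⟩⟩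
  · have hab' : i.base a = i.base b := (h5 a).trans (hab.trans (h5 b).symm)
    exact (h3 a).symm.trans ((congrArg j.base hab').trans (h3 b))
  · exact (h5 _).symm.trans (h4 x)

omit hF in
lemma evL_covModel_euler (F : EquivariantFGL.{u} D) (V : D) :
    evL F.covModel (UnivC.euler V) = F.euler V := evL_euler _ V

end IsUniversal

/-! ### Comparison of restriction maps with the universal ring. -/

section Pushforward

variable (q : D →* E) (hq : Function.Surjective q) (G : EquivariantFGL.{u} E)

/-- The identification of the continuous functionals on a pushforward. -/
def covPushforward : (pushforward q hq G).Cov →+* G.Cov where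
  toFun l := ⟨l.1, l.2⟩
  map_one' := by
    refine Subtype.ext ?_
    change (G.θ (q 1)).toLinearMap = (G.θ 1).toLinearMap
    rw [map_one]
  map_zero' := rfl
  map_add' _ _ := rfl
  map_mul' l m := Subtype.ext (LinearMap.ext fun x => by
    obtain ⟨J, h⟩ := l.2
    obtain ⟨K, h'⟩ := m.2
    obtain ⟨w, hw⟩ := mk₂_surjective (G := G) J K (comulComponent G.Δ J K x)
    exact (pair_eq (G := pushforward q hq G) l m h h' x w hw).symm.trans
      (pair_eq (G := G) ⟨l.1, l.2⟩ ⟨m.1, m.2⟩ h h' x w hw))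

lemma covPushforward_apply (l : (pushforward q hq G).Cov) (x : G.R) :
    (covPushforward q hq G l).1 x = l.1 x := rfl

lemma isHom_pushforward : (pushforward q hq G).covModel.IsHom (G.covModel.pullback q hq)
    (RingHom.id G.k) (covPushforward q hq G) where
  map_algebraMap c := Subtype.ext (LinearMap.ext fun x => by
    rw [covPushforward_apply]
    refine (algebraMap_cov_apply (G := pushforward q hq G) c x).trans
      (Eq.trans ?_ (algebraMap_cov_apply (G := G) c x).symm)
    exact congrArg (fun V => HMul.hMul (α := G.k) c (G.θ V x)) (map_one q))
  map_counit _ := rfl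
  map_g _ := rfl
  map_cap l := Subtype.ext (LinearMap.ext fun x => by
    rw [covPushforward_apply]
    have h1 := cap_evalAt (G := G) G.y (covPushforward q hq G l)
    have h2 := cap_evalAt (G := pushforward q hq G) (pushforward q hq G).y l
    refine (congrArg (fun z : G.Cov => z.1 x) h1).trans
      (Eq.trans ?_ (congrArg (fun z : (pushforward q hq G).Cov => z.1 x) h2).symm)
    rfl)

lemma evL_pushforward (l : L.{u} D) :
    evL (pushforward q hq G).covModel l = evL G.covModel (res q hq l) := by
  rw [← evL_pullback q hq]
  exact map_evL (isHom_pushforward q hq G) l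

lemma IsUniversal.restriction_evL {F : EquivariantFGL.{u} D} (hF : F.IsUniversal) (l : L.{u} D) :
    hF.restriction q hq G (evL F.covModel l) = evL G.covModel (res q hq l) := by
  let i : Hom (fgl D) F := (isUniversal_fgl F).some.default
  rw [← base_eq i l, ← evL_pushforward]
  exact base_eq ((hF (pushforward q hq G)).some.default.comp i) l

end Pushforward

end EquivariantFGL

/-! ### The additive group -/

section Additive

open Coalgebra Polynomial CofreeOps

variable {k : Type u} [Field k]

instance : Bialgebra k k[X] :=
  Bialgebra.ofAlgHom (aeval (X ⊗ₜ[k] 1 + 1 ⊗ₜ[k] X)) (aeval 0)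
    (Polynomial.algHom_ext (by
      simp [TensorProduct.add_tmul, TensorProduct.tmul_add, ← Algebra.TensorProduct.one_def,
        add_assoc]
      rfl))
    (Polynomial.algHom_ext (by simp))
    (Polynomial.algHom_ext (by simp))

lemma comul_X : comul (R := k) (X : k[X]) = X ⊗ₜ[k] 1 + 1 ⊗ₜ[k] X := aeval_X _

lemma counit_polynomial (p : k[X]) : counit (R := k) p = p.eval 0 := by
  change aeval 0 p = _
  rw [coe_aeval_eq_eval]

instance : IsCocomm k k[X] where
  comm_comp_comul := by
    have h : ((Algebra.TensorProduct.comm k k[X] k[X]).toAlgHom.comp (Bialgebra.comulAlgHom k k[X]))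
        = Bialgebra.comulAlgHom k k[X] := Polynomial.algHom_ext (by
      simp [comul_X, add_comm])
    exact congrArg AlgHom.toLinearMap h

variable (k) in
/-- The functional `p ↦ p'(0)`. -/
def derivAtZero : k[X] →ₗ[k] k := (leval 0).comp derivative

lemma derivAtZero_apply (p : k[X]) : derivAtZero k p = p.derivative.eval 0 := rfl

lemma contract_derivAtZero_mul (w w' : k[X] ⊗[k] k[X]) :
    contract (derivAtZero k) (w * w') = contract (derivAtZero k) w * contract counit w'
      + contract counit w * contract (derivAtZero k) w' := by
  induction w using TensorProduct.induction_on with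
  | zero => simp
  | add a b ha hb => simp only [add_mul, map_add, ha, hb]; ring
  | tmul a b =>
    induction w' using TensorProduct.induction_on with
    | zero => simp
    | add a b ha hb => simp only [mul_add, map_add, ha, hb]; ring
    | tmul c d =>
      simp only [Algebra.TensorProduct.tmul_mul_tmul, contract_tmul, derivAtZero_apply,
        counit_polynomial, derivative_mul, eval_add, eval_mul, add_smul, smul_mul_smul_comm]

lemma cap_counit {k C : Type*} [CommRing k] [CommRing C] [Bialgebra k C] (c : C) :
    cap (counit (R := k)) c = c := by
  have h := congrArg (TensorProduct.lid k C) (rTensor_counit_comul (R := k) c)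
  rw [TensorProduct.lid_tmul, one_smul] at h
  exact h

/-- For primitive X, capping with p ↦ p'(0) is a derivation sending X to 1. In characteristic zero
it is onto with kernel the constants, so it is an orientation. -/
lemma cap_derivAtZero (p : k[X]) : cap (derivAtZero k) p = p.derivative := by
  have hmul : ∀ p q : k[X], cap (derivAtZero k) (p * q)
      = cap (derivAtZero k) p * q + p * cap (derivAtZero k) q := fun p q => by
    rw [cap_apply, Bialgebra.comul_mul, contract_derivAtZero_mul, ← cap_apply, ← cap_apply,
      ← cap_apply, ← cap_apply, cap_counit, cap_counit]
  have hone : cap (derivAtZero k) 1 = 0 := by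
    rw [cap_apply, Bialgebra.comul_one, Algebra.TensorProduct.one_def, contract_tmul]
    simp [derivAtZero_apply]
  let d : Derivation k k[X] k[X] := Derivation.mk' (cap (derivAtZero k)) fun p q => by
    rw [hmul, smul_eq_mul, smul_eq_mul]
    ring
  have h : d = derivative' := derivation_ext (by
    change cap (derivAtZero k) X = derivative' X
    rw [cap_apply, comul_X, map_add, contract_tmul, contract_tmul]
    simp [derivAtZero_apply])
  exact congrArg (fun d : Derivation k k[X] k[X] => d p) h

variable (k) in
/-- The antiderivative without constant term. -/
def antiderivative : k[X] →ₗ[k] k[X] :=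
  Polynomial.lsum fun n => ((n + 1 : k)⁻¹) • Polynomial.monomial (n + 1)

lemma antiderivative_monomial (n : ℕ) (a : k) :
    antiderivative k (monomial n a) = monomial (n + 1) ((n + 1 : k)⁻¹ * a) := by
  rw [antiderivative, lsum_apply, sum_monomial_index _ _ (by simp)]
  simp [smul_monomial]

lemma cap_derivAtZero_antiderivative [CharZero k] (p : k[X]) :
    cap (derivAtZero k) (antiderivative k p) = p := by
  rw [cap_derivAtZero]
  induction p using Polynomial.induction_on' with
  | add p q hp hq => rw [map_add, map_add, hp, hq]
  | monomial n a =>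
    have h : (n + 1 : k) ≠ 0 := Nat.cast_add_one_ne_zero n
    rw [antiderivative_monomial, derivative_monomial]
    simp only [Nat.cast_add, Nat.cast_one, add_tsub_cancel_right]
    congr 1
    field_simp

lemma antiderivative_cap_derivAtZero [CharZero k] (p : k[X]) :
    antiderivative k (cap (derivAtZero k) p) = p - algebraMap k k[X] (counit p) := by
  rw [cap_derivAtZero, counit_polynomial]
  induction p using Polynomial.induction_on' with
  | add p q hp hq => rw [map_add, map_add, hp, hq, eval_add, map_add]; abel
  | monomial n a =>
    rw [derivative_monomial, antiderivative_monomial]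
    rcases n with _ | n
    · simp
    · have h : (n + 1 : k) ≠ 0 := Nat.cast_add_one_ne_zero n
      simp only [Nat.cast_add, Nat.cast_one, add_tsub_cancel_right, eval_monomial]
      simp only [ne_eq, Nat.add_eq_zero_iff, one_ne_zero, and_false, not_false_eq_true, zero_pow,
        mul_zero, map_zero, sub_zero]
      congr 1
      field_simp

/-- The covariant bialgebra of the additive group, with trivial augmentations. -/
def additiveModel [CharZero k] (D : Type v) [CommGroup D] : CovFGL D k k[X] where
  y := derivAtZero k
  Z := antiderivative k
  cap_Z := cap_derivAtZero_antiderivative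
  Z_cap := antiderivative_cap_derivAtZero
  -- All augmentations coincide, so every Euler class is y(1) = 0.
  g := 1
  grouplike _ := .one
  nil p := by
    have h : ∀ n (p : k[X]), CapOrientation.Yl
        ⟨derivAtZero k, antiderivative k, cap_derivAtZero_antiderivative,
          antiderivative_cap_derivAtZero⟩ (1 : D →* k[X]) (List.replicate n 1) p
        = derivative^[n] p := fun n p => by
      induction n with
      | zero => rfl
      | succ n ih =>
        rw [List.replicate_succ, CapOrientation.Yl_cons, CapOrientation.Yop_apply, ih,
          Function.iterate_succ_apply']
        simp [cap_derivAtZero]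
    exact ⟨List.replicate (p.natDegree + 1) 1, by
      rw [h, iterate_derivative_eq_zero (Nat.lt_succ_self _)]⟩

end Additive

namespace UnivC

variable {D : Type} [CommGroup D]

instance : CharZero (ULift.{u} ℚ) :=
  charZero_of_injective_ringHom (f := (ULift.ringEquiv (R := ℚ)).symm.toRingHom)
    (ULift.ringEquiv (R := ℚ)).symm.injective

/-- A ring map to a field killing the Euler classes. -/
lemma exists_map_euler_eq_zero : ∃ φ : L.{u} D →+* ULift.{u} ℚ, ∀ V, φ (euler V) = 0 :=
  ⟨evL (additiveModel D), fun V => by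
    rw [evL_euler]
    exact (additiveModel (k := ULift.{u} ℚ) D).y_one⟩

instance : Nontrivial (L.{u} D) := by
  obtain ⟨φ, -⟩ := exists_map_euler_eq_zero (D := D)
  exact φ.domain_nontrivial

end UnivC

/-! ### Regularity of Euler classes -/

/-- A character of infinite order survives in the free quotient by torsion. Some basis coordinate is
nonzero on it, and a sign makes that coordinate positive. -/
lemma exists_coordinate {D : Type*} [AddCommGroup D] [Module.Finite ℤ D] (W : D)
    (hW : ∀ n : ℤ, n • W = 0 → n = 0) :
    ∃ φ : D →+ ℤ, (∃ d, φ d = 1) ∧ 0 < φ W := by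
  let b := Module.Free.chooseBasis ℤ (D ⧸ Submodule.torsion ℤ D)
  let π := (Submodule.torsion ℤ D).mkQ
  have h0 : π W ≠ 0 := fun h => by
    rw [Submodule.mkQ_apply, Submodule.Quotient.mk_eq_zero] at h
    obtain ⟨n, hn⟩ := h
    exact nonZeroDivisors.ne_zero n.2 (hW n hn)
  obtain ⟨i, hi⟩ : ∃ i, b.repr (π W) i ≠ 0 := by
    by_contra! h
    exact h0 (b.repr.map_eq_zero_iff.mp (Finsupp.ext h))
  obtain ⟨d, hd⟩ := Submodule.mkQ_surjective (Submodule.torsion ℤ D) (b i)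
  have hd' : (b.coord i ∘ₗ π) d = 1 := by
    change b.repr (π d) i = 1
    rw [show π d = b i from hd, b.repr_self, Finsupp.single_eq_same]
  rcases lt_or_gt_of_ne hi with h | h
  · exact ⟨-(b.coord i ∘ₗ π).toAddMonoidHom, ⟨-d, by
      change -((b.coord i ∘ₗ π) (-d)) = 1
      rw [map_neg, neg_neg, hd']⟩, neg_pos.mpr h⟩
  · exact ⟨(b.coord i ∘ₗ π).toAddMonoidHom, ⟨d, hd'⟩, h⟩

namespace UnivC

variable {D : Type} [CommGroup D]

theorem isRegular_euler [Group.FG D] {W : D} (hW : ∀ n : ℤ, W ^ n = 1 → n = 0) :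
    IsRegular (euler.{u} W) := by
  have : AddGroup.FG (Additive D) := inferInstance
  have : Module.Finite ℤ (Additive D) := Module.Finite.iff_addGroup_fg.mpr this
  obtain ⟨φ, ⟨d, hd⟩, hφ⟩ := exists_coordinate (Additive.ofMul W) hW
  have key : ∀ x : L.{u} D, x * euler W = 0 → x = 0 := fun x hx =>
    eq_zero_of_mul_euler (φ := AddMonoidHom.toMultiplicativeRight φ) (d := d.toMul)
      (congrArg Multiplicative.ofAdd hd) (φ (Additive.ofMul W)).toNat (by omega) W
      (Int.toNat_of_nonneg hφ.le).symm x hx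
  exact isRegular_iff_mem_nonZeroDivisors.mpr (mem_nonZeroDivisors_iff_right.mpr key)

/-- The Euler classes of independent characters form a regular sequence. -/
theorem mem_span_of_mul_euler_mem [Group.FG D] {V W : D}
    (hW : ∀ n m : ℤ, W ^ n = V ^ m → n = 0) {x : L.{u} D}
    (hx : x * euler W ∈ Ideal.span {euler V}) : x ∈ Ideal.span {euler V} := by
  -- Modulo e_V the ring is the universal ring of the quotient by V, where W still has infinite
  -- order. Torsion in this quotient is harmless.
  have hq := QuotientGroup.mk'_surjective (Subgroup.zpowers V)
  have hker := res_ker.{u} (QuotientGroup.mk' (Subgroup.zpowers V)) hq V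
    (QuotientGroup.ker_mk' _)
  rw [← hker, RingHom.mem_ker] at hx ⊢
  rw [map_mul, res_euler] at hx
  refine (isRegular_euler (W := QuotientGroup.mk' (Subgroup.zpowers V) W) fun n hn => ?_).right
    (hx.trans (zero_mul _).symm)
  rw [← map_zpow] at hn
  obtain ⟨m, hm⟩ := (QuotientGroup.eq_one_iff _).mp hn
  exact hW n m hm.symm

end UnivC

/-! ### Characters of compact abelian groups -/

section Characters

open MeasureTheory

variable {A : Type*} [CommGroup A] [TopologicalSpace A] [IsTopologicalGroup A] [CompactSpace A]

/-- A character as a continuous function. -/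
def characterFun {A : Type*} [CommGroup A] [TopologicalSpace A] (V : PontryaginDual A) : C(A, ℂ) :=
  ⟨fun a => (V a : ℂ), continuous_subtype_val.comp (map_continuous V)⟩

omit [IsTopologicalGroup A] [CompactSpace A] in
lemma characterFun_mul (V W : PontryaginDual A) :
    characterFun (V * W) = characterFun V * characterFun W :=
  ContinuousMap.ext fun a => Circle.coe_mul (V a) (W a)

omit [IsTopologicalGroup A] [CompactSpace A] in
lemma star_characterFun (V : PontryaginDual A) : star (characterFun V) = characterFun V⁻¹ :=
  ContinuousMap.ext fun a => (Circle.coe_inv_eq_conj (V a)).symm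

omit [IsTopologicalGroup A] [CompactSpace A] in
lemma characterFun_one : characterFun (1 : PontryaginDual A) = 1 := rfl

/-- The linear span of a group of characters. -/
def characterSpan {A : Type*} [CommGroup A] [TopologicalSpace A]
    (H : Subgroup (PontryaginDual A)) : StarSubalgebra ℂ C(A, ℂ) where
  __ := Submodule.span ℂ (characterFun '' (H : Set (PontryaginDual A)))
  mul_mem' {a b} ha hb := by
    have h := Submodule.mul_mem_mul ha hb
    rw [Submodule.span_mul_span] at h
    refine Submodule.span_mono ?_ h
    rintro _ ⟨_, ⟨V, hV, rfl⟩, _, ⟨W, hW, rfl⟩, rfl⟩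
    exact ⟨V * W, H.mul_mem hV hW, characterFun_mul V W⟩
  algebraMap_mem' c := by
    rw [Algebra.algebraMap_eq_smul_one]
    exact Submodule.smul_mem _ c (Submodule.subset_span ⟨1, H.one_mem, characterFun_one⟩)
  star_mem' {a} ha := by
    refine Submodule.span_induction (p := fun a _ => star a ∈ Submodule.span ℂ _) ?_ ?_ ?_ ?_ ha
    · rintro _ ⟨V, hV, rfl⟩
      exact Submodule.subset_span ⟨V⁻¹, H.inv_mem hV, (star_characterFun V).symm⟩
    · rw [star_zero]
      exact zero_mem _
    · intro a b _ _ ha hb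
      rw [star_add]
      exact add_mem ha hb
    · intro c a _ ha
      rw [star_smul]
      exact Submodule.smul_mem _ _ ha

section Integral

variable [MeasurableSpace A] [BorelSpace A]

-- Translating the integral by b multiplies it by V(b), which is not 1 for some b.
omit [CompactSpace A] in
lemma integral_characterFun_eq_zero (μ : Measure A) [μ.IsMulLeftInvariant] {V : PontryaginDual A}
    (hV : V ≠ 1) : ∫ a, characterFun V a ∂μ = 0 := by
  obtain ⟨b, hb⟩ : ∃ b, V b ≠ 1 := by
    by_contra! h
    exact hV (DFunLike.ext _ _ h)
  have h1 := integral_mul_left_eq_self (μ := μ) (characterFun V) b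
  have h2 : ∀ a, characterFun V (b * a) = characterFun V b * characterFun V a := fun a => by
    change ((V (b * a) : Circle) : ℂ) = _
    rw [map_mul, Circle.coe_mul]
    rfl
  simp only [h2] at h1
  rw [integral_const_mul] at h1
  by_contra h
  have h3 : characterFun V b = 1 := mul_right_cancel₀ h (h1.trans (one_mul _).symm)
  exact hb (Circle.ext (h3.trans Circle.coe_one.symm))

lemma integral_eq_zero_of_mem_span {H : Subgroup (PontryaginDual A)} {V : PontryaginDual A}
    (hV : V ∉ H) {f : C(A, ℂ)} (hf : f ∈ characterSpan H) :
    ∫ a, (f * characterFun V⁻¹) a ∂(Measure.haar : Measure A) = 0 := by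
  have hi : ∀ f : C(A, ℂ), Integrable (fun a => (f * characterFun V⁻¹) a) (Measure.haar : Measure A) :=
    fun f => (f * characterFun V⁻¹).continuous.integrable_of_hasCompactSupport
      (HasCompactSupport.of_compactSpace _)
  refine Submodule.span_induction (p := fun f _ =>
    ∫ a, (f * characterFun V⁻¹) a ∂(Measure.haar : Measure A) = 0) ?_ ?_ ?_ ?_ hf
  · rintro _ ⟨W, hW, rfl⟩
    rw [← characterFun_mul]
    refine integral_characterFun_eq_zero _ fun h => hV ?_
    rwa [← mul_inv_eq_one.mp h]
  · simp
  · intro f g _ _ hf hg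
    have h : ∀ a, ((f + g) * characterFun V⁻¹) a
        = (f * characterFun V⁻¹) a + (g * characterFun V⁻¹) a := fun a => by
      rw [add_mul]; rfl
    simp only [h]
    rw [integral_add (hi f) (hi g), hf, hg, add_zero]
  · intro c f _ hf
    have h : ∀ a, ((c • f) * characterFun V⁻¹) a = c • (f * characterFun V⁻¹) a := fun a => by
      rw [smul_mul_assoc]; rfl
    simp only [h]
    rw [integral_smul, hf, smul_zero]

end Integral

/-- A group of characters separating points contains all characters. -/
theorem eq_top_of_separatesPoints (H : Subgroup (PontryaginDual A))
    (hH : ∀ a b : A, a ≠ b → ∃ V ∈ H, V a ≠ V b) : H = ⊤ := by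
  borelize A
  refine eq_top_iff.mpr fun V _ => ?_
  by_contra hV
  -- By Stone–Weierstrass the span of a separating group of characters is dense, so an outside
  -- character V is uniformly within 1/2 of some f in the span.
  have hdense := ContinuousMap.starSubalgebra_topologicalClosure_eq_top_of_separatesPoints
    (characterSpan H) (fun a b hab => by
      obtain ⟨W, hW, h⟩ := hH a b hab
      exact ⟨_, ⟨characterFun W, Submodule.subset_span ⟨W, hW, rfl⟩, rfl⟩,
        fun h' => h (Circle.ext h')⟩)
  have hV' : characterFun V ∈ closure (characterSpan H : Set C(A, ℂ)) := by
    rw [← StarSubalgebra.topologicalClosure_coe, hdense]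
    trivial
  obtain ⟨f, hf, hfV⟩ := Metric.mem_closure_iff.mp hV' (1 / 2) (by norm_num)
  have h0 := integral_eq_zero_of_mem_span hV hf
  have h1 : ∀ a, (f * characterFun V⁻¹) a - 1 = (f a - characterFun V a) * characterFun V⁻¹ a := by
    intro a
    have h2 : characterFun V a * characterFun V⁻¹ a = 1 := by
      rw [← ContinuousMap.mul_apply, ← characterFun_mul, mul_inv_cancel]
      rfl
    rw [sub_mul, h2]
    rfl
  have hi : Integrable (fun a => (f * characterFun V⁻¹) a) (Measure.haar : Measure A) :=
    (f * characterFun V⁻¹).continuous.integrable_of_hasCompactSupport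
      (HasCompactSupport.of_compactSpace _)
  -- By orthogonality f·V⁻¹ has integral zero, yet it lies within 1/2 of the constant 1. The total
  -- Haar measure would be at most half of itself.
  have h3 : ‖∫ a, ((f * characterFun V⁻¹) a - 1) ∂(Measure.haar : Measure A)‖
      ≤ 1 / 2 * (Measure.haar : Measure A).real Set.univ := by
    refine norm_integral_le_of_norm_le_const (Filter.Eventually.of_forall fun a => ?_)
    rw [h1, norm_mul]
    have h4 : ‖characterFun V⁻¹ a‖ = 1 := Circle.norm_coe _
    rw [h4, mul_one, ← dist_eq_norm, dist_comm]
    exact (ContinuousMap.dist_apply_le_dist a).trans hfV.le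
  rw [integral_sub hi (integrable_const _), h0, zero_sub, norm_neg, integral_const] at h3
  have h5 : 0 < (Measure.haar : Measure A).real Set.univ :=
    ENNReal.toReal_pos (IsOpen.measure_pos _ isOpen_univ Set.univ_nonempty).ne'
      (measure_ne_top _ _)
  rw [norm_smul, Real.norm_eq_abs, abs_of_pos h5, norm_one, mul_one] at h3
  linarith

end Characters

/-! ### Character groups -/

section

variable {A : Type*} [CommGroup A] [TopologicalSpace A]

/-- Evaluation of characters. -/
def evalCharacter (a : A) : PontryaginDual A →* Circle where
  toFun V := V a
  map_one' := rfl
  map_mul' _ _ := rfl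

lemma zpow_character_apply (V : PontryaginDual A) (n : ℤ) (a : A) : (V ^ n) a = V a ^ n :=
  map_zpow (evalCharacter a) V n

lemma group_fg_of_separating [IsTopologicalGroup A] [CompactSpace A] {ι : Type*} [Finite ι]
    (V : ι → PontryaginDual A) (h : ∀ a b, (∀ i, V i a = V i b) → a = b) :
    Group.FG (PontryaginDual A) := by
  refine Group.fg_iff.mpr ⟨Set.range V, eq_top_of_separatesPoints _ fun a b hab => ?_,
    Set.finite_range V⟩
  by_contra! h'
  exact hab (h a b fun i => h' _ (Subgroup.subset_closure ⟨i, rfl⟩))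

/-- The characters that extend form a subgroup, and it separates the points of B because the
characters of A separate those of A. -/
lemma restrictCharacters_surjective [IsTopologicalGroup A] (B : Subgroup A) [CompactSpace B]
    (h : ∀ a b : A, (∀ V : PontryaginDual A, V a = V b) → a = b) :
    Function.Surjective (restrictCharacters B) := by
  rw [← MonoidHom.range_eq_top]
  refine eq_top_of_separatesPoints _ fun a b hab => ?_
  by_contra! h'
  exact hab (Subtype.ext (h _ _ fun V => h' _ ⟨V, rfl⟩))

lemma isClosed_characterKernel (V : PontryaginDual A) :
    IsClosed (characterKernel V : Set A) :=
  isClosed_singleton.preimage (map_continuous V)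

/-- A character trivial on ker V descends to the quotient by ker V. There V is injective, so its
powers separate points and are all the characters. -/
lemma restrictCharacters_characterKernel_ker [IsTopologicalGroup A] [CompactSpace A]
    (V : PontryaginDual A) :
    (restrictCharacters (characterKernel V)).ker = Subgroup.zpowers V := by
  let lift : ∀ W : PontryaginDual A, characterKernel V ≤ (W : A →* Circle).ker →
      PontryaginDual (A ⧸ characterKernel V) := fun W h =>
    ⟨QuotientGroup.lift (characterKernel V) (W : A →* Circle) h,
      (map_continuous W).quotient_lift _⟩
  let π : A →ₜ* A ⧸ characterKernel V :=
    ⟨QuotientGroup.mk' (characterKernel V), QuotientGroup.continuous_mk⟩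
  have hlift : ∀ W h, PontryaginDual.map π (lift W h) = W := fun W h => rfl
  have hV : characterKernel V ≤ (V : A →* Circle).ker := le_rfl
  refine le_antisymm (fun W hW => ?_) ((Subgroup.zpowers_le).mpr ?_)
  · have h1 : characterKernel V ≤ (W : A →* Circle).ker := fun a ha =>
      DFunLike.congr_fun (MonoidHom.mem_ker.mp hW) (⟨a, ha⟩ : characterKernel V)
    have htop := eq_top_of_separatesPoints (Subgroup.zpowers (lift V hV)) (fun a b hab => by
      refine ⟨_, Subgroup.mem_zpowers _, fun h => hab ?_⟩
      induction a using QuotientGroup.induction_on with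
      | H a =>
        induction b using QuotientGroup.induction_on with
        | H b =>
          refine QuotientGroup.eq.mpr (MonoidHom.mem_ker.mpr ?_)
          have h' : V a = V b := h
          change V (a⁻¹ * b) = 1
          rw [map_mul, map_inv, h', inv_mul_cancel])
    have h2 : lift W h1 ∈ Subgroup.zpowers (lift V hV) := htop ▸ Subgroup.mem_top _
    obtain ⟨n, hn⟩ := Subgroup.mem_zpowers_iff.mp h2
    refine Subgroup.mem_zpowers_iff.mpr ⟨n, ?_⟩
    rw [← hlift W h1, ← hn, map_zpow, hlift V hV]
  · exact MonoidHom.mem_ker.mpr (DFunLike.ext _ _ fun a => a.2)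

end

lemma circle_exists_zpow_eq {n : ℤ} (hn : n ≠ 0) (z : Circle) : ∃ w : Circle, w ^ n = z := by
  obtain ⟨x, rfl⟩ := Circle.exp_surjective z
  refine ⟨Circle.exp (x / n), ?_⟩
  rw [← Circle.exp_zsmul, zsmul_eq_mul, mul_div_cancel₀ _ (Int.cast_ne_zero.mpr hn)]

lemma isTopologicalGroup_of_equiv {A B : Type*} [CommGroup A] [TopologicalSpace A] [CommGroup B]
    [TopologicalSpace B] [IsTopologicalGroup B] (e : A ≃ₜ* B) : IsTopologicalGroup A :=
  e.toHomeomorph.isInducing.topologicalGroup e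

/-- A surjective V takes as value an n-th root of −1 for each n ≠ 0, so its n-th power is not
trivial. -/
lemma eq_zero_of_surjective_of_zpow_eq_one {A : Type*} [CommGroup A] [TopologicalSpace A]
    {V : PontryaginDual A} (hV : Function.Surjective V) (n : ℤ) (hn : V ^ n = 1) : n = 0 := by
  by_contra h0
  obtain ⟨w, hw⟩ := circle_exists_zpow_eq h0 (-1)
  obtain ⟨a, rfl⟩ := hV w
  rw [← zpow_character_apply, hn] at hw
  have h1 := congrArg (fun z : Circle => (z : ℂ)) hw
  simp only [Circle.coe_neg] at h1
  change (1 : ℂ) = -1 at h1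
  norm_num at h1

/-- A torus is divisible, so its character group is torsion-free. -/
lemma eq_zero_of_torus_of_zpow_eq_one {A : Type*} [CommGroup A] [TopologicalSpace A] {r : ℕ}
    (e : A ≃ₜ* StdTorus r) {V : PontryaginDual A} (hV : V ≠ 1) (n : ℤ) (hn : V ^ n = 1) :
    n = 0 := by
  by_contra h0
  refine hV (DFunLike.ext _ _ fun a => ?_)
  choose b hb using fun i => circle_exists_zpow_eq h0 (e a i)
  have h1 : a = e.symm b ^ n := by
    rw [← map_zpow]
    exact ((e.symm_apply_apply a).symm.trans (congrArg e.symm (funext hb)).symm)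
  rw [h1, map_zpow, ← zpow_character_apply, hn]
  rfl

/-- The coordinates of a torus times a group of roots of unity as characters. -/
def coordinateCharacter {A : Type*} [CommGroup A] [TopologicalSpace A] {r : ℕ} {B : Subgroup Circle}
    (e : A ≃ₜ* StdTorus r × B) : Option (Fin r) → PontryaginDual A
  | some i =>
    { toFun := fun a => (e a).1 i
      map_one' := by rw [map_one]; rfl
      map_mul' := fun a b => by rw [map_mul]; rfl
      continuous_toFun := by fun_prop }
  | none =>
    { toFun := fun a => (e a).2
      map_one' := by rw [map_one]; rfl
      map_mul' := fun a b => by rw [map_mul]; rfl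
      continuous_toFun := by fun_prop }

lemma eq_of_coordinateCharacter {A : Type*} [CommGroup A] [TopologicalSpace A] {r : ℕ}
    {B : Subgroup Circle} (e : A ≃ₜ* StdTorus r × B) (a b : A)
    (h : ∀ i, coordinateCharacter e i a = coordinateCharacter e i b) : a = b :=
  e.injective (Prod.ext (funext fun i => h (some i)) (Subtype.ext (h none)))

instance compactSpace_rootsOfUnityGroup (n : ℕ) : CompactSpace (RootsOfUnityGroup n) := by
  have : IsClosed (RootsOfUnityGroup n : Set Circle) :=
    isClosed_singleton.preimage (continuous_pow n)
  exact isCompact_iff_compactSpace.mp this.isCompact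

/-- A torus is the product of a torus and the trivial group. -/
lemma nonempty_torus_equiv {A : Type*} [CommGroup A] [TopologicalSpace A] {r : ℕ}
    (e : A ≃ₜ* StdTorus r) : Nonempty (A ≃ₜ* StdTorus r × RootsOfUnityGroup 1) := by
  have h : ∀ z : RootsOfUnityGroup 1, z = 1 := fun z => Subtype.ext (by
    have := MonoidHom.mem_ker.mp z.2
    simpa using this)
  exact ⟨{ toFun := fun a => (e a, 1)
           invFun := fun x => e.symm x.1
           left_inv := fun a => e.symm_apply_apply a
           right_inv := fun x => Prod.ext (e.apply_symm_apply x.1) (h x.2).symm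
           map_mul' := fun a b => Prod.ext (map_mul e a b) (one_mul 1).symm
           continuous_toFun := by fun_prop
           continuous_invFun := by fun_prop }⟩

/-! ### Regular sequences of length two -/

section RegularSequence

open scoped Pointwise

lemma isSMulRegular_of_isRegular {R : Type*} [CommRing R] {a : R} (ha : IsRegular a) :
    IsSMulRegular R a := fun _ _ h => ha.left h

lemma isRegular_pair {R : Type*} [CommRing R] {a b : R} (ha : IsRegular a)
    (hb : ∀ x, x * b ∈ Ideal.span {a} → x ∈ Ideal.span {a}) (h : Ideal.ofList [a, b] ≠ ⊤) :
    RingTheory.Sequence.IsRegular R [a, b] where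
  toIsWeaklyRegular := by
    rw [RingTheory.Sequence.isWeaklyRegular_cons_iff,
      RingTheory.Sequence.isWeaklyRegular_singleton_iff]
    refine ⟨isSMulRegular_of_isRegular ha, ?_⟩
    have hmem : ∀ x : R, x ∈ a • (⊤ : Submodule R R) ↔ x ∈ Ideal.span {a} := fun x => by
      rw [Submodule.mem_smul_pointwise_iff_exists, Ideal.mem_span_singleton]
      exact ⟨fun ⟨z, _, hz⟩ => ⟨z, hz.symm⟩, fun ⟨z, hz⟩ => ⟨z, trivial, hz.symm⟩⟩
    refine isSMulRegular_iff_right_eq_zero_of_smul.mpr fun x hx => ?_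
    obtain ⟨x, rfl⟩ := Submodule.mkQ_surjective _ x
    rw [Submodule.mkQ_apply] at hx ⊢
    rw [← Submodule.Quotient.mk_smul, Submodule.Quotient.mk_eq_zero, hmem, smul_eq_mul,
      mul_comm] at hx
    rw [Submodule.Quotient.mk_eq_zero, hmem]
    exact hb x hx
  top_ne_smul := by
    rw [smul_eq_mul, Ideal.mul_top]
    exact h.symm

end RegularSequence

/-! ### Transfer to universal equivariant formal group laws -/

namespace EquivariantFGL.IsUniversal

open UnivC

variable {D E : Type} [CommGroup D] [CommGroup E] {F : EquivariantFGL.{u} D}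
  (hF : F.IsUniversal)

/-- The isomorphism from the universal ring to the ground ring of a universal equivariant formal
group law. -/
def equivL : L.{u} D ≃+* F.k := RingEquiv.ofBijective (evL F.covModel) hF.bijective_evL

lemma equivL_euler (V : D) : hF.equivL (UnivC.euler V) = F.euler V := evL_covModel_euler F V

include hF

lemma isRegular_euler [Group.FG D] {W : D} (hW : ∀ n : ℤ, W ^ n = 1 → n = 0) :
    IsRegular (F.euler W) := by
  rw [isRegular_iff_mem_nonZeroDivisors, mem_nonZeroDivisors_iff_right]
  intro x hx
  obtain ⟨x, rfl⟩ := hF.equivL.surjective x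
  rw [← hF.equivL_euler, ← map_mul, map_eq_zero_iff _ hF.equivL.injective] at hx
  rw [(UnivC.isRegular_euler hW).right (hx.trans (zero_mul _).symm), map_zero]

lemma mem_span_of_mul_euler_mem [Group.FG D] {V W : D} (hW : ∀ n m : ℤ, W ^ n = V ^ m → n = 0)
    {x : F.k} (hx : x * F.euler W ∈ Ideal.span {F.euler V}) : x ∈ Ideal.span {F.euler V} := by
  obtain ⟨x, rfl⟩ := hF.equivL.surjective x
  rw [← hF.equivL_euler V, Ideal.mem_span_singleton] at hx ⊢
  rw [← hF.equivL_euler, ← map_mul, map_dvd_iff, ← Ideal.mem_span_singleton] at hx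
  rw [map_dvd_iff, ← Ideal.mem_span_singleton]
  exact UnivC.mem_span_of_mul_euler_mem hW hx

lemma nontrivial : Nontrivial F.k := hF.equivL.injective.nontrivial

/-- The ideal lies in the kernel of the ring map to ℚ given by the additive group. -/
lemma ofList_euler_ne_top (s : List D) : Ideal.ofList (s.map F.euler) ≠ ⊤ := by
  obtain ⟨φ, hφ⟩ := exists_map_euler_eq_zero (D := D)
  refine ne_top_of_le_ne_top (RingHom.ker_ne_top (φ.comp hF.equivL.symm.toRingHom))
    (Ideal.span_le.mpr fun x hx => ?_)
  obtain ⟨V, -, rfl⟩ := List.mem_map.mp hx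
  change φ (hF.equivL.symm (F.euler V)) = 0
  rw [← hF.equivL_euler, RingEquiv.symm_apply_apply, hφ]

omit hF in
lemma restriction_equivL (hF : F.IsUniversal) (q : D →* E) (hq : Function.Surjective q)
    {G : EquivariantFGL.{u} E} (hG : G.IsUniversal) (l : L.{u} D) :
    hF.restriction q hq G (hF.equivL l) = hG.equivL (res q hq l) :=
  hF.restriction_evL q hq G l

omit hF in
lemma restriction_surjective (hF : F.IsUniversal) (q : D →* E) (hq : Function.Surjective q)
    {G : EquivariantFGL.{u} E} (hG : G.IsUniversal) :
    Function.Surjective (hF.restriction q hq G) := fun x => by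
  obtain ⟨l, rfl⟩ := hG.equivL.surjective x
  obtain ⟨l, rfl⟩ := res_surjective q hq l
  exact ⟨hF.equivL l, restriction_equivL hF q hq hG l⟩

omit hF in
lemma restriction_ker (hF : F.IsUniversal) (q : D →* E) (hq : Function.Surjective q)
    {G : EquivariantFGL.{u} E} (hG : G.IsUniversal) {V : D} (hV : q.ker = Subgroup.zpowers V) :
    RingHom.ker (hF.restriction q hq G) = Ideal.span {F.euler V} := by
  ext x
  obtain ⟨l, rfl⟩ := hF.equivL.surjective x
  rw [RingHom.mem_ker, restriction_equivL hF q hq hG, map_eq_zero_iff _ hG.equivL.injective,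
    ← RingHom.mem_ker, res_ker q hq V hV, ← hF.equivL_euler, Ideal.mem_span_singleton,
    Ideal.mem_span_singleton, map_dvd_iff]

/-- Euler classes of at most two independent characters form a regular sequence. -/
theorem isRegular_ofFn [Group.FG D] (l : ℕ) (hl : l ≤ 2) (V : Fin l → D)
    (hV : LinearIndependent ℤ fun i => Additive.ofMul (V i)) :
    RingTheory.Sequence.IsRegular F.k (List.ofFn fun i => F.euler (V i)) := by
  have htop : Ideal.ofList (List.ofFn fun i => F.euler (V i)) ≠ ⊤ := by
    have h := hF.ofList_euler_ne_top (List.ofFn V)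
    rwa [List.map_ofFn] at h
  have hreg : ∀ i, IsRegular (F.euler (V i)) := fun i => hF.isRegular_euler fun n hn => by
    have h := linearIndependent_iff'.mp hV {i} (fun _ => n)
      (by simpa using congrArg Additive.ofMul hn)
    exact h i (Finset.mem_singleton_self i)
  interval_cases l
  · have := hF.nontrivial
    exact RingTheory.Sequence.IsRegular.nil _ _
  · rw [List.ofFn_succ, List.ofFn_zero] at htop ⊢
    refine ⟨(RingTheory.Sequence.isWeaklyRegular_singleton_iff _ _).mpr
      (isSMulRegular_of_isRegular (hreg 0)), ?_⟩
    rw [smul_eq_mul, Ideal.mul_top]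
    exact htop.symm
  · have hlist : (List.ofFn fun i => F.euler (V i)) = [F.euler (V 0), F.euler (V 1)] := by
      simp [List.ofFn_succ]
    rw [hlist] at htop ⊢
    refine isRegular_pair (hreg 0) (fun x hx => hF.mem_span_of_mul_euler_mem (fun n m h => ?_) hx)
      htop
    -- The equality V₁ⁿ = V₀ᵐ is the linear relation with coefficients −m and n.
    have h1 := (Fintype.linearIndependent_iff.mp hV ![-m, n] (by
      have h2 : n • Additive.ofMul (V 1) = m • Additive.ofMul (V 0) := congrArg Additive.ofMul h
      simp [Fin.sum_univ_two, h2])) 1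
    simpa using h1

end EquivariantFGL.IsUniversal

end

theorem mainTheorem8 :
    -- existence of the equivariant Lazard rings
    (∀ (A : Type) [CommGroup A] [TopologicalSpace A], IsAbelianCompactLie A →
      ∃ F : EquivariantFGL.{u} (PontryaginDual A), F.IsUniversal) ∧
    -- regular sequences of Euler classes at tori
    (∀ (A : Type) [CommGroup A] [TopologicalSpace A] (r : ℕ), Nonempty (A ≃ₜ* StdTorus r) →
      ∀ F : EquivariantFGL.{u} (PontryaginDual A), F.IsUniversal →
        (∀ V : PontryaginDual A, V ≠ 1 → IsRegular (F.euler V)) ∧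
        (∀ l : ℕ, l ≤ 2 → ∀ V : Fin l → PontryaginDual A,
          LinearIndependent ℤ (fun i => Additive.ofMul (V i)) →
            RingTheory.Sequence.IsRegular F.k (List.ofFn fun i => F.euler (V i)))) ∧
    -- exact sequences for surjective characters of products of a torus and a cyclic group
    (∀ (A : Type) [CommGroup A] [TopologicalSpace A] (r n : ℕ), 1 ≤ n →
      Nonempty (A ≃ₜ* StdTorus r × RootsOfUnityGroup n) →
      ∀ (F : EquivariantFGL.{u} (PontryaginDual A)) (hF : F.IsUniversal)
        (V : PontryaginDual A), Function.Surjective V →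
        IsRegular (F.euler V) ∧
        ∃ hq : Function.Surjective (restrictCharacters (characterKernel V)),
          ∀ G : EquivariantFGL.{u} (PontryaginDual (characterKernel V)), G.IsUniversal →
            Function.Surjective
              (hF.restriction (restrictCharacters (characterKernel V)) hq G) ∧
            RingHom.ker (hF.restriction (restrictCharacters (characterKernel V)) hq G)
              = Ideal.span {F.euler V}) := by
  refine ⟨fun A _ _ _ => ⟨UnivC.fgl _, UnivC.isUniversal_fgl⟩, ?_, ?_⟩
  · rintro A _ _ r ⟨e⟩ F hF
    obtain ⟨e'⟩ := nonempty_torus_equiv e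
    have := isTopologicalGroup_of_equiv e'
    have : CompactSpace A := e'.toHomeomorph.symm.compactSpace
    have := group_fg_of_separating (coordinateCharacter e') (eq_of_coordinateCharacter e')
    exact ⟨fun V hV => hF.isRegular_euler (eq_zero_of_torus_of_zpow_eq_one e hV),
      fun l hl V hV => hF.isRegular_ofFn l hl V hV⟩
  · rintro A _ _ r n - ⟨e⟩ F hF V hV
    have := isTopologicalGroup_of_equiv e
    have : CompactSpace A := e.toHomeomorph.symm.compactSpace
    have : CompactSpace (characterKernel V) :=
      isCompact_iff_compactSpace.mp (isClosed_characterKernel V).isCompact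
    have := group_fg_of_separating (coordinateCharacter e) (eq_of_coordinateCharacter e)
    -- The coordinate characters separate the points of A, hence so do all the characters.
    have hq := restrictCharacters_surjective (characterKernel V) fun a b h =>
      eq_of_coordinateCharacter e a b fun i => h _
    exact ⟨hF.isRegular_euler (eq_zero_of_surjective_of_zpow_eq_one hV), hq, fun G hG =>
      ⟨hF.restriction_surjective _ hq hG,
        hF.restriction_ker _ hq hG (restrictCharacters_characterKernel_ker V)⟩⟩
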